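/- Let $0<\alpha\le 1$, $L>0$ and $c,g,P_{\rm atm}\in\mathbb R$. The subscript $per$ means $L$-periodic in the horizontal variable; $C^{0,\alpha}$ and $C^{1,\alpha}$ on the closure of an open set are the usual Hölder spaces (derivatives in the open set, extended continuously to the closure). For $\eta:\mathbb R\to(0,\infty)$ let $D_\eta=\{(x,y): 0<y<\eta(x)\}$, and for $p_0<0$ let $R=\{(q,p): p_0<p<0\}$. Differential equations in $D_\eta$ and $R$ are understood in the sense of distributions, boundary conditions and inequalities pointwise. Consider the following problems. (i) *Weak velocity formulation*: $\eta\in C^{1,\alpha}_{per}(\mathbb R)$, $\eta>0$, and $u,v,P\in C^{0,\alpha}_{per}(\overline{D_\eta})$ with $u<c$ in $\overline{D_\eta}$ satisfy $$(u-c)_x+v_y=0,\qquad ((u-c)^2)_x+((u-c)v)_y=-P_x,\qquad ((u-c)v)_x+(v^2)_y=-P_y-g\quad\text{in }D_\eta,$$ $v=0$ on $y=0$, and $v=(u-c)\eta_x$, $P=P_{\rm atm}$ on $y=\eta(x)$. (ii) *Weak stream function formulation*: for constants $p_0<0$, $Q\in\mathbb R$ and a function $\Gamma\in C^{0,\alpha}([p_0,0])$,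 the functions $\eta\in C^{1,\alpha}_{per}(\mathbb R)$, $\eta>0$, and $\psi\in C^{1,\alpha}_{per}(\overline{D_\eta})$ with $\psi_y<0$ in $\overline{D_\eta}$ satisfy $$(\psi_x\psi_y)_x-\tfrac12(\psi_x^2-\psi_y^2)_y-(\Gamma(-\psi))_y=0\quad\text{in }D_\eta,$$ $\psi=-p_0$ on $y=0$, and $\psi=0$, $|\nabla\psi|^2+2gy=Q$ on $y=\eta(x)$. (iii) *Weak height (Dubreil-Jacotin) formulation*: for constants $p_0<0$, $Q\in\mathbb R$ and a function $\Gamma\in C^{0,\alpha}([p_0,0])$, the function $h\in C^{1,\alpha}_{per}(\overline R)$ with $h_p>0$ in $\overline R$ satisfies $$\Big\{-\frac{1+h_q^2}{2h_p^2}+\Gamma(p)\Big\}_p+\Big\{\frac{h_q}{h_p}\Big\}_q=0\quad\text{in }R,$$ $h=0$ on $p=p_0$, and $\frac{1+h_q^2}{2h_p^2}+gh-\frac Q2=0$ on $p=0$. Then (ii) and (iii) are equivalent for every $\alpha\in(0,1]$: for each solution of one there is a solution of the other, with the same $p_0,Q,\Gamma$, such that $\eta(q)=h(q,0)$ and the maps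 $(x,y)\mapsto(x,-\psi(x,y))$ and $(q,p)\mapsto(q,h(q,p))$ are mutually inverse bijections between $\overline{D_\eta}$ and $\overline R$. If moreover $\alpha\in(1/3,1]$, then (i) and (ii), and hence all three formulations, are equivalent: for each solution of (i) there are $p_0,Q,\Gamma,\psi$ solving (ii) with the same $\eta$, and for each solution of (ii) there are $u,v,P$ solving (i) with the same $\eta$, such that in both cases $$\psi_y=u-c,\qquad \psi_x=-v,\qquad P+\tfrac12|\nabla\psi|^2+gy-\Gamma(-\psi)=\text{constant}\quad\text{in }\overline{D_\eta}.$$ In particular, for $\alpha\in(1/3,1]$ and a given $\eta:\mathbb R\to\mathbb R$ the following are equivalent: (i) has a solution with free surface $\eta$; (ii) has a solution with free surface $\eta$ for some $p_0,Q,\Gamma$; (iii) has a solution with $h(\cdot,0)=\eta$ for some $p_0,Q,\Gamma$. -/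

import Mathlib

open Set MeasureTheory Topology
open scoped NNReal ContDiff

namespace WaterWaves

noncomputable section

/-! ### Function spaces on planar domains -/

/-- `f` is Hölder continuous on `s` with exponent `α`. For the horizontally periodic functions on
horizontally periodic strips used below, boundedness is automatic. -/
def HolderOn {X : Type*} [PseudoEMetricSpace X] (α : ℝ≥0) (f : X → ℝ) (s : Set X) : Prop :=
  ∃ C : ℝ≥0, HolderOnWith C α f s

/-- `f` has period `L` in the first (horizontal) variable, on the set `s`. -/
def PeriodicOn (L : ℝ) (f : ℝ × ℝ → ℝ) (s : Set (ℝ × ℝ)) : Prop :=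
  ∀ z ∈ s, f (z.1 + L, z.2) = f z

/-- The classical partial derivative of `f` in the first variable. -/
def partial₁ (f : ℝ × ℝ → ℝ) (z : ℝ × ℝ) : ℝ := fderiv ℝ f z (1, 0)

/-- The classical partial derivative of `f` in the second variable. -/
def partial₂ (f : ℝ × ℝ → ℝ) (z : ℝ × ℝ) : ℝ := fderiv ℝ f z (0, 1)

/-- The first partial derivative of `f` in the open set `D`, extended by continuity to the closure
of `D`. -/
def d₁ (D : Set (ℝ × ℝ)) (f : ℝ × ℝ → ℝ) : ℝ × ℝ → ℝ := extendFrom D (partial₁ f)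

/-- The second partial derivative of `f` in the open set `D`, extended by continuity to the closure
of `D`. -/
def d₂ (D : Set (ℝ × ℝ)) (f : ℝ × ℝ → ℝ) : ℝ × ℝ → ℝ := extendFrom D (partial₂ f)

/-- The space `C^{0,α}_per` of the closure of `D`. -/
structure C0HolderPer (α : ℝ≥0) (L : ℝ) (D : Set (ℝ × ℝ)) (f : ℝ × ℝ → ℝ) : Prop where
  holder : HolderOn α f (closure D)
  periodic : PeriodicOn L f (closure D)

/-- The space `C^{1,α}_per` of the closure of the open set `D`: continuous on the closure,
differentiable in `D`, with first derivatives that are Hölder continuous in `D` (so that they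
extend continuously to the closure, with the same exponent and constant). -/
structure C1HolderPer (α : ℝ≥0) (L : ℝ) (D : Set (ℝ × ℝ)) (f : ℝ × ℝ → ℝ) : Prop where
  continuousOn : ContinuousOn f (closure D)
  differentiableOn : DifferentiableOn ℝ f D
  holder₁ : HolderOn α (partial₁ f) D
  holder₂ : HolderOn α (partial₂ f) D
  periodic : PeriodicOn L f (closure D)

/-- The space `C^{1,α}_per` of the real line. -/
structure C1HolderPerLine (α : ℝ≥0) (L : ℝ) (η : ℝ → ℝ) : Prop where
  differentiable : Differentiable ℝ η
  holder : HolderOn α (deriv η) univ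
  periodic : Function.Periodic η L

/-! ### Distributional equations -/

/-- Test functions: smooth, with compact support contained in `D`. -/
structure IsTestFunction (D : Set (ℝ × ℝ)) (φ : ℝ × ℝ → ℝ) : Prop where
  smooth : ContDiff ℝ ∞ φ
  hasCompactSupport : HasCompactSupport φ
  tsupport_subset : tsupport φ ⊆ D

/-- The equation `∂₁ a + ∂₂ b = s` in `D`, in the sense of distributions. -/
def WeakDivEq (D : Set (ℝ × ℝ)) (a b s : ℝ × ℝ → ℝ) : Prop :=
  ∀ φ : ℝ × ℝ → ℝ, IsTestFunction D φ →
    ∫ z in D, (a z * partial₁ φ z + b z * partial₂ φ z) = - ∫ z in D, s z * φ z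

/-! ### The three weak formulations -/

/-- The fluid domain `0 < y < η x`. -/
def fluidDomain (η : ℝ → ℝ) : Set (ℝ × ℝ) := {z | 0 < z.2 ∧ z.2 < η z.1}

/-- The open strip `p₀ < p < 0`. -/
def strip (p₀ : ℝ) : Set (ℝ × ℝ) := {z | p₀ < z.2 ∧ z.2 < 0}

/-- Weak velocity formulation, with `u < c` up to the boundary. The momentum equations are
`((u-c)² + P)_x + ((u-c)v)_y = 0` and `((u-c)v)_x + (v² + P)_y = -g`. -/
structure IsVelocitySolution (α : ℝ≥0) (L c g Patm : ℝ) (η : ℝ → ℝ) (u v P : ℝ × ℝ → ℝ) :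
    Prop where
  η_reg : C1HolderPerLine α L η
  η_pos : ∀ x, 0 < η x
  u_reg : C0HolderPer α L (fluidDomain η) u
  v_reg : C0HolderPer α L (fluidDomain η) v
  P_reg : C0HolderPer α L (fluidDomain η) P
  mass : WeakDivEq (fluidDomain η) (fun z => u z - c) v (fun _ => 0)
  momentum₁ : WeakDivEq (fluidDomain η) (fun z => (u z - c) ^ 2 + P z)
    (fun z => (u z - c) * v z) (fun _ => 0)
  momentum₂ : WeakDivEq (fluidDomain η) (fun z => (u z - c) * v z)
    (fun z => v z ^ 2 + P z) (fun _ => -g)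
  bottom : ∀ x, v (x, 0) = 0
  kinematic : ∀ x, v (x, η x) = (u (x, η x) - c) * deriv η x
  dynamic : ∀ x, P (x, η x) = Patm
  no_stagnation : ∀ z ∈ closure (fluidDomain η), u z < c

/-- Weak stream function formulation, with `ψ_y < 0` up to the boundary. -/
structure IsStreamSolution (α : ℝ≥0) (L g p₀ Q : ℝ) (Γ : ℝ → ℝ) (η : ℝ → ℝ) (ψ : ℝ × ℝ → ℝ) :
    Prop where
  p₀_neg : p₀ < 0
  Γ_reg : HolderOn α Γ (Icc p₀ 0)
  η_reg : C1HolderPerLine α L η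
  η_pos : ∀ x, 0 < η x
  ψ_reg : C1HolderPer α L (fluidDomain η) ψ
  interior : WeakDivEq (fluidDomain η)
    (fun z => d₁ (fluidDomain η) ψ z * d₂ (fluidDomain η) ψ z)
    (fun z => -(1 / 2) * (d₁ (fluidDomain η) ψ z ^ 2 - d₂ (fluidDomain η) ψ z ^ 2) - Γ (-ψ z))
    (fun _ => 0)
  bottom : ∀ x, ψ (x, 0) = -p₀
  top : ∀ x, ψ (x, η x) = 0
  bernoulli : ∀ x, d₁ (fluidDomain η) ψ (x, η x) ^ 2 + d₂ (fluidDomain η) ψ (x, η x) ^ 2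
    + 2 * g * η x = Q
  no_stagnation : ∀ z ∈ closure (fluidDomain η), d₂ (fluidDomain η) ψ z < 0

/-- Weak height (Dubreil-Jacotin) formulation, with `h_p > 0` up to the boundary. -/
structure IsHeightSolution (α : ℝ≥0) (L g p₀ Q : ℝ) (Γ : ℝ → ℝ) (h : ℝ × ℝ → ℝ) : Prop where
  p₀_neg : p₀ < 0
  Γ_reg : HolderOn α Γ (Icc p₀ 0)
  h_reg : C1HolderPer α L (strip p₀) h
  interior : WeakDivEq (strip p₀)
    (fun z => d₁ (strip p₀) h z / d₂ (strip p₀) h z)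
    (fun z => -((1 + d₁ (strip p₀) h z ^ 2) / (2 * d₂ (strip p₀) h z ^ 2)) + Γ z.2)
    (fun _ => 0)
  bottom : ∀ q, h (q, p₀) = 0
  bernoulli : ∀ q, (1 + d₁ (strip p₀) h (q, 0) ^ 2) / (2 * d₂ (strip p₀) h (q, 0) ^ 2)
    + g * h (q, 0) - Q / 2 = 0
  no_stagnation : ∀ z ∈ closure (strip p₀), 0 < d₂ (strip p₀) h z

/-! ### The correspondences between the unknowns -/

/-- `ψ` is a stream function of `(u - c, v)`, and `P` is given by Bernoulli's law with
function `Γ`, up to an additive constant. -/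
structure VelocityStreamCorr (c g : ℝ) (Γ : ℝ → ℝ) (η : ℝ → ℝ) (u v P ψ : ℝ × ℝ → ℝ) :
    Prop where
  ψ_y : ∀ z ∈ closure (fluidDomain η), d₂ (fluidDomain η) ψ z = u z - c
  ψ_x : ∀ z ∈ closure (fluidDomain η), d₁ (fluidDomain η) ψ z = -v z
  bernoulli : ∃ K : ℝ, ∀ z ∈ closure (fluidDomain η),
    P z + 1 / 2 * (d₁ (fluidDomain η) ψ z ^ 2 + d₂ (fluidDomain η) ψ z ^ 2)
      + g * z.2 - Γ (-ψ z) = K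

/-- The maps `(x, y) ↦ (x, -ψ (x, y))` and `(q, p) ↦ (q, h (q, p))` are inverse bijections
between the closure of the fluid domain and the closed strip. -/
structure StreamHeightCorr (p₀ : ℝ) (η : ℝ → ℝ) (ψ h : ℝ × ℝ → ℝ) : Prop where
  maps_stream : ∀ z ∈ closure (fluidDomain η), (z.1, -ψ z) ∈ closure (strip p₀)
  maps_height : ∀ z ∈ closure (strip p₀), (z.1, h z) ∈ closure (fluidDomain η)
  ψ_h : ∀ z ∈ closure (strip p₀), -ψ (z.1, h z) = z.2
  h_ψ : ∀ z ∈ closure (fluidDomain η), h (z.1, -ψ z) = z.2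

end

end WaterWaves

open WaterWaves

/-! All the interior equations are in divergence form, and weak divergence equations survive a `C¹`
change of variables. Put f = -ψ. The map (x, y) ↦ (x, f(x, y)) carries the fluid domain onto the
strip with Jacobian f_y > 0; its inverse is (q, p) ↦ (q, h(q, p)), where h_q = -f_x/f_y and h_p =
1/f_y. The Piola transform of the field in (ii) is, up to sign, the field in (iii). This works for
every positive Hölder exponent, provided that `C¹` test functions are admitted. The carriers are
`exists_bandPair`, `BandPair.weakC1` and `BandPair.isStreamSolution_iff`.

For (i) and (ii), mass conservation provides ψ. With the total head E = P + ½|∇ψ|² + gy, the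
momentum equations read A = 0 and B = 0, where A = (ψ_x ψ_y)_x + (½(ψ_y² - ψ_x²) - E)_y and B =
(½(ψ_x² - ψ_y²) - E)_x + (ψ_x ψ_y)_y. The equation A = 0 is that of (ii) with E in place of Γ(-ψ).
That E is a function of ψ alone amounts to the transport equation T = (ψ_y E)_x - (ψ_x E)_y = 0,
which in the variables (q, p) says E_q = 0. For smooth functions ψ_y B + T = ψ_x A. Hence, once A =
0, the equation B = 0 yields T = 0, and T = 0 yields B = 0 because ψ_y does not vanish.

For Hölder continuous ∇ψ and E the product ψ_y B has no direct meaning, and the identity is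
recovered by mollification at scale ε. Replacing mollified products by products of mollifications
costs commutators of order ε^(2α). After integration by parts they meet factors whose derivatives
are of order ε^(α-1), so the total error is of order ε^(3α-1) and disappears for α > 1/3. This is
the mechanism of Constantin, E and Titi for Onsager's conjecture; see
`tendsto_integral_momentum_add_transport`, `weakC1_transport` and `weakC1_momentum`.

The kinematic condition says that ψ is constant along the free surface. To make sense of this, ψ is
differentiated along boundary curves as a uniform limit of interior curves
(`C1Data.hasDerivAt_curve`). -/

namespace WaterWaves

noncomputable section

/-! ### Bounded Hölder continuous functions -/

/-- Bounded Hölder continuous functions on a metric space. -/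
def BddHolder {X : Type*} [PseudoMetricSpace X] (α : ℝ) (f : X → ℝ) : Prop :=
  ∃ C, 0 ≤ C ∧ (∀ z, |f z| ≤ C) ∧ ∀ z w, |f z - f w| ≤ C * dist z w ^ α

namespace BddHolder

variable {X : Type*} [PseudoMetricSpace X] {α : ℝ} {f g : X → ℝ}

lemma const (c : ℝ) : BddHolder α (fun _ : X => c) :=
  ⟨|c|, abs_nonneg _, fun _ => le_rfl, fun z w => by
    simpa using mul_nonneg (abs_nonneg c) (Real.rpow_nonneg dist_nonneg _)⟩

lemma add (hf : BddHolder α f) (hg : BddHolder α g) : BddHolder α (fun z => f z + g z) := by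
  obtain ⟨C, hC, hC₁, hC₂⟩ := hf
  obtain ⟨K, hK, hK₁, hK₂⟩ := hg
  refine ⟨C + K, by positivity, fun z => (abs_add_le _ _).trans (add_le_add (hC₁ z) (hK₁ z)),
    fun z w => ?_⟩
  calc |f z + g z - (f w + g w)| = |(f z - f w) + (g z - g w)| := by ring_nf
    _ ≤ _ := (abs_add_le _ _).trans (add_le_add (hC₂ z w) (hK₂ z w))
    _ = _ := by ring

lemma mul (hf : BddHolder α f) (hg : BddHolder α g) : BddHolder α (fun z => f z * g z) := by
  obtain ⟨C, hC, hC₁, hC₂⟩ := hf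
  obtain ⟨K, hK, hK₁, hK₂⟩ := hg
  refine ⟨2 * (C * K), by positivity, fun z => ?_, fun z w => ?_⟩
  · rw [abs_mul]
    nlinarith [mul_le_mul (hC₁ z) (hK₁ z) (abs_nonneg _) hC, mul_nonneg hC hK]
  · calc |f z * g z - f w * g w| = |(f z - f w) * g z + f w * (g z - g w)| := by ring_nf
      _ ≤ |f z - f w| * |g z| + |f w| * |g z - g w| := by
        simpa only [abs_mul] using abs_add_le ((f z - f w) * g z) (f w * (g z - g w))
      _ ≤ (C * dist z w ^ α) * K + C * (K * dist z w ^ α) := by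
        have := Real.rpow_nonneg (dist_nonneg (x := z) (y := w)) α
        gcongr
        exacts [hC₂ z w, hK₁ z, hC₁ w, hK₂ z w]
      _ = _ := by ring

lemma neg (hf : BddHolder α f) : BddHolder α (fun z => -f z) := by
  simpa using (const (-1 : ℝ)).mul hf

lemma sub (hf : BddHolder α f) (hg : BddHolder α g) : BddHolder α (fun z => f z - g z) := by
  simpa only [sub_eq_add_neg] using hf.add hg.neg

lemma sq (hf : BddHolder α f) : BddHolder α (fun z => f z ^ 2) := by
  simpa only [pow_two] using hf.mul hf

lemma inv (hf : BddHolder α f) {m : ℝ} (hm : 0 < m) (h : ∀ z, m ≤ |f z|) :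
    BddHolder α (fun z => (f z)⁻¹) := by
  obtain ⟨C, hC, hC₁, hC₂⟩ := hf
  refine ⟨m⁻¹ + C * (m⁻¹ * m⁻¹), by positivity, fun z => ?_, fun z w => ?_⟩
  · rw [abs_inv]
    have : |f z|⁻¹ ≤ m⁻¹ := inv_anti₀ hm (h z)
    have : 0 ≤ C * (m⁻¹ * m⁻¹) := by positivity
    linarith
  · have hz : f z ≠ 0 := abs_pos.1 (hm.trans_le (h z))
    have hw : f w ≠ 0 := abs_pos.1 (hm.trans_le (h w))
    have e : (f z)⁻¹ - (f w)⁻¹ = (f w - f z) * ((f z)⁻¹ * (f w)⁻¹) := by field_simp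
    have hd := Real.rpow_nonneg (dist_nonneg (x := z) (y := w)) α
    rw [e, abs_mul, abs_mul, abs_inv, abs_inv, abs_sub_comm]
    calc |f z - f w| * (|f z|⁻¹ * |f w|⁻¹) ≤ (C * dist z w ^ α) * (m⁻¹ * m⁻¹) := by
          gcongr
          exacts [hC₂ z w, h z, h w]
      _ = (C * (m⁻¹ * m⁻¹)) * dist z w ^ α := by ring
      _ ≤ _ := by
        gcongr
        have : 0 < m⁻¹ := by positivity
        linarith

lemma div (hf : BddHolder α f) (hg : BddHolder α g) {m : ℝ} (hm : 0 < m) (h : ∀ z, m ≤ |g z|) :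
    BddHolder α (fun z => f z / g z) := by
  simpa only [div_eq_mul_inv] using hf.mul (hg.inv hm h)

lemma comp_lipschitz {Y : Type*} [PseudoMetricSpace Y] (hα : 0 ≤ α) (hf : BddHolder α f)
    {φ : Y → X} {K : ℝ} (hK : ∀ y y', dist (φ y) (φ y') ≤ K * dist y y') :
    BddHolder α (fun y => f (φ y)) := by
  obtain ⟨C, hC, hC₁, hC₂⟩ := hf
  refine ⟨C + C * (max K 0) ^ α, by positivity, fun z => ?_, fun z w => ?_⟩
  · have : 0 ≤ C * (max K 0) ^ α := by positivity
    linarith [hC₁ (φ z)]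
  · have h1 : dist (φ z) (φ w) ≤ max K 0 * dist z w :=
      (hK z w).trans (by gcongr; exact le_max_left _ _)
    calc |f (φ z) - f (φ w)| ≤ C * dist (φ z) (φ w) ^ α := hC₂ _ _
      _ ≤ C * (max K 0 * dist z w) ^ α := by gcongr
      _ = C * (max K 0) ^ α * dist z w ^ α := by
        rw [Real.mul_rpow (le_max_right _ _) dist_nonneg]; ring
      _ ≤ _ := by gcongr; linarith

/-- At distances at most one the Lipschitz bound suffices, since t ≤ t^α there. At larger distances
twice the supremum suffices, since t^α ≥ 1. -/
lemma of_lipschitz (hα₀ : 0 ≤ α) (hα : α ≤ 1) {C K : ℝ} (hC : ∀ z, |f z| ≤ C)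
    (hK : ∀ z w, |f z - f w| ≤ K * dist z w) : BddHolder α f := by
  rcases isEmpty_or_nonempty X with hX | ⟨⟨z₀⟩⟩
  · exact ⟨0, le_rfl, fun z => hX.elim z, fun z => hX.elim z⟩
  have hC0 : 0 ≤ C := (abs_nonneg _).trans (hC z₀)
  refine ⟨|K| + 2 * C, by positivity, fun z => by linarith [hC z, abs_nonneg K], fun z w => ?_⟩
  have h1 : |f z - f w| ≤ |K| * dist z w :=
    (hK z w).trans (by gcongr; exact le_abs_self K)
  rcases le_total (dist z w) 1 with hd | hd
  · have h2 : dist z w ≤ dist z w ^ α := by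
      simpa using Real.rpow_le_rpow_of_exponent_ge_of_imp dist_nonneg hd hα (by simp)
    calc |f z - f w| ≤ |K| * dist z w := h1
      _ ≤ |K| * dist z w ^ α := by gcongr
      _ ≤ _ := by gcongr; linarith
  · have h2 : 1 ≤ dist z w ^ α := Real.one_le_rpow hd hα₀
    calc |f z - f w| ≤ |f z| + |f w| := abs_sub _ _
      _ ≤ 2 * C := by linarith [hC z, hC w]
      _ ≤ (2 * C) * dist z w ^ α := le_mul_of_one_le_right (by positivity) h2
      _ ≤ _ := by gcongr; linarith [abs_nonneg K]

lemma exists_holderWith {r : ℝ≥0} (hf : BddHolder (r : ℝ) f) : ∃ C : ℝ≥0, HolderWith C r f := by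
  obtain ⟨C, hC, -, hC₂⟩ := hf
  lift C to ℝ≥0 using hC
  refine ⟨C, fun z w => ?_⟩
  rw [edist_dist, edist_dist, Real.dist_eq, ENNReal.ofReal_rpow_of_nonneg dist_nonneg r.coe_nonneg,
    ← ENNReal.ofReal_coe_nnreal, ← ENNReal.ofReal_mul C.coe_nonneg]
  exact ENNReal.ofReal_le_ofReal (hC₂ z w)

lemma holderOn {r : ℝ≥0} (hf : BddHolder (r : ℝ) f) (s : Set X) : HolderOn r f s :=
  let ⟨C, hC⟩ := hf.exists_holderWith
  ⟨C, hC.holderOnWith s⟩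

lemma uniformContinuous (hα : 0 < α) (hf : BddHolder α f) : UniformContinuous f := by
  lift α to ℝ≥0 using hα.le
  obtain ⟨C, hC⟩ := hf.exists_holderWith
  exact hC.uniformContinuous (by exact_mod_cast hα)

lemma continuous (hα : 0 < α) (hf : BddHolder α f) : Continuous f :=
  (hf.uniformContinuous hα).continuous

end BddHolder

/-- The linear form `(s, t) ↦ a s + b t`. -/
def linForm (a b : ℝ) : ℝ × ℝ →L[ℝ] ℝ :=
  a • ContinuousLinearMap.fst ℝ ℝ ℝ + b • ContinuousLinearMap.snd ℝ ℝ ℝ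

@[simp] lemma linForm_apply (a b : ℝ) (v : ℝ × ℝ) : linForm a b v = a * v.1 + b * v.2 := by
  simp [linForm]

lemma fderiv_eq_linForm (f : ℝ × ℝ → ℝ) (z : ℝ × ℝ) :
    fderiv ℝ f z = linForm (partial₁ f z) (partial₂ f z) := by
  ext <;> simp [partial₁, partial₂]

/-! ### Mollification in the plane -/

/-- A fixed smooth bump function supported in the unit ball of the plane. -/
def unitBump : ContDiffBump (0 : ℝ × ℝ) := ⟨1 / 2, 1, by norm_num, by norm_num⟩

/-- The mollification kernel. -/
def kern : ℝ × ℝ → ℝ := unitBump.normed volume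

lemma kern_contDiff {n : ℕ∞} : ContDiff ℝ n kern := unitBump.contDiff_normed

lemma kern_hasCompactSupport : HasCompactSupport kern := unitBump.hasCompactSupport_normed

lemma kern_nonneg (w : ℝ × ℝ) : 0 ≤ kern w := unitBump.nonneg_normed w

lemma integral_kern : ∫ w, kern w = 1 := unitBump.integral_normed

lemma tsupport_kern : tsupport kern = Metric.closedBall 0 1 := unitBump.tsupport_normed_eq

lemma kern_eq_zero {w : ℝ × ℝ} (h : 1 < ‖w‖) : kern w = 0 :=
  image_eq_zero_of_notMem_tsupport (by rw [tsupport_kern]; simpa using h)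

lemma fderiv_kern_eq_zero {w : ℝ × ℝ} (h : 1 < ‖w‖) : fderiv ℝ kern w = 0 :=
  image_eq_zero_of_notMem_tsupport fun hw => by
    have := tsupport_fderiv_subset ℝ hw
    rw [tsupport_kern] at this
    simp at this; linarith

lemma kern_continuous : Continuous kern := (kern_contDiff (n := 0)).continuous

lemma fderiv_kern_continuous (v : ℝ × ℝ) : Continuous fun w => fderiv ℝ kern w v :=
  ((kern_contDiff (n := 1)).continuous_fderiv (by norm_num)).clm_apply continuous_const

lemma fderiv_kern_hasCompactSupport (v : ℝ × ℝ) :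
    HasCompactSupport fun w => fderiv ℝ kern w v :=
  kern_hasCompactSupport.fderiv_apply ℝ v

lemma integrable_kern : Integrable kern :=
  kern_continuous.integrable_of_hasCompactSupport kern_hasCompactSupport

lemma integrable_fderiv_kern (v : ℝ × ℝ) : Integrable fun w => fderiv ℝ kern w v :=
  (fderiv_kern_continuous v).integrable_of_hasCompactSupport (fderiv_kern_hasCompactSupport v)

lemma integral_fderiv_kern (v : ℝ × ℝ) : ∫ w, fderiv ℝ kern w v = 0 := by
  have := integral_mul_fderiv_eq_neg_fderiv_mul_of_integrable (μ := (volume : Measure (ℝ × ℝ)))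
    (f := fun _ : ℝ × ℝ => (1 : ℝ)) (g := kern) (v := v) (by simp)
    (by simpa using integrable_fderiv_kern v) (by simpa using integrable_kern)
    (fun _ _ => by fun_prop)
    (fun x _ => (kern_contDiff (n := 1)).differentiable (by norm_num) x)
  simpa using this

/-- The mollification of `f` at scale `ε`. -/
def moll (ε : ℝ) (f : ℝ × ℝ → ℝ) (z : ℝ × ℝ) : ℝ := ∫ w, kern w * f (z - ε • w)

lemma integrable_kern_mul {f : ℝ × ℝ → ℝ} (hf : Continuous f) (ε : ℝ) (z : ℝ × ℝ) :
    Integrable fun w => kern w * f (z - ε • w) :=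
  (kern_continuous.mul (by fun_prop)).integrable_of_hasCompactSupport
    kern_hasCompactSupport.mul_right

lemma integrable_fderiv_kern_mul {f : ℝ × ℝ → ℝ} (hf : Continuous f) (ε : ℝ) (v z : ℝ × ℝ) :
    Integrable fun w => fderiv ℝ kern w v * f (z - ε • w) :=
  ((fderiv_kern_continuous v).mul (by fun_prop)).integrable_of_hasCompactSupport
    (fderiv_kern_hasCompactSupport v).mul_right

/-- The scale is moved from the kernel to the function, so that one fixed kernel serves every ε and
smoothness follows from the theory of convolutions. -/
lemma moll_eq_convolution {ε : ℝ} (hε : 0 < ε) (f : ℝ × ℝ → ℝ) :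
    moll ε f = fun z => (convolution kern (fun x => f (ε • x)) (ContinuousLinearMap.mul ℝ ℝ)
      volume) (ε⁻¹ • z) := by
  ext z
  simp [moll, convolution, smul_sub, smul_smul, mul_inv_cancel₀ hε.ne']

lemma moll_contDiff {ε : ℝ} (hε : 0 < ε) {f : ℝ × ℝ → ℝ} (hf : Continuous f) {n : ℕ∞} :
    ContDiff ℝ n (moll ε f) := by
  rw [moll_eq_convolution hε]
  exact (kern_hasCompactSupport.contDiff_convolution_left (n := n) _ kern_contDiff
    (by fun_prop : Continuous fun x : ℝ × ℝ => f (ε • x)).locallyIntegrable).comp (by fun_prop)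

lemma fderiv_moll {ε : ℝ} (hε : 0 < ε) {f : ℝ × ℝ → ℝ} (hf : Continuous f) (z v : ℝ × ℝ) :
    fderiv ℝ (moll ε f) z v = ε⁻¹ * ∫ w, fderiv ℝ kern w v * f (z - ε • w) := by
  have hc : Continuous fun x : ℝ × ℝ => f (ε • x) := by fun_prop
  have h1 := kern_hasCompactSupport.hasFDerivAt_convolution_left (ContinuousLinearMap.mul ℝ ℝ)
    (kern_contDiff (n := 1)) hc.locallyIntegrable (ε⁻¹ • z) (μ := volume)
  have h2 : HasFDerivAt (fun z : ℝ × ℝ => ε⁻¹ • z) (ε⁻¹ • ContinuousLinearMap.id ℝ (ℝ × ℝ)) z :=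
    (hasFDerivAt_id z).const_smul ε⁻¹
  rw [moll_eq_convolution hε]
  have h3 := (h1.comp z h2).fderiv
  rw [Function.comp_def] at h3
  rw [h3]
  simp only [ContinuousLinearMap.comp_apply, _root_.smul_apply,
    ContinuousLinearMap.id_apply, map_smul, smul_eq_mul, mul_eq_mul_left_iff]
  left
  rw [convolution_def, ContinuousLinearMap.integral_apply]
  · refine integral_congr_ae (.of_forall fun w => ?_)
    simp [smul_sub, smul_smul, mul_inv_cancel₀ hε.ne']
  · exact ((kern_hasCompactSupport.fderiv ℝ).convolutionExists_left _
      ((kern_contDiff (n := 1)).continuous_fderiv (by norm_num)) hc.locallyIntegrable) _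

/-- Bounds that are valid for integrals against a kernel supported in the unit ball. -/
lemma abs_integral_le_of_unit_support {k : ℝ × ℝ → ℝ} (hk : Integrable k)
    (hk₀ : ∀ w, 1 < ‖w‖ → k w = 0) {G : ℝ × ℝ → ℝ} {C : ℝ} (hG : ∀ w, ‖w‖ ≤ 1 → |G w| ≤ C) :
    |∫ w, k w * G w| ≤ C * ∫ w, |k w| := by
  rw [← integral_const_mul, ← Real.norm_eq_abs]
  refine norm_integral_le_of_norm_le (hk.abs.const_mul C) (.of_forall fun w => ?_)
  rw [Real.norm_eq_abs, abs_mul, mul_comm]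
  rcases le_or_gt ‖w‖ 1 with h | h
  · gcongr; exact hG w h
  · simp [hk₀ w h]

lemma abs_integral_kern_mul_le {G : ℝ × ℝ → ℝ} {C : ℝ} (hG : ∀ w, ‖w‖ ≤ 1 → |G w| ≤ C) :
    |∫ w, kern w * G w| ≤ C := by
  have := abs_integral_le_of_unit_support integrable_kern (fun w => kern_eq_zero) hG
  simpa [abs_of_nonneg (kern_nonneg _), integral_kern] using this

lemma moll_sub_self {f : ℝ × ℝ → ℝ} (hf : Continuous f) (ε : ℝ) (z : ℝ × ℝ) :
    moll ε f z - f z = ∫ w, kern w * (f (z - ε • w) - f z) := by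
  simp only [mul_sub]
  rw [integral_sub (integrable_kern_mul hf ε z) (integrable_kern.mul_const _), integral_mul_const,
    integral_kern, one_mul, moll]

lemma abs_increment_le {α : ℝ} (hα : 0 < α) {f : ℝ × ℝ → ℝ} {C : ℝ}
    (hC : 0 ≤ C) (hf : ∀ z w, |f z - f w| ≤ C * dist z w ^ α) {ε : ℝ} (hε : 0 < ε)
    (z : ℝ × ℝ) {w : ℝ × ℝ} (hw : ‖w‖ ≤ 1) : |f (z - ε • w) - f z| ≤ C * ε ^ α := by
  refine (hf _ _).trans ?_
  gcongr
  rw [dist_eq_norm, sub_sub_cancel_left, norm_neg, norm_smul, Real.norm_of_nonneg hε.le]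
  exact mul_le_of_le_one_right hε.le hw

lemma abs_moll_le {f : ℝ × ℝ → ℝ} {C : ℝ} (hf : ∀ z, |f z| ≤ C) (ε : ℝ) (z : ℝ × ℝ) :
    |moll ε f z| ≤ C :=
  abs_integral_kern_mul_le fun _ _ => hf _

lemma abs_moll_sub_le {α : ℝ} (hα : 0 < α) {f : ℝ × ℝ → ℝ} (hc : Continuous f) {C : ℝ}
    (hC : 0 ≤ C) (hf : ∀ z w, |f z - f w| ≤ C * dist z w ^ α) {ε : ℝ} (hε : 0 < ε)
    (z : ℝ × ℝ) : |moll ε f z - f z| ≤ C * ε ^ α := by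
  rw [moll_sub_self hc]
  exact abs_integral_kern_mul_le fun w hw => abs_increment_le hα hC hf hε z hw

lemma le_moll {f : ℝ × ℝ → ℝ} (hc : Continuous f) {m : ℝ} (hf : ∀ z, m ≤ f z) (ε : ℝ)
    (z : ℝ × ℝ) : m ≤ moll ε f z := by
  calc m = ∫ w, kern w * m := by rw [integral_mul_const, integral_kern, one_mul]
    _ ≤ _ := integral_mono (integrable_kern.mul_const _) (integrable_kern_mul hc ε z)
        fun w => mul_le_mul_of_nonneg_left (hf _) (kern_nonneg w)

/-- The derivative falls on the kernel at the price of ε⁻¹. Since the derivative of the kernel has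
integral zero, `f z` may be subtracted under the integral, and the Hölder bound gains ε^α. -/
lemma abs_fderiv_moll_le {α : ℝ} (hα : 0 < α) {f : ℝ × ℝ → ℝ} (hc : Continuous f) {C : ℝ}
    (hC : 0 ≤ C) (hf : ∀ z w, |f z - f w| ≤ C * dist z w ^ α) {ε : ℝ} (hε : 0 < ε)
    (z v : ℝ × ℝ) :
    |fderiv ℝ (moll ε f) z v| ≤ (C * ∫ w, |fderiv ℝ kern w v|) * (ε⁻¹ * ε ^ α) := by
  have h1 : ∫ w, fderiv ℝ kern w v * f (z - ε • w) =
      ∫ w, fderiv ℝ kern w v * (f (z - ε • w) - f z) := by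
    simp only [mul_sub]
    rw [integral_sub (integrable_fderiv_kern_mul hc ε v z)
      ((integrable_fderiv_kern v).mul_const _), integral_mul_const, integral_fderiv_kern]
    simp
  rw [fderiv_moll hε hc, h1, abs_mul, abs_of_pos (inv_pos.2 hε)]
  have := abs_integral_le_of_unit_support (integrable_fderiv_kern v)
    (fun w hw => by simp [fderiv_kern_eq_zero hw])
    (fun w hw => abs_increment_le hα hC hf hε z hw)
  calc _ ≤ ε⁻¹ * (C * ε ^ α * ∫ w, |fderiv ℝ kern w v|) := by gcongr
    _ = _ := by ring

/-- The commutator estimate of Constantin, E and Titi. -/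
lemma abs_moll_mul_sub_le {α : ℝ} (hα : 0 < α) {f g : ℝ × ℝ → ℝ} (hfc : Continuous f)
    (hgc : Continuous g) {C K : ℝ} (hC : 0 ≤ C) (hK : 0 ≤ K)
    (hf : ∀ z w, |f z - f w| ≤ C * dist z w ^ α) (hg : ∀ z w, |g z - g w| ≤ K * dist z w ^ α)
    {ε : ℝ} (hε : 0 < ε) (z : ℝ × ℝ) :
    |moll ε (fun z => f z * g z) z - moll ε f z * moll ε g z| ≤
      (2 * (C * K)) * (ε ^ α * ε ^ α) := by
  -- The kernel has mass one, so expanding the product of increments gives the commutator plus the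
  -- product of the two errors `moll ε f z - f z` and `moll ε g z - g z`. The commutator is
  -- therefore a difference of two terms quadratic in increments of size ε^α.
  have e : ∫ w, kern w * ((f (z - ε • w) - f z) * (g (z - ε • w) - g z)) =
      moll ε (fun z => f z * g z) z - f z * moll ε g z - g z * moll ε f z + f z * g z := by
    have i1 : Integrable fun w => kern w * (f (z - ε • w) * g (z - ε • w)) :=
      integrable_kern_mul (hfc.mul hgc) ε z
    have i2 := (integrable_kern_mul hgc ε z).const_mul (f z)
    have i3 := (integrable_kern_mul hfc ε z).const_mul (g z)
    have i4 := integrable_kern.mul_const (f z * g z)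
    simp only [moll]
    have e4 : f z * g z = ∫ w, kern w * (f z * g z) := by
      rw [integral_mul_const, integral_kern, one_mul]
    have i12 : Integrable fun w => kern w * (f (z - ε • w) * g (z - ε • w)) -
        f z * (kern w * g (z - ε • w)) := i1.sub i2
    have i123 : Integrable fun w => kern w * (f (z - ε • w) * g (z - ε • w)) -
        f z * (kern w * g (z - ε • w)) - g z * (kern w * f (z - ε • w)) := i12.sub i3
    rw [← integral_const_mul, ← integral_const_mul, e4, ← integral_sub i1 i2,
      ← integral_sub i12 i3, ← integral_add i123 i4]
    refine integral_congr_ae (.of_forall fun w => ?_)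
    simp only
    ring
  have h1 : |∫ w, kern w * ((f (z - ε • w) - f z) * (g (z - ε • w) - g z))| ≤
      (C * ε ^ α) * (K * ε ^ α) := by
    refine abs_integral_kern_mul_le fun w hw => ?_
    rw [abs_mul]
    exact mul_le_mul (abs_increment_le hα hC hf hε z hw) (abs_increment_le hα hK hg hε z hw)
      (abs_nonneg _) (by positivity)
  have h2 : |(moll ε f z - f z) * (moll ε g z - g z)| ≤ (C * ε ^ α) * (K * ε ^ α) := by
    rw [abs_mul]
    exact mul_le_mul (abs_moll_sub_le hα hfc hC hf hε z) (abs_moll_sub_le hα hgc hK hg hε z)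
      (abs_nonneg _) (by positivity)
  have e2 : moll ε (fun z => f z * g z) z - moll ε f z * moll ε g z =
      (∫ w, kern w * ((f (z - ε • w) - f z) * (g (z - ε • w) - g z))) -
        (moll ε f z - f z) * (moll ε g z - g z) := by rw [e]; ring
  rw [e2]
  refine (abs_sub _ _).trans ?_
  linarith

/-! ### Distributional equations and mollification -/

/-- The equation `∂₁ a + ∂₂ b = 0` in `D`, tested with functions of class `C¹`. -/
def WeakC1 (D : Set (ℝ × ℝ)) (a b : ℝ × ℝ → ℝ) : Prop :=
  ∀ φ : ℝ × ℝ → ℝ, ContDiff ℝ 1 φ → HasCompactSupport φ → tsupport φ ⊆ D →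
    ∫ z in D, (a z * partial₁ φ z + b z * partial₂ φ z) = 0

lemma partial₁_eq_zero {φ : ℝ × ℝ → ℝ} {z : ℝ × ℝ} (h : z ∉ tsupport φ) : partial₁ φ z = 0 := by
  rw [partial₁, image_eq_zero_of_notMem_tsupport fun h' => h (tsupport_fderiv_subset ℝ h')]
  simp

lemma partial₂_eq_zero {φ : ℝ × ℝ → ℝ} {z : ℝ × ℝ} (h : z ∉ tsupport φ) : partial₂ φ z = 0 := by
  rw [partial₂, image_eq_zero_of_notMem_tsupport fun h' => h (tsupport_fderiv_subset ℝ h')]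
  simp

lemma setIntegral_test {D : Set (ℝ × ℝ)} (a b : ℝ × ℝ → ℝ) {φ : ℝ × ℝ → ℝ}
    (hφ : tsupport φ ⊆ D) :
    ∫ z in D, (a z * partial₁ φ z + b z * partial₂ φ z) =
      ∫ z, (a z * partial₁ φ z + b z * partial₂ φ z) :=
  setIntegral_eq_integral_of_forall_compl_eq_zero fun z hz => by
    rw [partial₁_eq_zero fun h => hz (hφ h), partial₂_eq_zero fun h => hz (hφ h)]; simp

lemma WeakC1.weakDivEq {D : Set (ℝ × ℝ)} {a b : ℝ × ℝ → ℝ} (h : WeakC1 D a b) :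
    WeakDivEq D a b (fun _ => 0) := fun φ hφ => by
  rw [h φ (hφ.smooth.of_le (by exact_mod_cast le_top)) hφ.hasCompactSupport hφ.tsupport_subset]
  simp

lemma WeakDivEq.congr {D : Set (ℝ × ℝ)} (hD : MeasurableSet D) {a b s a' b' : ℝ × ℝ → ℝ}
    (h : WeakDivEq D a b s) (ha : ∀ z ∈ D, a z = a' z) (hb : ∀ z ∈ D, b z = b' z) :
    WeakDivEq D a' b' s := fun φ hφ => by
  rw [← h φ hφ]
  exact setIntegral_congr_fun hD fun z hz => by simp only [ha z hz, hb z hz]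

lemma WeakC1.congr {D : Set (ℝ × ℝ)} (hD : MeasurableSet D) {a b a' b' : ℝ × ℝ → ℝ}
    (h : WeakC1 D a b) (ha : ∀ z ∈ D, a z = a' z) (hb : ∀ z ∈ D, b z = b' z) :
    WeakC1 D a' b' := fun φ h₁ h₂ h₃ => by
  rw [← h φ h₁ h₂ h₃]
  exact setIntegral_congr_fun hD fun z hz => by simp only [ha z hz, hb z hz]

lemma WeakC1.neg {D : Set (ℝ × ℝ)} {a b : ℝ × ℝ → ℝ} (h : WeakC1 D a b) :
    WeakC1 D (fun z => -a z) (fun z => -b z) := fun φ h₁ h₂ h₃ => by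
  rw [← neg_eq_zero, ← integral_neg, ← h φ h₁ h₂ h₃]
  exact integral_congr_ae (.of_forall fun z => by simp only; ring)

/-- The reflected kernel centred at `z` and scaled by ε is an admissible test function as long as
its ball of radius ε lies in `D`. The weak equation tested with it is the mollified equation at `z`,
up to a nonzero power of ε. -/
lemma WeakDivEq.fderiv_moll_add_eq_zero {D : Set (ℝ × ℝ)} {a b : ℝ × ℝ → ℝ}
    (h : WeakDivEq D a b fun _ => 0) (ha : Continuous a) (hb : Continuous b) {ε : ℝ} (hε : 0 < ε)
    {z : ℝ × ℝ} (hz : Metric.closedBall z ε ⊆ D) :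
    partial₁ (moll ε a) z + partial₂ (moll ε b) z = 0 := by
  set φ : ℝ × ℝ → ℝ := fun ζ => kern (ε⁻¹ • (z - ζ)) with hφdef
  have hφs : ContDiff ℝ ∞ φ := (kern_contDiff (n := ⊤)).comp (by fun_prop)
  have hφt : tsupport φ ⊆ Metric.closedBall z ε := by
    refine closure_minimal (fun ζ hζ => ?_) Metric.isClosed_closedBall
    by_contra hcon
    refine hζ (kern_eq_zero ?_)
    rw [norm_smul, Real.norm_of_nonneg (inv_nonneg.2 hε.le), ← dist_eq_norm, dist_comm]
    rw [Metric.mem_closedBall, not_le] at hcon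
    rw [← div_eq_inv_mul, one_lt_div hε]; exact hcon
  have hφ : IsTestFunction D φ :=
    ⟨hφs, HasCompactSupport.of_support_subset_isCompact (isCompact_closedBall z ε)
      ((subset_tsupport _).trans hφt), hφt.trans hz⟩
  have hder : ∀ ζ v, fderiv ℝ φ ζ v = -(ε⁻¹ * fderiv ℝ kern (ε⁻¹ • (z - ζ)) v) := fun ζ v => by
    have h1 : HasFDerivAt (fun ζ : ℝ × ℝ => ε⁻¹ • (z - ζ))
        (ε⁻¹ • (-ContinuousLinearMap.id ℝ (ℝ × ℝ))) ζ :=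
      ((hasFDerivAt_id ζ).const_sub z).const_smul ε⁻¹
    have h2 := (((kern_contDiff (n := 1)).differentiable (by norm_num)
      (ε⁻¹ • (z - ζ))).hasFDerivAt.comp ζ h1).fderiv
    rw [hφdef]
    rw [Function.comp_def] at h2
    rw [h2]
    simp
  have key := h φ hφ
  rw [setIntegral_test a b hφ.tsupport_subset] at key
  set H : ℝ × ℝ → ℝ := fun w => fderiv ℝ kern w (1, 0) * a (z - ε • w) +
    fderiv ℝ kern w (0, 1) * b (z - ε • w) with hH
  have e1 : ∀ ζ, a ζ * partial₁ φ ζ + b ζ * partial₂ φ ζ = -(ε⁻¹ * H (ε⁻¹ • (z - ζ))) := by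
    intro ζ
    have : z - ε • ε⁻¹ • (z - ζ) = ζ := by
      rw [smul_smul, mul_inv_cancel₀ hε.ne', one_smul, sub_sub_cancel]
    simp only [partial₁, partial₂, hder, hH, this]
    ring
  simp only [e1, zero_mul, integral_zero, neg_zero, integral_neg, integral_const_mul] at key
  rw [integral_sub_left_eq_self (fun ζ => H (ε⁻¹ • ζ)) volume z,
    Measure.integral_comp_smul] at key
  have hint : ∫ w, H w = 0 := by
    have h1 : ε⁻¹ ≠ 0 := inv_ne_zero hε.ne'
    simpa [h1, hε.ne'] using key
  rw [partial₁, partial₂, fderiv_moll hε ha, fderiv_moll hε hb, ← mul_add,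
    ← integral_add (integrable_fderiv_kern_mul ha _ _ _) (integrable_fderiv_kern_mul hb _ _ _)]
  rw [hint, mul_zero]

lemma exists_closedBall_subset {K D : Set (ℝ × ℝ)} (hK : IsCompact K) (hD : IsOpen D)
    (h : K ⊆ D) : ∃ δ > 0, ∀ ε, ε ≤ δ → ∀ z ∈ K, Metric.closedBall z ε ⊆ D := by
  obtain ⟨δ, hδ, hsub⟩ := hK.exists_cthickening_subset_open hD h
  exact ⟨δ, hδ, fun ε hε z hz => (Metric.closedBall_subset_closedBall hε).trans
    ((Metric.closedBall_subset_cthickening hz δ).trans hsub)⟩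

lemma tendsto_integral_moll_mul {α : ℝ} (hα : 0 < α) {a : ℝ × ℝ → ℝ} (ha : BddHolder α a)
    {χ : ℝ × ℝ → ℝ} (hχ : Continuous χ) (hχs : HasCompactSupport χ) :
    Filter.Tendsto (fun ε => ∫ z, moll ε a z * χ z) (𝓝[>] 0) (𝓝 (∫ z, a z * χ z)) := by
  have hc := ha.continuous hα
  obtain ⟨C, hC, -, hC₂⟩ := ha
  have hi := hχ.integrable_of_hasCompactSupport hχs (μ := volume)
  rw [tendsto_iff_dist_tendsto_zero]
  have hlim : Filter.Tendsto (fun ε : ℝ => C * ε ^ α * ∫ z, |χ z|) (𝓝[>] 0) (𝓝 0) := by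
    have : Filter.Tendsto (fun ε : ℝ => C * ε ^ α * ∫ z, |χ z|) (𝓝 0)
        (𝓝 (C * 0 ^ α * ∫ z, |χ z|)) :=
      (((Real.continuous_rpow_const hα.le).tendsto 0).const_mul C).mul_const _
    rw [Real.zero_rpow hα.ne', mul_zero, zero_mul] at this
    exact this.mono_left nhdsWithin_le_nhds
  refine squeeze_zero' (.of_forall fun _ => dist_nonneg) ?_ hlim
  filter_upwards [self_mem_nhdsWithin] with ε hε
  have i1 : Integrable fun z => moll ε a z * χ z :=
    (((moll_contDiff hε hc (n := 0)).continuous).mul hχ).integrable_of_hasCompactSupport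
      hχs.mul_left
  have i2 : Integrable fun z => a z * χ z :=
    (hc.mul hχ).integrable_of_hasCompactSupport hχs.mul_left
  rw [dist_eq_norm, ← integral_sub i1 i2, ← integral_const_mul]
  refine norm_integral_le_of_norm_le (hi.abs.const_mul _) (.of_forall fun z => ?_)
  rw [← sub_mul, Real.norm_eq_abs, abs_mul]
  gcongr
  exact abs_moll_sub_le hα hc hC hC₂ hε z

lemma integral_mul_fderiv_test {f φ : ℝ × ℝ → ℝ} (hf : ContDiff ℝ 1 f) (hφ : ContDiff ℝ 1 φ)
    (hφs : HasCompactSupport φ) (v : ℝ × ℝ) :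
    ∫ z, f z * fderiv ℝ φ z v = -∫ z, fderiv ℝ f z v * φ z := by
  have c1 : Continuous fun z => fderiv ℝ φ z v :=
    (hφ.continuous_fderiv (by norm_num)).clm_apply continuous_const
  have c2 : Continuous fun z => fderiv ℝ f z v :=
    (hf.continuous_fderiv (by norm_num)).clm_apply continuous_const
  exact integral_mul_fderiv_eq_neg_fderiv_mul_of_integrable
    ((c2.mul hφ.continuous).integrable_of_hasCompactSupport hφs.mul_left)
    ((hf.continuous.mul c1).integrable_of_hasCompactSupport (hφs.fderiv_apply ℝ v).mul_left)
    ((hf.continuous.mul hφ.continuous).integrable_of_hasCompactSupport hφs.mul_left)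
    (fun z _ => hf.differentiable (by norm_num) z) (fun z _ => hφ.differentiable (by norm_num) z)

lemma partial₁_continuous {φ : ℝ × ℝ → ℝ} (hφ : ContDiff ℝ 1 φ) : Continuous (partial₁ φ) :=
  (hφ.continuous_fderiv (by norm_num)).clm_apply continuous_const

lemma partial₂_continuous {φ : ℝ × ℝ → ℝ} (hφ : ContDiff ℝ 1 φ) : Continuous (partial₂ φ) :=
  (hφ.continuous_fderiv (by norm_num)).clm_apply continuous_const

lemma integral_div_mul_test {f g φ : ℝ × ℝ → ℝ} (hf : ContDiff ℝ 1 f) (hg : ContDiff ℝ 1 g)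
    (hφ : ContDiff ℝ 1 φ) (hφs : HasCompactSupport φ) :
    ∫ z, (partial₁ f z + partial₂ g z) * φ z =
      -((∫ z, f z * partial₁ φ z) + ∫ z, g z * partial₂ φ z) := by
  simp only [partial₁, partial₂]
  rw [integral_mul_fderiv_test hf hφ hφs, integral_mul_fderiv_test hg hφ hφs, neg_add, neg_neg,
    neg_neg]
  simp only [add_mul]
  refine integral_add ?_ ?_
  · exact ((partial₁_continuous hf).mul hφ.continuous).integrable_of_hasCompactSupport
      hφs.mul_left
  · exact ((partial₂_continuous hg).mul hφ.continuous).integrable_of_hasCompactSupport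
      hφs.mul_left

lemma tendsto_integral_div_moll {α : ℝ} (hα : 0 < α) {a b : ℝ × ℝ → ℝ} (ha : BddHolder α a)
    (hb : BddHolder α b) {φ : ℝ × ℝ → ℝ} (hφ : ContDiff ℝ 1 φ) (hφs : HasCompactSupport φ) :
    Filter.Tendsto (fun ε => ∫ z, (partial₁ (moll ε a) z + partial₂ (moll ε b) z) * φ z) (𝓝[>] 0)
      (𝓝 (-∫ z, (a z * partial₁ φ z + b z * partial₂ φ z))) := by
  have s1 : HasCompactSupport (partial₁ φ) := hφs.fderiv_apply ℝ _
  have s2 : HasCompactSupport (partial₂ φ) := hφs.fderiv_apply ℝ _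
  have i1 : Integrable fun z => a z * partial₁ φ z :=
    ((ha.continuous hα).mul (partial₁_continuous hφ)).integrable_of_hasCompactSupport s1.mul_left
  have i2 : Integrable fun z => b z * partial₂ φ z :=
    ((hb.continuous hα).mul (partial₂_continuous hφ)).integrable_of_hasCompactSupport s2.mul_left
  rw [integral_add i1 i2]
  refine (((tendsto_integral_moll_mul hα ha (partial₁_continuous hφ) s1).add
    (tendsto_integral_moll_mul hα hb (partial₂_continuous hφ) s2)).neg).congr' ?_
  filter_upwards [self_mem_nhdsWithin] with ε hε
  rw [integral_div_mul_test (moll_contDiff hε (ha.continuous hα) (n := 1))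
    (moll_contDiff hε (hb.continuous hα) (n := 1)) hφ hφs]

/-- A criterion for a weak divergence equation in terms of mollifications. -/
lemma weakC1_of_tendsto {α : ℝ} (hα : 0 < α) {D : Set (ℝ × ℝ)} {a b : ℝ × ℝ → ℝ}
    (ha : BddHolder α a) (hb : BddHolder α b)
    (h : ∀ φ : ℝ × ℝ → ℝ, ContDiff ℝ 1 φ → HasCompactSupport φ → tsupport φ ⊆ D →
      Filter.Tendsto (fun ε => ∫ z, (partial₁ (moll ε a) z + partial₂ (moll ε b) z) * φ z)
        (𝓝[>] 0) (𝓝 0)) : WeakC1 D a b := fun φ h₁ h₂ h₃ => by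
  rw [setIntegral_test a b h₃]
  exact neg_eq_zero.1 (tendsto_nhds_unique (tendsto_integral_div_moll hα ha hb h₁ h₂) (h φ h₁ h₂ h₃))

lemma WeakDivEq.eventually_div_moll {D : Set (ℝ × ℝ)} (hD : IsOpen D) {a b : ℝ × ℝ → ℝ}
    (h : WeakDivEq D a b fun _ => 0) (ha : Continuous a) (hb : Continuous b) {K : Set (ℝ × ℝ)}
    (hK : IsCompact K) (hKD : K ⊆ D) :
    ∀ᶠ ε in 𝓝[>] (0 : ℝ), ∀ z ∈ K, partial₁ (moll ε a) z + partial₂ (moll ε b) z = 0 := by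
  obtain ⟨δ, hδ, hball⟩ := exists_closedBall_subset hK hD hKD
  filter_upwards [Ioo_mem_nhdsGT hδ] with ε hε z hz
  exact h.fderiv_moll_add_eq_zero ha hb hε.1 (hball ε hε.2.le z hz)

/-- On the compact support of a test function the mollified equation holds exactly for small ε, and
the passage to the limit needs only one derivative of the test function. The larger class of tests
is required because a change of variables of class `C^{1,α}` turns smooth tests into `C¹` ones. -/
lemma WeakDivEq.weakC1 {α : ℝ} (hα : 0 < α) {D : Set (ℝ × ℝ)} (hD : IsOpen D) {a b : ℝ × ℝ → ℝ}
    (h : WeakDivEq D a b fun _ => 0) (ha : BddHolder α a) (hb : BddHolder α b) :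
    WeakC1 D a b := by
  refine weakC1_of_tendsto hα ha hb fun φ _ h₂ h₃ => ?_
  refine tendsto_const_nhds.congr' ?_
  filter_upwards [h.eventually_div_moll hD (ha.continuous hα) (hb.continuous hα) h₂ h₃] with ε hε
  symm
  refine integral_eq_zero_of_ae (.of_forall fun z => ?_)
  by_cases hz : z ∈ tsupport φ
  · simp [hε z hz]
  · simp [image_eq_zero_of_notMem_tsupport hz]

/-! ### Commutator estimates for exponents larger than one third -/

/-- Families of functions that are bounded, with derivative in the direction `v` of the order of
`ε ^ (α - 1)`. -/
def MildFamily (α : ℝ) (v : ℝ × ℝ) (w : ℝ → ℝ × ℝ → ℝ) : Prop :=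
  ∃ M, 0 ≤ M ∧ ∀ ε, 0 < ε → ε ≤ 1 → ContDiff ℝ 1 (w ε) ∧ (∀ z, |w ε z| ≤ M) ∧
    ∀ z, |fderiv ℝ (w ε) z v| ≤ M * (ε⁻¹ * ε ^ α)

/-- Families of functions of the order of `ε ^ (2 α)`. -/
def SmallFamily (α : ℝ) (r : ℝ → ℝ × ℝ → ℝ) : Prop :=
  ∃ M, 0 ≤ M ∧ ∀ ε, 0 < ε → ε ≤ 1 → ContDiff ℝ 1 (r ε) ∧ ∀ z, |r ε z| ≤ M * (ε ^ α * ε ^ α)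

lemma fderiv_mul_apply {f g : ℝ × ℝ → ℝ} {z : ℝ × ℝ} (hf : DifferentiableAt ℝ f z)
    (hg : DifferentiableAt ℝ g z) (v : ℝ × ℝ) :
    fderiv ℝ (fun z => f z * g z) z v = f z * fderiv ℝ g z v + g z * fderiv ℝ f z v := by
  rw [fderiv_fun_mul hf hg]
  simp

section Families

variable {α : ℝ} {v : ℝ × ℝ} {w w' r r' : ℝ → ℝ × ℝ → ℝ}

lemma MildFamily.const (c : ℝ) : MildFamily α v (fun _ _ => c) :=
  ⟨|c|, abs_nonneg c, fun ε hε _ => ⟨contDiff_const, fun _ => le_rfl, fun z => by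
    simp; positivity⟩⟩

lemma MildFamily.moll (hα : 0 < α) {f : ℝ × ℝ → ℝ} (hf : BddHolder α f) :
    MildFamily α v (fun ε => moll ε f) := by
  have hc := hf.continuous hα
  obtain ⟨C, hC, hC₁, hC₂⟩ := hf
  have hk : 0 ≤ ∫ w, |fderiv ℝ kern w v| := integral_nonneg fun _ => abs_nonneg _
  refine ⟨C + C * ∫ w, |fderiv ℝ kern w v|, by positivity, fun ε hε _ =>
    ⟨moll_contDiff hε hc (n := 1), fun z => ?_, fun z => ?_⟩⟩
  · exact (abs_moll_le hC₁ ε z).trans (le_add_of_nonneg_right (by positivity))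
  · refine (abs_fderiv_moll_le hα hc hC hC₂ hε z v).trans ?_
    gcongr
    exact le_add_of_nonneg_left hC

lemma MildFamily.mul (hw : MildFamily α v w) (hw' : MildFamily α v w') :
    MildFamily α v (fun ε z => w ε z * w' ε z) := by
  obtain ⟨M, hM, h⟩ := hw
  obtain ⟨N, hN, h'⟩ := hw'
  refine ⟨2 * (M * N), by positivity, fun ε hε hε₁ => ?_⟩
  obtain ⟨a, b, c⟩ := h ε hε hε₁
  obtain ⟨a', b', c'⟩ := h' ε hε hε₁
  refine ⟨a.mul a', fun z => ?_, fun z => ?_⟩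
  · rw [abs_mul]
    nlinarith [mul_le_mul (b z) (b' z) (abs_nonneg _) hM, mul_nonneg hM hN]
  · simp only
    rw [fderiv_mul_apply (a.differentiable (by norm_num) z) (a'.differentiable (by norm_num) z)]
    refine (abs_add_le _ _).trans ?_
    rw [abs_mul, abs_mul]
    calc _ ≤ M * (N * (ε⁻¹ * ε ^ α)) + N * (M * (ε⁻¹ * ε ^ α)) := by
          gcongr
          exacts [b z, c' z, b' z, c z]
      _ = _ := by ring

lemma MildFamily.inv (hw : MildFamily α v w) {m : ℝ} (hm : 0 < m)
    (h : ∀ ε z, m ≤ |w ε z|) : MildFamily α v (fun ε z => (w ε z)⁻¹) := by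
  obtain ⟨M, hM, hw⟩ := hw
  refine ⟨m⁻¹ + (m⁻¹ * m⁻¹) * M, by positivity, fun ε hε hε₁ => ?_⟩
  obtain ⟨a, b, c⟩ := hw ε hε hε₁
  have hne : ∀ z, w ε z ≠ 0 := fun z => abs_pos.1 (hm.trans_le (h ε z))
  refine ⟨a.inv hne, fun z => ?_, fun z => ?_⟩
  · rw [abs_inv]
    refine (inv_anti₀ hm (h ε z)).trans (le_add_of_nonneg_right (by positivity))
  · have e : fderiv ℝ (fun z => (w ε z)⁻¹) z v = -((w ε z)⁻¹ * (w ε z)⁻¹) * fderiv ℝ (w ε) z v := by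
      have h1 := (hasDerivAt_inv (hne z)).comp_hasFDerivAt z
        (a.differentiable (by norm_num) z).hasFDerivAt
      rw [Function.comp_def] at h1
      rw [h1.fderiv]
      simp [pow_two]
    rw [e, abs_mul, abs_neg, abs_mul, abs_inv]
    calc _ ≤ (m⁻¹ * m⁻¹) * (M * (ε⁻¹ * ε ^ α)) := by
          gcongr
          exacts [h ε z, h ε z, c z]
      _ = ((m⁻¹ * m⁻¹) * M) * (ε⁻¹ * ε ^ α) := by ring
      _ ≤ _ := by
        gcongr
        exact le_add_of_nonneg_left (by positivity)

lemma SmallFamily.commutator (hα : 0 < α) {f g : ℝ × ℝ → ℝ} (hf : BddHolder α f)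
    (hg : BddHolder α g) :
    SmallFamily α (fun ε z => moll ε (fun z => f z * g z) z - moll ε f z * moll ε g z) := by
  have hfc := hf.continuous hα
  have hgc := hg.continuous hα
  obtain ⟨C, hC, -, hC₂⟩ := hf
  obtain ⟨K, hK, -, hK₂⟩ := hg
  refine ⟨2 * (C * K), by positivity, fun ε hε _ => ⟨?_, fun z =>
    abs_moll_mul_sub_le hα hfc hgc hC hK hC₂ hK₂ hε z⟩⟩
  exact (moll_contDiff hε (hfc.mul hgc) (n := 1)).sub
    ((moll_contDiff hε hfc (n := 1)).mul (moll_contDiff hε hgc (n := 1)))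

lemma SmallFamily.add (hr : SmallFamily α r) (hr' : SmallFamily α r') :
    SmallFamily α (fun ε z => r ε z + r' ε z) := by
  obtain ⟨M, hM, h⟩ := hr
  obtain ⟨N, hN, h'⟩ := hr'
  refine ⟨M + N, by positivity, fun ε hε hε₁ => ⟨(h ε hε hε₁).1.add (h' ε hε hε₁).1, fun z => ?_⟩⟩
  refine (abs_add_le _ _).trans ?_
  rw [add_mul]
  exact add_le_add ((h ε hε hε₁).2 z) ((h' ε hε hε₁).2 z)

lemma SmallFamily.const_mul (hr : SmallFamily α r) (c : ℝ) :
    SmallFamily α (fun ε z => c * r ε z) := by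
  obtain ⟨M, hM, h⟩ := hr
  refine ⟨|c| * M, by positivity, fun ε hε hε₁ =>
    ⟨contDiff_const.mul (h ε hε hε₁).1, fun z => ?_⟩⟩
  rw [abs_mul, mul_assoc]
  gcongr
  exact (h ε hε hε₁).2 z

/-- Bounded terms can thus be absorbed into terms of order ε^(α-1). -/
lemma one_le_inv_mul_rpow (hα : α ≤ 1) {ε : ℝ} (hε : 0 < ε) (hε₁ : ε ≤ 1) :
    1 ≤ ε⁻¹ * ε ^ α := by
  rw [← Real.rpow_neg_one, ← Real.rpow_add hε]
  exact Real.one_le_rpow_of_pos_of_le_one_of_nonpos hε hε₁ (by linarith)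

/-- The product of a mild factor and a derivative of a small function tends to zero in the sense
of distributions if the exponent is larger than one third. -/
lemma SmallFamily.tendsto_integral (hα : 1 / 3 < α) (hα₁ : α ≤ 1) (hr : SmallFamily α r)
    (hw : MildFamily α v w) {φ : ℝ × ℝ → ℝ} (hφ : ContDiff ℝ 1 φ) (hφs : HasCompactSupport φ) :
    Filter.Tendsto (fun ε => ∫ z, fderiv ℝ (r ε) z v * (w ε z * φ z)) (𝓝[>] 0) (𝓝 0) := by
  obtain ⟨M, hM, h⟩ := hr
  obtain ⟨N, hN, h'⟩ := hw
  have cφ : Continuous fun z => fderiv ℝ φ z v :=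
    (hφ.continuous_fderiv (by norm_num)).clm_apply continuous_const
  have i1 := (hφ.continuous.integrable_of_hasCompactSupport hφs (μ := volume)).abs
  have i2 := (cφ.integrable_of_hasCompactSupport (hφs.fderiv_apply ℝ v) (μ := volume)).abs
  set I := ∫ z, (|φ z| + |fderiv ℝ φ z v|) with hI
  -- The exponent 3α - 1 is the sum of 2α from the small family and α - 1 from the derivative of the
  -- mild factor. Its positivity is the only place where α > 1/3 is needed.
  have hlim : Filter.Tendsto (fun ε : ℝ => M * N * I * ε ^ (3 * α - 1)) (𝓝[>] 0) (𝓝 0) := by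
    have hp : 0 < 3 * α - 1 := by linarith
    have : Filter.Tendsto (fun ε : ℝ => M * N * I * ε ^ (3 * α - 1)) (𝓝 0)
        (𝓝 (M * N * I * 0 ^ (3 * α - 1))) :=
      ((Real.continuous_rpow_const hp.le).tendsto 0).const_mul _
    rw [Real.zero_rpow hp.ne', mul_zero] at this
    exact this.mono_left nhdsWithin_le_nhds
  refine squeeze_zero_norm' ?_ hlim
  filter_upwards [Ioc_mem_nhdsGT one_pos] with ε hε
  obtain ⟨a, b⟩ := h ε hε.1 hε.2
  obtain ⟨a', b', c'⟩ := h' ε hε.1 hε.2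
  -- The derivative is moved off the small family, of which only the size is controlled.
  have e := integral_mul_fderiv_test a (a'.mul hφ) hφs.mul_left v
  have e' : ∫ z, fderiv ℝ (r ε) z v * (w ε z * φ z) =
      -∫ z, r ε z * fderiv ℝ (fun z => w ε z * φ z) z v := by
    rw [e, neg_neg]
  have hpow : ε ^ (3 * α - 1) = (ε ^ α * ε ^ α) * (ε⁻¹ * ε ^ α) := by
    rw [← Real.rpow_neg_one, ← Real.rpow_add hε.1, ← Real.rpow_add hε.1, ← Real.rpow_add hε.1]
    ring_nf
  rw [e', norm_neg, hpow]
  have hεα : 0 ≤ ε ^ α := Real.rpow_nonneg hε.1.le _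
  have hεi : 0 ≤ ε⁻¹ := (inv_pos.2 hε.1).le
  calc ‖∫ z, r ε z * fderiv ℝ (fun z => w ε z * φ z) z v‖
      ≤ ∫ z, (M * N * ((ε ^ α * ε ^ α) * (ε⁻¹ * ε ^ α))) * (|φ z| + |fderiv ℝ φ z v|) := by
        refine norm_integral_le_of_norm_le ((i1.add i2).const_mul _) (.of_forall fun z => ?_)
        rw [fderiv_mul_apply (a'.differentiable (by norm_num) z)
          (hφ.differentiable (by norm_num) z), Real.norm_eq_abs, abs_mul]
        calc |r ε z| * |w ε z * fderiv ℝ φ z v + φ z * fderiv ℝ (w ε) z v|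
            ≤ (M * (ε ^ α * ε ^ α)) *
              ((N * (ε⁻¹ * ε ^ α)) * |fderiv ℝ φ z v| + |φ z| * (N * (ε⁻¹ * ε ^ α))) := by
              gcongr
              · exact b z
              · refine (abs_add_le _ _).trans ?_
                rw [abs_mul, abs_mul]
                gcongr
                · exact (b' z).trans
                    (le_mul_of_one_le_right hN (one_le_inv_mul_rpow hα₁ hε.1 hε.2))
                · exact c' z
          _ = _ := by ring
    _ = _ := by rw [integral_const_mul, hI]; ring

end Families

/-! ### Cancellation between the momentum and transport equations -/

lemma moll_comb {f g h : ℝ × ℝ → ℝ} (hf : Continuous f) (hg : Continuous g) (hh : Continuous h)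
    (a b c ε : ℝ) : moll ε (fun z => a * f z + b * g z + c * h z) =
      fun z => a * moll ε f z + b * moll ε g z + c * moll ε h z := by
  ext z
  have i1 := (integrable_kern_mul hf ε z).const_mul a
  have i2 := (integrable_kern_mul hg ε z).const_mul b
  have i3 := (integrable_kern_mul hh ε z).const_mul c
  have i12 : Integrable fun w => a * (kern w * f (z - ε • w)) + b * (kern w * g (z - ε • w)) :=
    i1.add i2
  simp only [moll]
  rw [← integral_const_mul, ← integral_const_mul, ← integral_const_mul, ← integral_add i1 i2,
    ← integral_add i12 i3]
  exact integral_congr_ae (.of_forall fun w => by simp only; ring)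

lemma moll_neg (f : ℝ × ℝ → ℝ) (ε : ℝ) : moll ε (fun z => -f z) = fun z => -moll ε f z := by
  ext z
  simp [moll, integral_neg]

lemma fderiv_comb {f g h : ℝ × ℝ → ℝ} {z : ℝ × ℝ} (hf : DifferentiableAt ℝ f z)
    (hg : DifferentiableAt ℝ g z) (hh : DifferentiableAt ℝ h z) (a b c : ℝ) (v : ℝ × ℝ) :
    fderiv ℝ (fun z => a * f z + b * g z + c * h z) z v =
      a * fderiv ℝ f z v + b * fderiv ℝ g z v + c * fderiv ℝ h z v := by
  have : HasFDerivAt (fun z => a * f z + b * g z + c * h z) _ z :=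
    ((hf.hasFDerivAt.const_mul a).add (hg.hasFDerivAt.const_mul b)).add (hh.hasFDerivAt.const_mul c)
  rw [this.fderiv]
  simp

lemma fderiv_sub_mul {X f g : ℝ × ℝ → ℝ} {z : ℝ × ℝ} (hX : DifferentiableAt ℝ X z)
    (hf : DifferentiableAt ℝ f z) (hg : DifferentiableAt ℝ g z) (v : ℝ × ℝ) :
    fderiv ℝ (fun z => X z - f z * g z) z v =
      fderiv ℝ X z v - (f z * fderiv ℝ g z v + g z * fderiv ℝ f z v) := by
  have : HasFDerivAt (fun z => X z - f z * g z) _ z :=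
    hX.hasFDerivAt.sub (hf.hasFDerivAt.mul hg.hasFDerivAt)
  rw [this.fderiv]
  simp

/-- The combination of the momentum equations and the transport equation that only involves
commutators. Here `f₁`, `f₂` stand for the first derivatives of a stream function. -/
lemma tendsto_integral_momentum_add_transport {α : ℝ} (hα : 1 / 3 < α) (hα₁ : α ≤ 1)
    {D : Set (ℝ × ℝ)} (hD : IsOpen D) {f₁ f₂ E : ℝ × ℝ → ℝ} (h₁ : BddHolder α f₁)
    (h₂ : BddHolder α f₂) (hE : BddHolder α E)
    (curl : WeakDivEq D f₂ (fun z => -f₁ z) fun _ => 0)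
    (hA : WeakDivEq D (fun z => f₁ z * f₂ z)
      (fun z => (-1 / 2) * (f₁ z * f₁ z) + (1 / 2) * (f₂ z * f₂ z) + (-1) * E z) fun _ => 0)
    {χ : ℝ → ℝ × ℝ → ℝ} (hχ₁ : MildFamily α (1, 0) χ) (hχ₂ : MildFamily α (0, 1) χ)
    {φ : ℝ × ℝ → ℝ} (hφ : ContDiff ℝ 1 φ) (hφs : HasCompactSupport φ) (hφD : tsupport φ ⊆ D) :
    Filter.Tendsto (fun ε => ∫ z, (moll ε f₂ z *
      (partial₁ (moll ε fun z => (1 / 2) * (f₁ z * f₁ z) + (-1 / 2) * (f₂ z * f₂ z) + (-1) * E z) z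
        + partial₂ (moll ε fun z => f₁ z * f₂ z) z)
      + (partial₁ (moll ε fun z => f₂ z * E z) z + partial₂ (moll ε fun z => -(f₁ z * E z)) z))
        * (χ ε z * φ z)) (𝓝[>] 0) (𝓝 0) := by
  have hα₀ : 0 < α := by linarith
  have c₁ := h₁.continuous hα₀
  have c₂ := h₂.continuous hα₀
  have cE := hE.continuous hα₀
  -- One residual for each nonlinear entry: `R₁` for ½(f₁² - f₂²), `R₂` for f₁f₂, `R₃` for f₂E and
  -- `R₄` for -f₁E. The term -E in the momentum fields is linear and commutes with mollification.
  have sR₁ := ((SmallFamily.commutator hα₀ h₁ h₁).const_mul (1 / 2)).add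
    ((SmallFamily.commutator hα₀ h₂ h₂).const_mul (-1 / 2))
  have sR₂ := SmallFamily.commutator hα₀ h₁ h₂
  have sR₃ := SmallFamily.commutator hα₀ h₂ hE
  have sR₄ := (SmallFamily.commutator hα₀ h₁ hE).const_mul (-1)
  set R₁ : ℝ → ℝ × ℝ → ℝ := fun ε z =>
    1 / 2 * (moll ε (fun z => f₁ z * f₁ z) z - moll ε f₁ z * moll ε f₁ z) +
      -1 / 2 * (moll ε (fun z => f₂ z * f₂ z) z - moll ε f₂ z * moll ε f₂ z) with hR₁
  set R₂ : ℝ → ℝ × ℝ → ℝ := fun ε z =>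
    moll ε (fun z => f₁ z * f₂ z) z - moll ε f₁ z * moll ε f₂ z with hR₂
  set R₃ : ℝ → ℝ × ℝ → ℝ := fun ε z =>
    moll ε (fun z => f₂ z * E z) z - moll ε f₂ z * moll ε E z with hR₃
  set R₄ : ℝ → ℝ × ℝ → ℝ := fun ε z =>
    -1 * (moll ε (fun z => f₁ z * E z) z - moll ε f₁ z * moll ε E z) with hR₄
  have ma₁ : MildFamily α (1, 0) fun ε z => moll ε f₁ z * χ ε z := (MildFamily.moll hα₀ h₁).mul hχ₁
  have ma₂ : MildFamily α (0, 1) fun ε z => moll ε f₁ z * χ ε z := (MildFamily.moll hα₀ h₁).mul hχ₂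
  have mb₁ : MildFamily α (1, 0) fun ε z => moll ε f₂ z * χ ε z := (MildFamily.moll hα₀ h₂).mul hχ₁
  have mb₂ : MildFamily α (0, 1) fun ε z => moll ε f₂ z * χ ε z := (MildFamily.moll hα₀ h₂).mul hχ₂
  -- These six limits are the residuals of f₂B - f₁A + T, each derivative being multiplied by a mild
  -- factor. It remains to identify their sum with the integrand of the claim, up to the vanishing
  -- mollifications of A and of the curl.
  have lim := ((((((sR₁.tendsto_integral hα hα₁ mb₁ hφ hφs).add
    (sR₂.tendsto_integral hα hα₁ mb₂ hφ hφs)).sub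
    (sR₂.tendsto_integral hα hα₁ ma₁ hφ hφs)).add
    (sR₁.tendsto_integral hα hα₁ ma₂ hφ hφs)).add
    (sR₃.tendsto_integral hα hα₁ hχ₁ hφ hφs)).add
    (sR₄.tendsto_integral hα hα₁ hχ₂ hφ hφs))
  simp only [add_zero, sub_zero] at lim
  refine lim.congr' ?_
  have hint : ∀ {r w : ℝ → ℝ × ℝ → ℝ} {v : ℝ × ℝ}, SmallFamily α r → MildFamily α v w →
      ∀ ε, 0 < ε → ε ≤ 1 → Integrable fun z => fderiv ℝ (r ε) z v * (w ε z * φ z) := by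
    rintro r w v ⟨M, -, h⟩ ⟨N, -, h'⟩ ε hε hε₁
    exact ((((h ε hε hε₁).1.continuous_fderiv (by norm_num)).clm_apply continuous_const).mul
      ((h' ε hε hε₁).1.continuous.mul hφ.continuous)).integrable_of_hasCompactSupport
        hφs.mul_left.mul_left
  filter_upwards [Ioc_mem_nhdsGT one_pos, curl.eventually_div_moll hD c₂ c₁.neg hφs hφD,
    hA.eventually_div_moll hD (c₁.mul c₂) (by fun_prop) hφs hφD] with ε hε hcurl hAε
  have j₁ := hint sR₁ mb₁ ε hε.1 hε.2
  have j₂ := hint sR₂ mb₂ ε hε.1 hε.2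
  have j₃ := hint sR₂ ma₁ ε hε.1 hε.2
  have j₄ := hint sR₁ ma₂ ε hε.1 hε.2
  have j₅ := hint sR₃ hχ₁ ε hε.1 hε.2
  have j₆ := hint sR₄ hχ₂ ε hε.1 hε.2
  have k₂ := j₁.add j₂
  have k₃ := k₂.sub j₃
  have k₄ := k₃.add j₄
  have k₅ := k₄.add j₅
  rw [← integral_add' j₁ j₂, ← integral_sub' k₂ j₃, ← integral_add' k₃ j₄, ← integral_add' k₄ j₅,
    ← integral_add' k₅ j₆]
  refine integral_congr_ae (.of_forall fun z => ?_)
  simp only [Pi.add_apply, Pi.sub_apply]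
  by_cases hz : z ∈ tsupport φ
  swap
  · simp [image_eq_zero_of_notMem_tsupport hz]
  have dm : ∀ {f : ℝ × ℝ → ℝ}, Continuous f → DifferentiableAt ℝ (moll ε f) z := fun hf =>
    (moll_contDiff hε.1 hf (n := 1)).differentiable (by norm_num) z
  have cz := hcurl z hz
  have az := hAε z hz
  have c₁₁ : Continuous fun z => f₁ z * f₁ z := c₁.mul c₁
  have c₂₂ : Continuous fun z => f₂ z * f₂ z := c₂.mul c₂
  have c₁₂ : Continuous fun z => f₁ z * f₂ z := c₁.mul c₂
  have c₁E : Continuous fun z => f₁ z * E z := c₁.mul cE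
  have c₂E : Continuous fun z => f₂ z * E z := c₂.mul cE
  rw [moll_neg] at cz
  rw [moll_comb c₁₁ c₂₂ cE] at az
  rw [moll_comb c₁₁ c₂₂ cE, moll_neg]
  simp only [partial₁, partial₂] at cz az ⊢
  have fn : ∀ (f : ℝ × ℝ → ℝ) v, fderiv ℝ (fun z => -f z) z v = -fderiv ℝ f z v := fun f v => by
    rw [fderiv_fun_neg]; simp
  rw [fn] at cz
  rw [fderiv_comb (dm c₁₁) (dm c₂₂) (dm cE)] at az
  rw [fn, fderiv_comb (dm c₁₁) (dm c₂₂) (dm cE)]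
  have q₁ : ∀ v, fderiv ℝ (R₁ ε) z v = 1 / 2 * (fderiv ℝ (moll ε fun z => f₁ z * f₁ z) z v -
      2 * moll ε f₁ z * fderiv ℝ (moll ε f₁) z v) + -1 / 2 *
      (fderiv ℝ (moll ε fun z => f₂ z * f₂ z) z v -
      2 * moll ε f₂ z * fderiv ℝ (moll ε f₂) z v) := fun v => by
    have := fderiv_comb ((dm c₁₁).sub ((dm c₁).mul (dm c₁))) ((dm c₂₂).sub ((dm c₂).mul (dm c₂)))
      (differentiableAt_const (0 : ℝ)) (1 / 2) (-1 / 2) 0 v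
    simp only [mul_zero, add_zero, zero_mul] at this
    refine this.trans ?_
    have e₁ := fderiv_sub_mul (dm c₁₁) (dm c₁) (dm c₁) v
    have e₂ := fderiv_sub_mul (dm c₂₂) (dm c₂) (dm c₂) v
    refine congr_arg₂ _ (congr_arg _ (e₁.trans ?_)) (congr_arg _ (e₂.trans ?_)) <;> ring
  have q₄ : fderiv ℝ (R₄ ε) z (0, 1) = -(fderiv ℝ (moll ε fun z => f₁ z * E z) z (0, 1) -
      (moll ε f₁ z * fderiv ℝ (moll ε E) z (0, 1) +
        moll ε E z * fderiv ℝ (moll ε f₁) z (0, 1))) := by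
    rw [← fderiv_sub_mul (dm c₁E) (dm c₁) (dm cE), ← fn]
    simp only [hR₄, neg_one_mul]
  rw [q₁, q₁, q₄, fderiv_sub_mul (dm c₁₂) (dm c₁) (dm c₂),
    fderiv_sub_mul (dm c₁₂) (dm c₁) (dm c₂), fderiv_sub_mul (dm c₂E) (dm c₂) (dm cE)]
  -- For smooth functions f₂B + T - f₁A = -(f₁² + f₂² - E)(∂₁f₂ - ∂₂f₁), by the product rule alone.
  -- This dictates both multipliers.
  linear_combination (-(moll ε f₁ z) * χ ε z * φ z) * az +
    (moll ε f₁ z ^ 2 + moll ε f₂ z ^ 2 - moll ε E z) * χ ε z * φ z * cz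

/-- If the stream function equation and the second momentum equation hold, then so does the
transport equation. -/
lemma weakC1_transport {α : ℝ} (hα : 1 / 3 < α) (hα₁ : α ≤ 1)
    {D : Set (ℝ × ℝ)} (hD : IsOpen D) {f₁ f₂ E : ℝ × ℝ → ℝ} (h₁ : BddHolder α f₁)
    (h₂ : BddHolder α f₂) (hE : BddHolder α E)
    (curl : WeakDivEq D f₂ (fun z => -f₁ z) fun _ => 0)
    (hA : WeakDivEq D (fun z => f₁ z * f₂ z)
      (fun z => (-1 / 2) * (f₁ z * f₁ z) + (1 / 2) * (f₂ z * f₂ z) + (-1) * E z) fun _ => 0)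
    (hB : WeakDivEq D
      (fun z => (1 / 2) * (f₁ z * f₁ z) + (-1 / 2) * (f₂ z * f₂ z) + (-1) * E z)
      (fun z => f₁ z * f₂ z) fun _ => 0) :
    WeakC1 D (fun z => f₂ z * E z) (fun z => -(f₁ z * E z)) := by
  have hα₀ : 0 < α := by linarith
  have c₁ := h₁.continuous hα₀
  have c₂ := h₂.continuous hα₀
  have cE := hE.continuous hα₀
  refine weakC1_of_tendsto hα₀ (h₂.mul hE) (h₁.mul hE).neg fun φ hφ hφs hφD => ?_
  refine (tendsto_integral_momentum_add_transport hα hα₁ hD h₁ h₂ hE curl hA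
    (MildFamily.const 1) (MildFamily.const 1) hφ hφs hφD).congr' ?_
  filter_upwards [hB.eventually_div_moll hD (by fun_prop) (c₁.mul c₂) hφs hφD] with ε hε
  refine integral_congr_ae (.of_forall fun z => ?_)
  by_cases hz : z ∈ tsupport φ
  · simp only [hε z hz]; ring
  · simp [image_eq_zero_of_notMem_tsupport hz]

/-- If the stream function equation and the transport equation hold, then so does the first
momentum equation, in the absence of stagnation points. -/
lemma weakC1_momentum {α : ℝ} (hα : 1 / 3 < α) (hα₁ : α ≤ 1)
    {D : Set (ℝ × ℝ)} (hD : IsOpen D) {f₁ f₂ E : ℝ × ℝ → ℝ} (h₁ : BddHolder α f₁)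
    (h₂ : BddHolder α f₂) (hE : BddHolder α E) {m : ℝ} (hm : 0 < m) (hf₂ : ∀ z, f₂ z ≤ -m)
    (curl : WeakDivEq D f₂ (fun z => -f₁ z) fun _ => 0)
    (hA : WeakDivEq D (fun z => f₁ z * f₂ z)
      (fun z => (-1 / 2) * (f₁ z * f₁ z) + (1 / 2) * (f₂ z * f₂ z) + (-1) * E z) fun _ => 0)
    (hT : WeakDivEq D (fun z => f₂ z * E z) (fun z => -(f₁ z * E z)) fun _ => 0) :
    WeakC1 D (fun z => (1 / 2) * (f₁ z * f₁ z) + (-1 / 2) * (f₂ z * f₂ z) + (-1) * E z)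
      (fun z => f₁ z * f₂ z) := by
  have hα₀ : 0 < α := by linarith
  have c₁ := h₁.continuous hα₀
  have c₂ := h₂.continuous hα₀
  have cE := hE.continuous hα₀
  -- The kernel is nonnegative of mass one, so the mollification of `f₂` inherits the bound away
  -- from zero, uniformly in ε.
  have hlow : ∀ ε z, m ≤ |moll ε f₂ z| := fun ε z => by
    have := le_moll c₂.neg (m := m) (fun z => by simpa using neg_le_neg (hf₂ z)) ε z
    have e : moll ε (-f₂) z = -moll ε f₂ z := congr_fun (moll_neg f₂ ε) z
    rw [e] at this
    exact this.trans (neg_le_abs _)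
  -- The factor `χ` is the reciprocal of the mollified `f₂`: it cancels the coefficient of the
  -- momentum equation, and being mild it does not spoil the commutator estimate.
  have hχ : ∀ v, MildFamily α v fun ε z => (moll ε f₂ z)⁻¹ := fun v =>
    (MildFamily.moll hα₀ h₂).inv hm hlow
  refine weakC1_of_tendsto hα₀ ((((BddHolder.const _).mul (h₁.mul h₁)).add
    ((BddHolder.const _).mul (h₂.mul h₂))).add ((BddHolder.const _).mul hE)) (h₁.mul h₂)
    fun φ hφ hφs hφD => ?_
  refine (tendsto_integral_momentum_add_transport hα hα₁ hD h₁ h₂ hE curl hA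
    (hχ _) (hχ _) hφ hφs hφD).congr' ?_
  filter_upwards [hT.eventually_div_moll hD (c₂.mul cE) (c₁.mul cE).neg hφs hφD] with ε hε
  refine integral_congr_ae (.of_forall fun z => ?_)
  by_cases hz : z ∈ tsupport φ
  · have : moll ε f₂ z ≠ 0 := abs_pos.1 (hm.trans_le (hlow ε z))
    simp only [hε z hz]
    field_simp
    ring
  · simp [image_eq_zero_of_notMem_tsupport hz]

/-! ### Periodic bands -/

/-- The open band between the line `y = l` and the graph of `η`. -/
def band (l : ℝ) (η : ℝ → ℝ) : Set (ℝ × ℝ) := {z | l < z.2 ∧ z.2 < η z.1}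

/-- The closed band between the line `y = l` and the graph of `η`. -/
def closedBand (l : ℝ) (η : ℝ → ℝ) : Set (ℝ × ℝ) := {z | l ≤ z.2 ∧ z.2 ≤ η z.1}

/-- The vertical retraction onto the closed band. -/
def retract (l : ℝ) (η : ℝ → ℝ) (z : ℝ × ℝ) : ℝ × ℝ := (z.1, max l (min z.2 (η z.1)))

/-- Periodic bands whose upper boundary is a Lipschitz graph. -/
structure IsBand (L l : ℝ) (η : ℝ → ℝ) : Prop where
  period_pos : 0 < L
  periodic : Function.Periodic η L
  lipschitz : ∃ K, 0 ≤ K ∧ ∀ x y, |η x - η y| ≤ K * |x - y|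
  lt : ∀ x, l < η x

lemma band_subset_closedBand {l : ℝ} {η : ℝ → ℝ} : band l η ⊆ closedBand l η :=
  fun _ h => ⟨h.1.le, h.2.le⟩

lemma retract_eq_self {l : ℝ} {η : ℝ → ℝ} {z : ℝ × ℝ} (hz : z ∈ closedBand l η) :
    retract l η z = z := by
  rw [retract, min_eq_left hz.2, max_eq_right hz.1]

/-- Inequalities for the modulus of continuity extend to the closure. -/
lemma abs_sub_le_of_closure {D : Set (ℝ × ℝ)} {f : ℝ × ℝ → ℝ} {θ : ℝ → ℝ} (hθ : Continuous θ)
    (h : ∀ z ∈ D, ∀ w ∈ D, |f z - f w| ≤ θ (dist z w)) (hf : ContinuousOn f (closure D)) :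
    ∀ z ∈ closure D, ∀ w ∈ closure D, |f z - f w| ≤ θ (dist z w) := by
  intro z hz w hw
  have hz' : (𝓝[D] z).NeBot := mem_closure_iff_nhdsWithin_neBot.1 hz
  have hw' : (𝓝[D] w).NeBot := mem_closure_iff_nhdsWithin_neBot.1 hw
  have tz : Filter.Tendsto f (𝓝[D] z) (𝓝 (f z)) :=
    (hf z hz).mono_left (nhdsWithin_mono _ subset_closure)
  have tw : Filter.Tendsto f (𝓝[D] w) (𝓝 (f w)) :=
    (hf w hw).mono_left (nhdsWithin_mono _ subset_closure)
  have t1 : Filter.Tendsto (fun p : (ℝ × ℝ) × (ℝ × ℝ) => |f p.1 - f p.2|) (𝓝[D] z ×ˢ 𝓝[D] w)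
      (𝓝 |f z - f w|) :=
    ((tz.comp Filter.tendsto_fst).sub (tw.comp Filter.tendsto_snd)).abs
  have t2 : Filter.Tendsto (fun p : (ℝ × ℝ) × (ℝ × ℝ) => θ (dist p.1 p.2)) (𝓝[D] z ×ˢ 𝓝[D] w)
      (𝓝 (θ (dist z w))) := by
    have : Continuous fun p : (ℝ × ℝ) × (ℝ × ℝ) => θ (dist p.1 p.2) :=
      hθ.comp continuous_dist
    refine (this.tendsto (z, w)).mono_left ?_
    rw [nhds_prod_eq]
    exact Filter.prod_mono nhdsWithin_le_nhds nhdsWithin_le_nhds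
  refine le_of_tendsto_of_tendsto t1 t2 ?_
  filter_upwards [Filter.prod_mem_prod (self_mem_nhdsWithin (s := D) (a := z))
    (self_mem_nhdsWithin (s := D) (a := w))] with p hp
  exact h _ hp.1 _ hp.2

namespace IsBand

variable {L l : ℝ} {η : ℝ → ℝ} (hB : IsBand L l η)

include hB

lemma continuous : Continuous η := by
  obtain ⟨K, hK, h⟩ := hB.lipschitz
  exact (LipschitzWith.of_dist_le_mul (K := ⟨K, hK⟩) h).continuous

lemma isOpen : IsOpen (band l η) :=
  (isOpen_lt continuous_const continuous_snd).inter
    (isOpen_lt continuous_snd (hB.continuous.comp continuous_fst))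

lemma isClosed_closedBand : IsClosed (closedBand l η) :=
  (isClosed_le continuous_const continuous_snd).inter
    (isClosed_le continuous_snd (hB.continuous.comp continuous_fst))

lemma closure_band : closure (band l η) = closedBand l η := by
  refine Subset.antisymm (closure_minimal band_subset_closedBand hB.isClosed_closedBand) ?_
  rintro ⟨x, y⟩ ⟨h₁, h₂⟩
  have hy : y ∈ closure (Ioo l (η x)) := by
    rw [closure_Ioo (hB.lt x).ne]; exact ⟨h₁, h₂⟩
  exact map_mem_closure (f := fun y => (x, y)) (by fun_prop) hy fun y' hy' => ⟨hy'.1, hy'.2⟩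

lemma retract_mem (z : ℝ × ℝ) : retract l η z ∈ closedBand l η :=
  ⟨le_max_left _ _, max_le (hB.lt _).le (min_le_right _ _)⟩

lemma exists_dist_retract_le : ∃ K, 0 ≤ K ∧ ∀ z w, dist (retract l η z) (retract l η w) ≤
    K * dist z w := by
  obtain ⟨K, hK, h⟩ := hB.lipschitz
  refine ⟨1 + K, by positivity, fun z w => ?_⟩
  have d1 : |z.1 - w.1| ≤ dist z w := by rw [← Real.dist_eq]; exact le_max_left _ _
  have d2 : |z.2 - w.2| ≤ dist z w := by rw [← Real.dist_eq]; exact le_max_right _ _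
  have hd : 0 ≤ dist z w := dist_nonneg
  rw [retract, retract, Prod.dist_eq, Real.dist_eq, Real.dist_eq]
  refine max_le (d1.trans (by nlinarith)) ?_
  refine (abs_max_sub_max_le_max _ _ _ _).trans (max_le (by simp; positivity) ?_)
  refine (abs_min_sub_min_le_max _ _ _ _).trans (max_le (d2.trans (by nlinarith)) ?_)
  refine (h _ _).trans ?_
  nlinarith [mul_le_mul_of_nonneg_left d1 hK]

lemma retract_add (z : ℝ × ℝ) :
    retract l η (z.1 + L, z.2) = ((retract l η z).1 + L, (retract l η z).2) := by
  simp [retract, hB.periodic z.1]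

lemma shift_mem {z : ℝ × ℝ} (hz : z ∈ closedBand l η) : (z.1 + L, z.2) ∈ closedBand l η :=
  ⟨hz.1, by simpa [hB.periodic z.1] using hz.2⟩

lemma shift_mem_band {z : ℝ × ℝ} (hz : z ∈ band l η) : (z.1 + L, z.2) ∈ band l η :=
  ⟨hz.1, by simpa [hB.periodic z.1] using hz.2⟩

/-- Periodicity reduces the bound to the part of the closed band over one period, which is compact.
-/
lemma exists_bound {f : ℝ × ℝ → ℝ} (hf : ContinuousOn f (closedBand l η))
    (hp : PeriodicOn L f (closedBand l η)) : ∃ C, 0 ≤ C ∧ ∀ z ∈ closedBand l η, |f z| ≤ C := by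
  obtain ⟨M, hM⟩ := (isCompact_Icc (a := (0 : ℝ)) (b := L)).bddAbove_image hB.continuous.continuousOn
  have hK : IsCompact (closedBand l η ∩ (Icc 0 L ×ˢ Icc l M)) :=
    (isCompact_Icc.prod isCompact_Icc).inter_left hB.isClosed_closedBand
  obtain ⟨C, hC⟩ := hK.exists_bound_of_continuousOn (hf.mono inter_subset_left)
  refine ⟨max C 0, le_max_right _ _, fun z hz => le_max_of_le_left ?_⟩
  -- A horizontal line may leave the band between `z` and its representative in `Ico 0 L`.
  -- Composition with the retraction gives a function that is periodic on the entire line and still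
  -- has the value `f z` at `z.1`.
  have hper : Function.Periodic (fun x => f (retract l η (x, z.2))) L := fun x => by
    change f (retract l η ((x, z.2).1 + L, (x, z.2).2)) = _
    rw [hB.retract_add, hp _ (hB.retract_mem _)]
  obtain ⟨x, hx, hfx⟩ := hper.exists_mem_Ico₀ hB.period_pos z.1
  simp only [Prod.mk.eta, retract_eq_self hz] at hfx
  rw [hfx]
  have hm := hB.retract_mem (x, z.2)
  have hx' : x ∈ Icc 0 L := ⟨hx.1, hx.2.le⟩
  exact hC _ ⟨hm, hx', hm.1, hm.2.trans (hM (mem_image_of_mem η hx'))⟩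

/-- The reciprocal is continuous and periodic, hence bounded. The `+ 1` in the witness makes it
positive without further argument. -/
lemma exists_pos_le {f : ℝ × ℝ → ℝ} (hf : ContinuousOn f (closedBand l η))
    (hp : PeriodicOn L f (closedBand l η)) (hpos : ∀ z ∈ closedBand l η, 0 < f z) :
    ∃ m, 0 < m ∧ ∀ z ∈ closedBand l η, m ≤ f z := by
  obtain ⟨C, hC, h⟩ := hB.exists_bound (hf.inv₀ fun z hz => (hpos z hz).ne') fun z hz => by
    simp only [Pi.inv_apply, hp z hz]
  refine ⟨(C + 1)⁻¹, by positivity, fun z hz => ?_⟩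
  have h1 := h z hz
  rw [Pi.inv_apply, abs_of_pos (inv_pos.2 (hpos z hz))] at h1
  exact inv_le_of_inv_le₀ (hpos z hz) (by linarith)

lemma exists_gap : ∃ m, 0 < m ∧ ∀ x, l + m ≤ η x := by
  obtain ⟨m, hm, h⟩ := hB.exists_pos_le (f := fun z => η z.1 - l)
    ((hB.continuous.comp continuous_fst).sub continuous_const).continuousOn
    (fun z _ => by simp [hB.periodic z.1]) (fun z _ => sub_pos.2 (hB.lt z.1))
  exact ⟨m, hm, fun x => by linarith [h (x, l) ⟨le_rfl, (hB.lt x).le⟩]⟩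

lemma exists_height : ∃ M, 0 ≤ M ∧ ∀ x, |η x - l| ≤ M := by
  obtain ⟨m, hm, h⟩ := hB.exists_bound (f := fun z => η z.1 - l)
    ((hB.continuous.comp continuous_fst).sub continuous_const).continuousOn
    (fun z _ => by simp [hB.periodic z.1])
  exact ⟨m, hm, fun x => by simpa using h (x, l) ⟨le_rfl, (hB.lt x).le⟩⟩

/-- Hölder continuous periodic functions on the closed band, extended to the plane. -/
lemma bddHolder_comp_retract {α : ℝ} (hα : 0 < α) {f : ℝ × ℝ → ℝ} {C : ℝ}
    (hC : 0 ≤ C) (h : ∀ z ∈ closedBand l η, ∀ w ∈ closedBand l η, |f z - f w| ≤ C * dist z w ^ α)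
    (hf : ContinuousOn f (closedBand l η)) (hp : PeriodicOn L f (closedBand l η)) :
    BddHolder α fun z => f (retract l η z) := by
  obtain ⟨M, hM, hb⟩ := hB.exists_bound hf hp
  obtain ⟨K, hK, hr⟩ := hB.exists_dist_retract_le
  refine ⟨M + C * K ^ α, by positivity, fun z => ?_, fun z w => ?_⟩
  · have : 0 ≤ C * K ^ α := by positivity
    linarith [hb _ (hB.retract_mem z)]
  · calc _ ≤ C * dist (retract l η z) (retract l η w) ^ α :=
          h _ (hB.retract_mem z) _ (hB.retract_mem w)
      _ ≤ C * (K * dist z w) ^ α := by gcongr; exact hr z w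
      _ = C * K ^ α * dist z w ^ α := by rw [Real.mul_rpow hK dist_nonneg]; ring
      _ ≤ _ := by gcongr; linarith

end IsBand

/-- Hölder continuous functions extend continuously to the closure. -/
lemma exists_tendsto_of_holderOn {α : ℝ≥0} (hα : 0 < α) {D : Set (ℝ × ℝ)} {p : ℝ × ℝ → ℝ}
    (hp : HolderOn α p D) {z : ℝ × ℝ} (hz : z ∈ closure D) :
    ∃ y, Filter.Tendsto p (𝓝[D] z) (𝓝 y) := by
  obtain ⟨C, hC⟩ := hp
  have : (𝓝[D] z).NeBot := mem_closure_iff_nhdsWithin_neBot.1 hz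
  have hc : Cauchy (𝓝[D] z) := cauchy_nhds.mono nhdsWithin_le_nhds
  exact CompleteSpace.complete (hc.map_of_le (hC.uniformContinuousOn hα)
    (Filter.le_principal_iff.2 self_mem_nhdsWithin))

lemma extendFrom_eq_self {D : Set (ℝ × ℝ)} {p : ℝ × ℝ → ℝ} (hp : ContinuousOn p D) {z : ℝ × ℝ}
    (hz : z ∈ D) : extendFrom D p z = p z :=
  extendFrom_eq (subset_closure hz) (hp z hz)

lemma holder_extendFrom {α : ℝ≥0} (hα : 0 < α) {D : Set (ℝ × ℝ)} {p : ℝ × ℝ → ℝ}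
    (hp : HolderOn α p D) : ContinuousOn (extendFrom D p) (closure D) ∧
    ∃ C : ℝ, 0 ≤ C ∧ ∀ z ∈ closure D, ∀ w ∈ closure D,
      |extendFrom D p z - extendFrom D p w| ≤ C * dist z w ^ (α : ℝ) := by
  have hc : ContinuousOn (extendFrom D p) (closure D) :=
    continuousOn_extendFrom subset_rfl fun z hz => exists_tendsto_of_holderOn hα hp hz
  refine ⟨hc, ?_⟩
  obtain ⟨C, hC⟩ := hp
  refine ⟨C, C.2, abs_sub_le_of_closure (θ := fun t => C * t ^ (α : ℝ)) ?_ ?_ hc⟩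
  · exact continuous_const.mul (Real.continuous_rpow_const α.2)
  · intro z hz w hw
    rw [extendFrom_eq_self (hC.continuousOn hα) hz, extendFrom_eq_self (hC.continuousOn hα) hw,
      ← Real.dist_eq]
    exact hC.dist_le hz hw

lemma HolderOn.abs_sub_le {α : ℝ≥0} {X : Type*} [PseudoMetricSpace X] {s : Set X} {p : X → ℝ}
    (hp : HolderOn α p s) :
    ∃ C : ℝ, 0 ≤ C ∧ ∀ z ∈ s, ∀ w ∈ s, |p z - p w| ≤ C * dist z w ^ (α : ℝ) := by
  obtain ⟨C, hC⟩ := hp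
  refine ⟨C, C.2, fun z hz w hw => ?_⟩
  rw [← Real.dist_eq]
  exact hC.dist_le hz hw

lemma C0HolderPer.bddHolder {α : ℝ≥0} (hα : 0 < α) {L l : ℝ} {η : ℝ → ℝ} (hB : IsBand L l η)
    {f : ℝ × ℝ → ℝ} (hf : C0HolderPer α L (band l η) f) :
    BddHolder (α : ℝ) fun z => f (retract l η z) := by
  have h := hf.holder
  have hp := hf.periodic
  rw [hB.closure_band] at h hp
  obtain ⟨C, hC, hC'⟩ := h.abs_sub_le
  obtain ⟨C', h'⟩ := h
  exact hB.bddHolder_comp_retract (by exact_mod_cast hα) hC hC' (h'.continuousOn hα) hp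

/-! ### Functions of class `C^{1,α}` on bands -/

/-- The function `f` is continuous on the closed band, with derivatives in the open band given by
the bounded Hölder continuous functions `f₁` and `f₂`. -/
structure C1Data (α L l : ℝ) (η : ℝ → ℝ) (f f₁ f₂ : ℝ × ℝ → ℝ) : Prop where
  continuousOn : ContinuousOn f (closedBand l η)
  periodic : PeriodicOn L f (closedBand l η)
  holder₁ : BddHolder α f₁
  holder₂ : BddHolder α f₂
  periodic₁ : ∀ z, f₁ (z.1 + L, z.2) = f₁ z
  periodic₂ : ∀ z, f₂ (z.1 + L, z.2) = f₂ z
  hasFDerivAt : ∀ z ∈ band l η, HasFDerivAt f (linForm (f₁ z) (f₂ z)) z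

/-- In the open band differentiation commutes with translation; the boundary values follow by
density and continuity of the extension. -/
lemma extendFrom_partial_periodic {L l : ℝ} {η : ℝ → ℝ} (hB : IsBand L l η) {f p : ℝ × ℝ → ℝ}
    {v : ℝ × ℝ} (hv : ∀ z, p z = fderiv ℝ f z v) (hf : PeriodicOn L f (closedBand l η))
    {α : ℝ≥0} (hα : 0 < α) (hp : HolderOn α p (band l η)) :
    PeriodicOn L (extendFrom (band l η) p) (closedBand l η) := by
  have hc := (holder_extendFrom hα hp).1
  rw [hB.closure_band] at hc
  have hsub : closedBand l η ⊆ closure (band l η) := hB.closure_band.ge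
  obtain ⟨C, hC⟩ := hp
  have hpc := hC.continuousOn hα
  refine EqOn.of_subset_closure (s := band l η) (fun z hz => ?_) ?_ hc band_subset_closedBand hsub
  · rw [extendFrom_eq_self hpc hz, extendFrom_eq_self hpc (hB.shift_mem_band hz), hv, hv]
    have e : (z.1 + L, z.2) = z + (L, 0) := by ext <;> simp
    rw [e, ← fderiv_comp_add_right]
    congr 1
    refine Filter.EventuallyEq.fderiv_eq ?_
    filter_upwards [hB.isOpen.mem_nhds hz] with w hw
    have := hf w (band_subset_closedBand hw)
    rwa [show (w.1 + L, w.2) = w + (L, 0) by ext <;> simp] at this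
  · exact hc.comp (by fun_prop) fun z hz => hB.shift_mem hz

/-- Composed with the retraction, the derivatives become bounded Hölder functions on the whole
plane, so that they can be mollified without cutoffs near the boundary. -/
lemma C1HolderPer.c1Data {α : ℝ≥0} (hα : 0 < α) {L l : ℝ} {η : ℝ → ℝ} (hB : IsBand L l η)
    {f : ℝ × ℝ → ℝ} (hf : C1HolderPer α L (band l η) f) :
    C1Data α L l η f (fun z => d₁ (band l η) f (retract l η z))
      (fun z => d₂ (band l η) f (retract l η z)) := by
  have hcl := hB.closure_band
  have hper := hf.periodic
  have hcont := hf.continuousOn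
  rw [hcl] at hper hcont
  have p1 := extendFrom_partial_periodic hB (p := partial₁ f) (fun _ => rfl) hper hα hf.holder₁
  have p2 := extendFrom_partial_periodic hB (p := partial₂ f) (fun _ => rfl) hper hα hf.holder₂
  obtain ⟨c1, C1, hC1, h1⟩ := holder_extendFrom hα hf.holder₁
  obtain ⟨c2, C2, hC2, h2⟩ := holder_extendFrom hα hf.holder₂
  rw [hcl] at c1 h1 c2 h2
  refine ⟨hcont, hper, hB.bddHolder_comp_retract (by exact_mod_cast hα) hC1 h1 c1 p1,
    hB.bddHolder_comp_retract (by exact_mod_cast hα) hC2 h2 c2 p2, fun z => ?_, fun z => ?_,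
    fun z hz => ?_⟩
  · rw [hB.retract_add]; exact p1 _ (hB.retract_mem z)
  · rw [hB.retract_add]; exact p2 _ (hB.retract_mem z)
  · obtain ⟨K1, hK1⟩ := hf.holder₁
    obtain ⟨K2, hK2⟩ := hf.holder₂
    rw [retract_eq_self (band_subset_closedBand hz), d₁, d₂,
      extendFrom_eq_self (hK1.continuousOn hα) hz, extendFrom_eq_self (hK2.continuousOn hα) hz,
      ← fderiv_eq_linForm]
    exact (hf.differentiableOn.differentiableAt (hB.isOpen.mem_nhds hz)).hasFDerivAt

namespace C1Data

variable {α : ℝ≥0} {L l : ℝ} {η : ℝ → ℝ} {f f₁ f₂ : ℝ × ℝ → ℝ}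

lemma partial₁_eq (hf : C1Data α L l η f f₁ f₂) {z : ℝ × ℝ} (hz : z ∈ band l η) :
    partial₁ f z = f₁ z := by
  simp [partial₁, (hf.hasFDerivAt z hz).fderiv]

lemma partial₂_eq (hf : C1Data α L l η f f₁ f₂) {z : ℝ × ℝ} (hz : z ∈ band l η) :
    partial₂ f z = f₂ z := by
  simp [partial₂, (hf.hasFDerivAt z hz).fderiv]

lemma c1HolderPer (hB : IsBand L l η) (hf : C1Data α L l η f f₁ f₂) :
    C1HolderPer α L (band l η) f := by
  have h : ∀ {p q : ℝ × ℝ → ℝ}, (∀ z ∈ band l η, p z = q z) → BddHolder (α : ℝ) q →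
      HolderOn α p (band l η) := fun hpq hq => by
    obtain ⟨C, hC⟩ := hq.holderOn (band l η)
    exact ⟨C, fun z hz w hw => by rw [hpq z hz, hpq w hw]; exact hC z hz w hw⟩
  refine ⟨?_, fun z hz => (hf.hasFDerivAt z hz).differentiableAt.differentiableWithinAt,
    h (fun z hz => hf.partial₁_eq hz) hf.holder₁, h (fun z hz => hf.partial₂_eq hz) hf.holder₂, ?_⟩
  · rw [hB.closure_band]; exact hf.continuousOn
  · rw [hB.closure_band]; exact hf.periodic

lemma d₁_eq (hα : 0 < α) (hf : C1Data α L l η f f₁ f₂) {z : ℝ × ℝ}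
    (hz : z ∈ closure (band l η)) : d₁ (band l η) f z = f₁ z := by
  refine extendFrom_eq hz ?_
  refine (((hf.holder₁.continuous (by exact_mod_cast hα)).tendsto z).mono_left
    nhdsWithin_le_nhds).congr' ?_
  filter_upwards [self_mem_nhdsWithin] with w hw using (hf.partial₁_eq hw).symm

lemma d₂_eq (hα : 0 < α) (hf : C1Data α L l η f f₁ f₂) {z : ℝ × ℝ}
    (hz : z ∈ closure (band l η)) : d₂ (band l η) f z = f₂ z := by
  refine extendFrom_eq hz ?_
  refine (((hf.holder₂.continuous (by exact_mod_cast hα)).tendsto z).mono_left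
    nhdsWithin_le_nhds).congr' ?_
  filter_upwards [self_mem_nhdsWithin] with w hw using (hf.partial₂_eq hw).symm

lemma neg (hf : C1Data α L l η f f₁ f₂) :
    C1Data α L l η (fun z => -f z) (fun z => -f₁ z) (fun z => -f₂ z) where
  continuousOn := hf.continuousOn.neg
  periodic z hz := by simp only [hf.periodic z hz]
  holder₁ := hf.holder₁.neg
  holder₂ := hf.holder₂.neg
  periodic₁ z := by rw [hf.periodic₁]
  periodic₂ z := by rw [hf.periodic₂]
  hasFDerivAt z hz := by
    have : linForm (-f₁ z) (-f₂ z) = -linForm (f₁ z) (f₂ z) := by ext <;> simp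
    rw [this]
    exact (hf.hasFDerivAt z hz).neg

end C1Data

lemma norm_linForm_le (a b : ℝ) : ‖linForm a b‖ ≤ |a| + |b| := by
  refine ContinuousLinearMap.opNorm_le_bound _ (by positivity) fun v => ?_
  rw [linForm_apply, Real.norm_eq_abs, add_mul]
  refine (abs_add_le _ _).trans ?_
  rw [abs_mul, abs_mul]
  gcongr
  exacts [norm_fst_le v, norm_snd_le v]

/-- Functions with bounded derivatives on a band are Lipschitz continuous. -/
lemma IsBand.exists_lipschitz {L l : ℝ} {η : ℝ → ℝ} (hB : IsBand L l η) {f f₁ f₂ : ℝ × ℝ → ℝ}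
    {M : ℝ} (hM : 0 ≤ M) (hf : ContinuousOn f (closedBand l η))
    (hd : ∀ z ∈ band l η, HasFDerivAt f (linForm (f₁ z) (f₂ z)) z)
    (h₁ : ∀ z, |f₁ z| ≤ M) (h₂ : ∀ z, |f₂ z| ≤ M) :
    ∃ K, 0 ≤ K ∧ ∀ z ∈ closedBand l η, ∀ w ∈ closedBand l η, |f z - f w| ≤ K * dist z w := by
  obtain ⟨κ, hκ, hη⟩ := hB.lipschitz
  obtain ⟨m, hm, hgap⟩ := hB.exists_gap
  have hmean : ∀ s : Set (ℝ × ℝ), Convex ℝ s → s ⊆ band l η → ∀ z ∈ s, ∀ w ∈ s,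
      |f z - f w| ≤ 2 * M * dist z w := fun s hs hsub z hz w hw => by
    rw [dist_eq_norm]
    exact Convex.norm_image_sub_le_of_norm_hasFDerivWithin_le
      (fun ζ hζ => (hd ζ (hsub hζ)).hasFDerivWithinAt)
      (fun ζ _ => (norm_linForm_le _ _).trans (by linarith [h₁ ζ, h₂ ζ])) hs hw hz
  have key : ∀ z ∈ band l η, ∀ w ∈ band l η, |f z - f w| ≤ (2 * M * (2 * κ + 3)) * dist z w := by
    rintro ⟨x, y⟩ ⟨hz₁, hz₂⟩ ⟨x', y'⟩ ⟨hw₁, hw₂⟩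
    simp only at hz₁ hz₂ hw₁ hw₂
    set δ := |x - x'| with hδ
    have hδ0 : 0 ≤ δ := abs_nonneg _
    -- Two points are joined by a vertical descent to the height `lev`, a horizontal segment and a
    -- vertical ascent. A level κδ below the lower point keeps the segment under the graph, whose
    -- slope is at most κ. If that level is too low, one close to the bottom is used instead, which
    -- is under the graph because of the gap `m`. Each vertical part has length at most (κ + 1)d and
    -- the horizontal part at most d, which gives the factor 2κ + 3.
    set lev := max (min y y' - κ * δ) (min (min y y') (l + m / 2)) with hlev
    have hκδ : 0 ≤ κ * δ := by positivity
    have l1 : lev ≤ min y y' := max_le (by linarith) (min_le_left _ _)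
    have l2 : l < lev := lt_max_of_lt_right (lt_min (lt_min hz₁ hw₁) (by linarith))
    have l3 : min y y' - κ * δ ≤ lev := le_max_left _ _
    have ly : lev ≤ y := l1.trans (min_le_left _ _)
    have ly' : lev ≤ y' := l1.trans (min_le_right _ _)
    have hyy : |y - y'| ≤ dist (x, y) (x', y') := by
      rw [← Real.dist_eq]; exact le_max_right _ _
    have hxx : δ ≤ dist (x, y) (x', y') := by
      rw [hδ, ← Real.dist_eq]; exact le_max_left _ _
    have my : y - min y y' ≤ |y - y'| := by
      rcases le_total y y' with h | h
      · rw [min_eq_left h]; simp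
      · rw [min_eq_right h]; exact le_abs_self _
    have my' : y' - min y y' ≤ |y - y'| := by
      rcases le_total y y' with h | h
      · rw [min_eq_left h, abs_sub_comm]; exact le_abs_self _
      · rw [min_eq_right h]; simp
    have v1 := hmean ({x} ×ˢ Icc lev y) ((convex_singleton x).prod (convex_Icc lev y))
      (by
        rintro ⟨a, b⟩ ⟨ha, hb⟩
        rw [mem_singleton_iff] at ha
        simp only at ha hb
        subst ha
        exact ⟨l2.trans_le hb.1, hb.2.trans_lt hz₂⟩) (x, y) ⟨rfl, ly, le_rfl⟩ (x, lev)
      ⟨rfl, le_rfl, ly⟩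
    have v2 := hmean ({x'} ×ˢ Icc lev y') ((convex_singleton x').prod (convex_Icc lev y'))
      (by
        rintro ⟨a, b⟩ ⟨ha, hb⟩
        rw [mem_singleton_iff] at ha
        simp only at ha hb
        subst ha
        exact ⟨l2.trans_le hb.1, hb.2.trans_lt hw₂⟩) (x', y') ⟨rfl, ly', le_rfl⟩ (x', lev)
      ⟨rfl, le_rfl, ly'⟩
    have v3 := hmean (uIcc x x' ×ˢ {lev}) ((convex_uIcc x x').prod (convex_singleton lev))
      (by
        rintro ⟨a, b⟩ ⟨ha, hb⟩
        rw [mem_singleton_iff] at hb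
        simp only at ha hb
        subst hb
        refine ⟨l2, ?_⟩
        simp only
        refine max_lt ?_ ((min_le_right _ _).trans_lt (by linarith [hgap a]))
        have h4 : |x - a| ≤ δ := by
          rw [abs_sub_comm, hδ, abs_sub_comm x x']; exact abs_sub_left_of_mem_uIcc ha
        have h5 := (le_abs_self _).trans (hη x a)
        have h6 : κ * |x - a| ≤ κ * δ := by gcongr
        have h7 := min_le_left y y'
        linarith) (x, lev) ⟨left_mem_uIcc, rfl⟩ (x', lev) ⟨right_mem_uIcc, rfl⟩
    have e1 : dist (x, y) (x, lev) = y - lev := by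
      simp [Prod.dist_eq, Real.dist_eq, abs_of_nonneg (sub_nonneg.2 ly), sub_nonneg.2 ly]
    have e2 : dist (x', y') (x', lev) = y' - lev := by
      simp [Prod.dist_eq, Real.dist_eq, abs_of_nonneg (sub_nonneg.2 ly'), sub_nonneg.2 ly']
    have e3 : dist (x, lev) (x', lev) = δ := by
      simp [Prod.dist_eq, Real.dist_eq, hδ]
    rw [e1] at v1
    rw [e2] at v2
    rw [e3] at v3
    set d := dist (x, y) (x', y') with hd
    have hκd : κ * δ ≤ κ * d := by gcongr
    have t : |f (x, y) - f (x', y')| ≤ |f (x, y) - f (x, lev)| + |f (x, lev) - f (x', lev)| +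
        |f (x', y') - f (x', lev)| := by
      have := abs_add_three (f (x, y) - f (x, lev)) (f (x, lev) - f (x', lev))
        (f (x', lev) - f (x', y'))
      rw [abs_sub_comm (f (x', y'))]
      refine le_trans (le_of_eq ?_) this
      congr 1; ring
    have b1 : y - lev ≤ κ * d + d := by linarith
    have b2 : y' - lev ≤ κ * d + d := by linarith
    have n1 : 2 * M * (y - lev) ≤ 2 * M * (κ * d + d) := by gcongr
    have n2 : 2 * M * (y' - lev) ≤ 2 * M * (κ * d + d) := by gcongr
    have n3 : 2 * M * δ ≤ 2 * M * d := by gcongr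
    calc _ ≤ 2 * M * (κ * d + d) + 2 * M * d + 2 * M * (κ * d + d) := by linarith
      _ = _ := by ring
  refine ⟨2 * M * (2 * κ + 3), by positivity, ?_⟩
  rw [← hB.closure_band] at hf ⊢
  exact abs_sub_le_of_closure (θ := fun t => (2 * M * (2 * κ + 3)) * t) (by fun_prop) key hf

/-! ### Exchanging the vertical coordinate and an increasing function -/

lemma C1Data.exists_lipschitz {α L l : ℝ} {η : ℝ → ℝ} {f f₁ f₂ : ℝ × ℝ → ℝ}
    (hB : IsBand L l η) (hf : C1Data α L l η f f₁ f₂) :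
    ∃ K, 0 ≤ K ∧ ∀ z ∈ closedBand l η, ∀ w ∈ closedBand l η, |f z - f w| ≤ K * dist z w := by
  obtain ⟨C, hC, h₁, -⟩ := hf.holder₁
  obtain ⟨C', hC', h₂, -⟩ := hf.holder₂
  exact hB.exists_lipschitz (M := C + C') (by positivity) hf.continuousOn hf.hasFDerivAt
    (fun z => by linarith [h₁ z]) (fun z => by linarith [h₂ z])

/-- Derivatives along curves in the closed band, including the boundary curves. -/
lemma C1Data.hasDerivAt_curve {α L l : ℝ} (hα : 0 < α) {η : ℝ → ℝ} {f f₁ f₂ : ℝ × ℝ → ℝ}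
    (hB : IsBand L l η) (hf : C1Data α L l η f f₁ f₂) {η' : ℝ → ℝ}
    (hη : ∀ x, HasDerivAt η (η' x) x) {t : ℝ} (ht : t ∈ Icc (0 : ℝ) 1) (x : ℝ) :
    HasDerivAt (fun x => f (x, l + t * (η x - l))) (f₁ (x, l + t * (η x - l)) +
      f₂ (x, l + t * (η x - l)) * (t * η' x)) x := by
  have hne : (𝓝[Ioo 0 1] t).NeBot :=
    mem_closure_iff_nhdsWithin_neBot.1 (by rwa [closure_Ioo zero_ne_one])
  have hmem : ∀ s ∈ Icc (0 : ℝ) 1, ∀ x, (x, l + s * (η x - l)) ∈ closedBand l η := fun s hs x => by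
    have := (sub_pos.2 (hB.lt x)).le
    exact ⟨by simp only; nlinarith [hs.1, mul_nonneg hs.1 this],
      by simp only; nlinarith [mul_le_mul_of_nonneg_right hs.2 this]⟩
  have hmem' : ∀ s ∈ Ioo (0 : ℝ) 1, ∀ x, (x, l + s * (η x - l)) ∈ band l η := fun s hs x => by
    have := sub_pos.2 (hB.lt x)
    exact ⟨by simp only; nlinarith [hs.1, mul_pos hs.1 this],
      by simp only; nlinarith [mul_lt_mul_of_pos_right hs.2 this]⟩
  obtain ⟨C, hC, -, hC'⟩ := hf.holder₁
  obtain ⟨K, hK, hKb, hK'⟩ := hf.holder₂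
  obtain ⟨B, hB0, hBd⟩ := hB.exists_height
  obtain ⟨N, hN, hNl⟩ := hB.lipschitz
  have hη' : ∀ x, |η' x| ≤ N := fun x => by
    have := (hη x).hasFDerivAt.le_of_lip' hN (.of_forall fun y => hNl y x)
    simpa using this
  have hdist : ∀ s x, dist ((x, l + s * (η x - l)) : ℝ × ℝ) (x, l + t * (η x - l)) ≤
      |s - t| * B := fun s x => by
    rw [Prod.dist_eq, dist_self, Real.dist_eq, max_eq_right (abs_nonneg _), add_sub_add_left_eq_sub,
      ← sub_mul, abs_mul]
    gcongr
    exact hBd x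
  -- For `s` in the open unit interval the curve at relative height `s` lies in the open band, where
  -- the chain rule applies. As `s` tends to `t` the derivatives converge uniformly in `x`, by the
  -- Hölder bounds on `f₁` and `f₂`; so the formula persists on the boundary, where `f` itself need
  -- not be differentiable in the plane.
  refine hasDerivAt_of_tendstoUniformly (l := 𝓝[Ioo 0 1] t)
    (f := fun s x => f (x, l + s * (η x - l)))
    (f' := fun s x => f₁ (x, l + s * (η x - l)) + f₂ (x, l + s * (η x - l)) * (s * η' x))
    (g' := fun x => f₁ (x, l + t * (η x - l)) + f₂ (x, l + t * (η x - l)) * (t * η' x))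
    ?_ ?_ ?_ x
  · rw [Metric.tendstoUniformly_iff]
    intro e he
    have hlim : Filter.Tendsto (fun s => C * (|s - t| * B) ^ α + K * (|s - t| * B) ^ α * N +
        K * |s - t| * N) (𝓝[Ioo 0 1] t) (𝓝 0) := by
      have hc : Continuous fun s => C * (|s - t| * B) ^ α + K * (|s - t| * B) ^ α * N +
          K * |s - t| * N := by
        have : Continuous fun s => (|s - t| * B) ^ α :=
          (Real.continuous_rpow_const hα.le).comp (by fun_prop)
        fun_prop
      have := hc.tendsto t
      simp only [sub_self, abs_zero, zero_mul, Real.zero_rpow hα.ne', mul_zero, add_zero] at this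
      exact this.mono_left nhdsWithin_le_nhds
    filter_upwards [hlim.eventually (gt_mem_nhds he), self_mem_nhdsWithin] with s hs hs01 x
    refine lt_of_le_of_lt ?_ hs
    rw [dist_comm, Real.dist_eq]
    have hp : dist ((x, l + s * (η x - l)) : ℝ × ℝ) (x, l + t * (η x - l)) ^ α ≤
        (|s - t| * B) ^ α := by
      gcongr
      exact hdist s x
    have i1 := (hC' (x, l + s * (η x - l)) (x, l + t * (η x - l))).trans
      (mul_le_mul_of_nonneg_left hp hC)
    have i2 := (hK' (x, l + s * (η x - l)) (x, l + t * (η x - l))).trans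
      (mul_le_mul_of_nonneg_left hp hK)
    have s1 : |s * η' x| ≤ N := by
      rw [abs_mul, abs_of_pos hs01.1]
      nlinarith [hη' x, abs_nonneg (η' x), hs01.2, hs01.1]
    calc _ = |(f₁ (x, l + s * (η x - l)) - f₁ (x, l + t * (η x - l))) +
          (f₂ (x, l + s * (η x - l)) - f₂ (x, l + t * (η x - l))) * (s * η' x) +
          f₂ (x, l + t * (η x - l)) * (s - t) * η' x| := by congr 1; ring
      _ ≤ _ := by
        refine (abs_add_three _ _ _).trans ?_
        rw [abs_mul _ (s * η' x), abs_mul (_ * (s - t)), abs_mul _ (s - t)]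
        gcongr
        exacts [hKb _, hη' x]
  · filter_upwards [self_mem_nhdsWithin] with s hs x
    have h1 := hf.hasFDerivAt _ (hmem' s hs x)
    have h2 : HasDerivAt (fun x => ((x, l + s * (η x - l)) : ℝ × ℝ)) (1, s * η' x) x :=
      (hasDerivAt_id x).prodMk ((((hη x).sub_const l).const_mul s).const_add l)
    have h3 : HasDerivAt (fun x => f (x, l + s * (η x - l))) _ x := h1.comp_hasDerivAt x h2
    simpa using h3
  · intro x
    have hc := (hf.continuousOn _ (hmem t ht x)).tendsto
    refine hc.comp (tendsto_nhdsWithin_iff.2 ⟨?_, ?_⟩)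
    · have : Continuous fun s : ℝ => ((x, l + s * (η x - l)) : ℝ × ℝ) := by fun_prop
      exact (this.tendsto t).mono_left nhdsWithin_le_nhds
    · filter_upwards [self_mem_nhdsWithin] with s hs using hmem s ⟨hs.1.le, hs.2.le⟩ x

/-- Two functions `f` and `k` such that `(x, y) ↦ (x, f (x, y))` and `(x, p) ↦ (x, k (x, p))` are
inverse homeomorphisms of the plane which restrict to `C¹` diffeomorphisms of two bands. -/
structure BandPair (α L l l' : ℝ) (η η₂ : ℝ → ℝ) (f k f₁ f₂ k₁ k₂ : ℝ × ℝ → ℝ) : Prop where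
  isBand_dom : IsBand L l η
  isBand_cod : IsBand L l' η₂
  lipschitz : ∃ K, 0 ≤ K ∧ ∀ z w, |f z - f w| ≤ K * dist z w
  lipschitz_inv : ∃ K, 0 ≤ K ∧ ∀ z w, |k z - k w| ≤ K * dist z w
  left_inv : ∀ z : ℝ × ℝ, k (z.1, f z) = z.2
  right_inv : ∀ z : ℝ × ℝ, f (z.1, k z) = z.2
  mem_iff : ∀ z : ℝ × ℝ, (z.1, f z) ∈ band l' η₂ ↔ z ∈ band l η
  mem_closed_iff : ∀ z : ℝ × ℝ, (z.1, f z) ∈ closedBand l' η₂ ↔ z ∈ closedBand l η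
  data : C1Data α L l η f f₁ f₂
  data_inv : C1Data α L l' η₂ k k₁ k₂
  pos : ∀ z, 0 < f₂ z
  inv₁ : ∀ z : ℝ × ℝ, k₁ (z.1, f z) = -f₁ z / f₂ z
  inv₂ : ∀ z : ℝ × ℝ, k₂ (z.1, f z) = 1 / f₂ z

namespace BandPair

variable {α L l l' : ℝ} {η η₂ : ℝ → ℝ} {f k f₁ f₂ k₁ k₂ : ℝ × ℝ → ℝ}

lemma inv_eq (P : BandPair α L l l' η η₂ f k f₁ f₂ k₁ k₂) (w : ℝ × ℝ) :
    k₁ w = -f₁ (w.1, k w) / f₂ (w.1, k w) ∧ k₂ w = 1 / f₂ (w.1, k w) := by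
  rw [← P.inv₁ (w.1, k w), ← P.inv₂ (w.1, k w)]
  simp only [P.right_inv, Prod.mk.eta, and_self]

lemma continuous (P : BandPair α L l l' η η₂ f k f₁ f₂ k₁ k₂) : Continuous f := by
  obtain ⟨K, hK, h⟩ := P.lipschitz
  exact (LipschitzWith.of_dist_le_mul (K := ⟨K, hK⟩) h).continuous

/-- By this symmetry every transformation rule is proved once and used in both directions. -/
lemma symm (P : BandPair α L l l' η η₂ f k f₁ f₂ k₁ k₂) :
    BandPair α L l' l η₂ η k f k₁ k₂ f₁ f₂ where
  isBand_dom := P.isBand_cod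
  isBand_cod := P.isBand_dom
  lipschitz := P.lipschitz_inv
  lipschitz_inv := P.lipschitz
  left_inv := P.right_inv
  right_inv := P.left_inv
  mem_iff w := by rw [← P.mem_iff (w.1, k w)]; simp only [P.right_inv, Prod.mk.eta]
  mem_closed_iff w := by rw [← P.mem_closed_iff (w.1, k w)]; simp only [P.right_inv, Prod.mk.eta]
  data := P.data_inv
  data_inv := P.data
  pos w := by rw [(P.inv_eq w).2]; exact one_div_pos.2 (P.pos _)
  inv₁ w := by
    have := (P.pos (w.1, k w)).ne'
    rw [(P.inv_eq w).2, (P.inv_eq w).1]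
    field_simp
  inv₂ w := by
    rw [(P.inv_eq w).2, one_div_one_div]

lemma hasFDerivAt_comp (P : BandPair α L l l' η η₂ f k f₁ f₂ k₁ k₂) {Φ : ℝ × ℝ → ℝ}
    (hΦ : ContDiff ℝ 1 Φ) {z : ℝ × ℝ} (hz : z ∈ band l η) :
    HasFDerivAt (fun z : ℝ × ℝ => Φ (z.1, f z))
      (linForm (partial₁ Φ (z.1, f z) + f₁ z * partial₂ Φ (z.1, f z))
        (f₂ z * partial₂ Φ (z.1, f z))) z := by
  have h1 : HasFDerivAt (fun z : ℝ × ℝ => (z.1, f z))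
      ((ContinuousLinearMap.fst ℝ ℝ ℝ).prod (linForm (f₁ z) (f₂ z))) z :=
    hasFDerivAt_fst.prodMk (P.data.hasFDerivAt z hz)
  have h2 := (hΦ.differentiable (by norm_num) (z.1, f z)).hasFDerivAt
  rw [fderiv_eq_linForm] at h2
  have h3 : HasFDerivAt (fun z : ℝ × ℝ => Φ (z.1, f z)) _ z := h2.comp z h1
  refine h3.congr_fderiv ?_
  ext <;> simp <;> ring

/-- Transplanted test functions. -/
lemma test_comp (hα : 0 < α) (P : BandPair α L l l' η η₂ f k f₁ f₂ k₁ k₂) {Φ : ℝ × ℝ → ℝ}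
    (hΦ : ContDiff ℝ 1 Φ) (hΦs : HasCompactSupport Φ) (hΦD : tsupport Φ ⊆ band l' η₂) :
    ContDiff ℝ 1 (fun z : ℝ × ℝ => Φ (z.1, f z)) ∧
    HasCompactSupport (fun z : ℝ × ℝ => Φ (z.1, f z)) ∧
    tsupport (fun z : ℝ × ℝ => Φ (z.1, f z)) ⊆ band l η := by
  have cH : Continuous fun z : ℝ × ℝ => (z.1, f z) := continuous_fst.prodMk P.continuous
  have cG : Continuous fun w : ℝ × ℝ => (w.1, k w) := continuous_fst.prodMk P.symm.continuous
  have ht : tsupport (fun z : ℝ × ℝ => Φ (z.1, f z)) ⊆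
      (fun z : ℝ × ℝ => (z.1, f z)) ⁻¹' tsupport Φ := tsupport_comp_subset_preimage Φ cH
  have hD : tsupport (fun z : ℝ × ℝ => Φ (z.1, f z)) ⊆ band l η := fun z hz =>
    (P.mem_iff z).1 (hΦD (ht hz))
  refine ⟨?_, ?_, hD⟩
  · refine contDiff_one_iff_hasFDerivAt.2 ⟨fun z => linForm
      (partial₁ Φ (z.1, f z) + f₁ z * partial₂ Φ (z.1, f z)) (f₂ z * partial₂ Φ (z.1, f z)),
      ?_, fun z => ?_⟩
    · have c1 := (partial₁_continuous hΦ).comp cH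
      have c2 := (partial₂_continuous hΦ).comp cH
      have c3 := P.data.holder₁.continuous hα
      have c4 := P.data.holder₂.continuous hα
      exact ((c1.add (c3.mul c2)).smul continuous_const).add ((c4.mul c2).smul continuous_const)
    · by_cases hz : z ∈ tsupport (fun z : ℝ × ℝ => Φ (z.1, f z))
      · exact P.hasFDerivAt_comp hΦ (hD hz)
      -- Outside the band the chain rule is not available. There the transplanted function vanishes
      -- near `z`, and the proposed derivative is zero as well.
      · by_cases hz' : z ∈ band l η
        · exact P.hasFDerivAt_comp hΦ hz'
        · have hn : (z.1, f z) ∉ tsupport Φ := fun h => hz' ((P.mem_iff z).1 (hΦD h))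
          have hl : linForm 0 0 = 0 := by ext <;> simp
          simp only
          rw [partial₁_eq_zero hn, partial₂_eq_zero hn, mul_zero, mul_zero, add_zero, hl]
          refine (hasFDerivAt_const (0 : ℝ) z).congr_of_eventuallyEq ?_
          exact notMem_tsupport_iff_eventuallyEq.1 hz
  -- The support is a closed subset of the image of a compact set under the continuous inverse map.
  · have hK : IsCompact ((fun w : ℝ × ℝ => (w.1, k w)) '' tsupport Φ) := hΦs.image cG
    refine hK.of_isClosed_subset (isClosed_tsupport _) fun z hz => ⟨(z.1, f z), ht hz, ?_⟩
    simp only [P.left_inv, Prod.mk.eta]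

end BandPair

lemma det_shear (a b : ℝ) :
    ((ContinuousLinearMap.fst ℝ ℝ ℝ).prod (linForm a b)).det = b := by
  rw [ContinuousLinearMap.det, ← LinearMap.det_toMatrix (Module.Basis.finTwoProd ℝ),
    Matrix.det_fin_two]
  simp [LinearMap.toMatrix_apply]

namespace BandPair

variable {α L l l' : ℝ} {η η₂ : ℝ → ℝ} {f k f₁ f₂ k₁ k₂ : ℝ × ℝ → ℝ}

lemma image_band (P : BandPair α L l l' η η₂ f k f₁ f₂ k₁ k₂) :
    (fun z : ℝ × ℝ => (z.1, f z)) '' band l η = band l' η₂ := by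
  ext w
  constructor
  · rintro ⟨z, hz, rfl⟩
    exact (P.mem_iff z).2 hz
  · intro hw
    refine ⟨(w.1, k w), (P.symm.mem_iff w).2 hw, ?_⟩
    simp only [P.right_inv, Prod.mk.eta]

lemma setIntegral_eq (P : BandPair α L l l' η η₂ f k f₁ f₂ k₁ k₂) (g : ℝ × ℝ → ℝ) :
    ∫ w in band l' η₂, g w = ∫ z in band l η, f₂ z * g (z.1, f z) := by
  rw [← P.image_band, integral_image_eq_integral_abs_det_fderiv_smul volume
    P.isBand_dom.isOpen.measurableSet
    (fun z hz => (hasFDerivAt_fst.prodMk (P.data.hasFDerivAt z hz)).hasFDerivWithinAt)]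
  · simp only [det_shear, abs_of_pos (P.pos _), smul_eq_mul]
  · intro z _ w _ h
    simp only [Prod.mk.injEq] at h
    have := P.left_inv z
    rw [h.1, h.2, P.left_inv] at this
    exact Prod.ext h.1 this.symm

/-- Divergence equations are transformed by the Piola transform. -/
lemma weakC1 (hα : 0 < α) (P : BandPair α L l l' η η₂ f k f₁ f₂ k₁ k₂) {a b a' b' : ℝ × ℝ → ℝ}
    (ha : ∀ z ∈ band l η, a z = f₂ z * a' (z.1, f z))
    (hb : ∀ z ∈ band l η, a z * f₁ z + b z * f₂ z = f₂ z * b' (z.1, f z))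
    (h : WeakC1 (band l η) a b) : WeakC1 (band l' η₂) a' b' := fun Φ h₁ h₂ h₃ => by
  obtain ⟨t₁, t₂, t₃⟩ := P.test_comp hα h₁ h₂ h₃
  rw [P.setIntegral_eq, ← h _ t₁ t₂ t₃]
  refine setIntegral_congr_fun P.isBand_dom.isOpen.measurableSet fun z hz => ?_
  have hd := (P.hasFDerivAt_comp h₁ hz).fderiv
  have e1 : partial₁ (fun z : ℝ × ℝ => Φ (z.1, f z)) z =
      partial₁ Φ (z.1, f z) + f₁ z * partial₂ Φ (z.1, f z) := by
    rw [partial₁, hd]; simp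
  have e2 : partial₂ (fun z : ℝ × ℝ => Φ (z.1, f z)) z = f₂ z * partial₂ Φ (z.1, f z) := by
    rw [partial₂, hd]; simp
  simp only [e1, e2]
  -- The pairing of (a, b) with the gradient of the transplanted test is a ∂₁Φ + (a f₁ + b f₂) ∂₂Φ.
  -- By `ha` and `hb` this is the Jacobian f₂ times the pairing of (a', b') with the gradient of Φ.
  linear_combination (-partial₁ Φ (z.1, f z)) * ha z hz - partial₂ Φ (z.1, f z) * hb z hz

end BandPair

/-- The extension of `f` beyond the closed band with slope one in the vertical direction. -/
def extendVertical (l : ℝ) (η : ℝ → ℝ) (f : ℝ × ℝ → ℝ) (z : ℝ × ℝ) : ℝ :=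
  f (retract l η z) + (z.2 - (retract l η z).2)

lemma extendVertical_eq {l : ℝ} {η : ℝ → ℝ} (f : ℝ × ℝ → ℝ) {z : ℝ × ℝ}
    (hz : z ∈ closedBand l η) : extendVertical l η f z = f z := by
  rw [extendVertical, retract_eq_self hz, sub_self, add_zero]

section Extension

variable {α L l m : ℝ} {η : ℝ → ℝ} {f f₁ f₂ : ℝ × ℝ → ℝ}

lemma C1Data.mul_sub_le (hf : C1Data α L l η f f₁ f₂)
    (hm : ∀ z ∈ band l η, m ≤ f₂ z) {x y y' : ℝ} (hy : l ≤ y) (hyy : y ≤ y') (hy' : y' ≤ η x) :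
    m * (y' - y) ≤ f (x, y') - f (x, y) := by
  have hd : ∀ s ∈ Ioo l (η x), HasDerivAt (fun s => f (x, s)) (f₂ (x, s)) s := fun s hs => by
    have h1 := hf.hasFDerivAt (x, s) hs
    have h2 : HasDerivAt (fun s : ℝ => ((x, s) : ℝ × ℝ)) (0, 1) s :=
      (hasDerivAt_const s x).prodMk (hasDerivAt_id s)
    have h3 : HasDerivAt (fun s => f (x, s)) _ s := h1.comp_hasDerivAt s h2
    simpa using h3
  refine Convex.mul_sub_le_image_sub_of_le_deriv (convex_Icc l (η x)) (f := fun s => f (x, s))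
    ?_ ?_ ?_ y ⟨hy, hyy.trans hy'⟩ y' ⟨hy.trans hyy, hy'⟩ hyy
  · exact hf.continuousOn.comp (by fun_prop) fun s hs => hs
  · rw [interior_Icc]
    exact fun s hs => (hd s hs).differentiableAt.differentiableWithinAt
  · rw [interior_Icc]
    intro s hs
    rw [(hd s hs).deriv]
    exact hm (x, s) hs

/-- A vertical increment splits into the part covered by the retracted points, where the slope is at
least `m`, and the part outside the band, where the slope is one. The split is legitimate because
the retraction does not expand vertical distances. -/
lemma extendVertical_mul_sub_le (hB : IsBand L l η) (hf : C1Data α L l η f f₁ f₂)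
    (hm : ∀ z ∈ band l η, m ≤ f₂ z) {x y y' : ℝ} (hyy : y ≤ y') :
    min m 1 * (y' - y) ≤ extendVertical l η f (x, y') - extendVertical l η f (x, y) := by
  set r := max l (min y (η x)) with hr
  set r' := max l (min y' (η x)) with hr'
  have hrr : r ≤ r' := max_le_max le_rfl (min_le_min hyy le_rfl)
  have hlt := hB.lt x
  have hd : r' - r ≤ y' - y := by
    rw [hr, hr']
    rcases max_cases l (min y (η x)) with h1 | h1 <;> rcases max_cases l (min y' (η x)) with h2 | h2
      <;> rcases min_cases y (η x) with h3 | h3 <;> rcases min_cases y' (η x) with h4 | h4 <;>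
      linarith
  have hs := hf.mul_sub_le hm (x := x) (le_max_left _ _ : l ≤ r) hrr
    (max_le hlt.le (min_le_right _ _))
  have e : extendVertical l η f (x, y') - extendVertical l η f (x, y) =
      (f (x, r') - f (x, r)) + ((y' - y) - (r' - r)) := by
    simp only [extendVertical, retract]; ring
  rw [e]
  have h1 : min m 1 * (r' - r) ≤ m * (r' - r) :=
    mul_le_mul_of_nonneg_right (min_le_left _ _) (by linarith)
  have h2 : min m 1 * ((y' - y) - (r' - r)) ≤ 1 * ((y' - y) - (r' - r)) :=
    mul_le_mul_of_nonneg_right (min_le_right _ _) (by linarith)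
  linarith

lemma extendVertical_exists_lipschitz (hB : IsBand L l η) (hf : C1Data α L l η f f₁ f₂) :
    ∃ K, 0 ≤ K ∧ ∀ z w, |extendVertical l η f z - extendVertical l η f w| ≤ K * dist z w := by
  obtain ⟨K, hK, h⟩ := hf.exists_lipschitz hB
  obtain ⟨κ, hκ, hr⟩ := hB.exists_dist_retract_le
  refine ⟨K * κ + 1 + κ, by positivity, fun z w => ?_⟩
  have h1 := (h _ (hB.retract_mem z) _ (hB.retract_mem w)).trans
    (mul_le_mul_of_nonneg_left (hr z w) hK)
  have h2 : |z.2 - w.2| ≤ dist z w := by rw [← Real.dist_eq]; exact le_max_right _ _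
  have h3 : |(retract l η z).2 - (retract l η w).2| ≤ κ * dist z w := by
    rw [← Real.dist_eq]; exact (le_max_right _ _).trans (hr z w)
  calc _ = |(f (retract l η z) - f (retract l η w)) + (z.2 - w.2) +
        -((retract l η z).2 - (retract l η w).2)| := by
        simp only [extendVertical]; congr 1; ring
    _ ≤ _ := by
      refine (abs_add_three _ _ _).trans ?_
      rw [abs_neg]
      linarith

/-- Global inverse in the vertical direction. -/
lemma exists_vertical_inverse {F : ℝ × ℝ → ℝ} {μ K : ℝ} (hμ : 0 < μ)
    (hF : ∀ x y y', y ≤ y' → μ * (y' - y) ≤ F (x, y') - F (x, y)) (hK : 0 ≤ K)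
    (hlip : ∀ z w, |F z - F w| ≤ K * dist z w) :
    ∃ k : ℝ × ℝ → ℝ, (∀ z : ℝ × ℝ, k (z.1, F z) = z.2) ∧ (∀ z : ℝ × ℝ, F (z.1, k z) = z.2) ∧
      ∃ K', 0 ≤ K' ∧ ∀ z w, |k z - k w| ≤ K' * dist z w := by
  have hc : Continuous F := (LipschitzWith.of_dist_le_mul (K := ⟨K, hK⟩) hlip).continuous
  have hsurj : ∀ x, Function.Surjective fun y => F (x, y) := fun x => by
    refine Continuous.surjective (by fun_prop) ?_ ?_
    · refine Filter.tendsto_atTop_mono' _ ?_ (Filter.tendsto_atTop_add_const_left _ (F (x, 0))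
        (Filter.tendsto_id.const_mul_atTop hμ))
      filter_upwards [Filter.eventually_ge_atTop 0] with y hy
      have := hF x 0 y hy
      simp only [id]; linarith
    · refine Filter.tendsto_atBot_mono' _ ?_ (Filter.tendsto_atBot_add_const_left _ (F (x, 0))
        (Filter.tendsto_id.const_mul_atBot hμ))
      filter_upwards [Filter.eventually_le_atBot 0] with y hy
      have := hF x y 0 hy
      simp only [id]; linarith
  choose k hk using hsurj
  have habs : ∀ x y y', μ * |y' - y| ≤ |F (x, y') - F (x, y)| := fun x y y' => by
    rcases le_total y y' with h | h
    · rw [abs_of_nonneg (sub_nonneg.2 h)]; exact (hF x y y' h).trans (le_abs_self _)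
    · rw [abs_sub_comm, abs_sub_comm (F _), abs_of_nonneg (sub_nonneg.2 h)]
      exact (hF x y' y h).trans (le_abs_self _)
  -- For the Lipschitz constant, `k w` is compared with `k z` on the vertical line through `z`.
  -- Moving the base point changes `F` by at most K times the distance, the target heights differ by
  -- at most the distance, and inversion divides by μ.
  refine ⟨fun z => k z.1 z.2, fun z => ?_, fun z => hk z.1 z.2, μ⁻¹ * (1 + K), by positivity,
    fun z w => ?_⟩
  · have := habs z.1 z.2 (k z.1 (F z))
    simp only at hk ⊢
    rw [hk, Prod.mk.eta, sub_self, abs_zero] at this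
    have h0 : |k z.1 (F z) - z.2| = 0 :=
      le_antisymm (by by_contra hcon; push Not at hcon; nlinarith [mul_pos hμ hcon]) (abs_nonneg _)
    exact sub_eq_zero.1 (abs_eq_zero.1 h0)
  · have h1 := habs z.1 (k w.1 w.2) (k z.1 z.2)
    simp only at hk
    rw [hk] at h1
    have h2 := hlip (w.1, k w.1 w.2) (z.1, k w.1 w.2)
    rw [hk] at h2
    have d1 : |w.1 - z.1| ≤ dist z w := by
      rw [← Real.dist_eq, dist_comm]; exact le_max_left _ _
    have d2 : |z.2 - w.2| ≤ dist z w := by rw [← Real.dist_eq]; exact le_max_right _ _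
    have d3 : dist ((w.1, k w.1 w.2) : ℝ × ℝ) (z.1, k w.1 w.2) = |w.1 - z.1| := by
      simp [Prod.dist_eq, Real.dist_eq]
    rw [d3] at h2
    have h3 : |z.2 - F (z.1, k w.1 w.2)| ≤ dist z w + K * dist z w := by
      calc _ = |(z.2 - w.2) + (w.2 - F (z.1, k w.1 w.2))| := by congr 1; ring
        _ ≤ _ := (abs_add_le _ _).trans (by nlinarith)
    rw [mul_assoc, le_inv_mul_iff₀ hμ]
    simp only
    linarith

end Extension

/-- A function on a band that is increasing in the vertical direction has an inverse of the same
regularity. -/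
theorem exists_bandPair {α L l l' m : ℝ} (hα : 0 < α) {η η₂ : ℝ → ℝ} {f f₁ f₂ : ℝ × ℝ → ℝ}
    (hB : IsBand L l η) (hf : C1Data α L l η f f₁ f₂) (hm : 0 < m) (hm₂ : ∀ z, m ≤ f₂ z)
    (hbot : ∀ x, f (x, l) = l') (htop : ∀ x, f (x, η x) = η₂ x) :
    ∃ F k k₁ k₂, (∀ z ∈ closedBand l η, F z = f z) ∧
      BandPair α L l l' η η₂ F k f₁ f₂ k₁ k₂ := by
  obtain ⟨K, hK, hlip⟩ := extendVertical_exists_lipschitz hB hf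
  have hslope : ∀ x y y', y ≤ y' → min m 1 * (y' - y) ≤
      extendVertical l η f (x, y') - extendVertical l η f (x, y) := fun x y y' h =>
    extendVertical_mul_sub_le hB hf (fun z _ => hm₂ z) h
  have hμ : 0 < min m 1 := lt_min hm one_pos
  obtain ⟨k, hkl, hkr, K', hK', hklip⟩ := exists_vertical_inverse hμ hslope hK hlip
  have hFe : ∀ z ∈ closedBand l η, extendVertical l η f z = f z := fun z hz =>
    extendVertical_eq f hz
  have hFper : ∀ z : ℝ × ℝ, extendVertical l η f (z.1 + L, z.2) = extendVertical l η f z :=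
    fun z => by
      simp only [extendVertical, hB.retract_add, hf.periodic _ (hB.retract_mem z)]
  set F := extendVertical l η f with hF
  have hFc : Continuous F := (LipschitzWith.of_dist_le_mul (K := ⟨K, hK⟩) hlip).continuous
  have hkc : Continuous k := (LipschitzWith.of_dist_le_mul (K := ⟨K', hK'⟩) hklip).continuous
  have hmono : ∀ x, StrictMono fun y => F (x, y) := fun x y y' h => by
    have := hslope x y y' h.le
    have h2 := mul_pos hμ (sub_pos.2 h)
    simp only; linarith
  have hFbot : ∀ x, F (x, l) = l' := fun x => by rw [hFe _ ⟨le_rfl, (hB.lt x).le⟩, hbot]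
  have hFtop : ∀ x, F (x, η x) = η₂ x := fun x => by rw [hFe _ ⟨(hB.lt x).le, le_rfl⟩, htop]
  have hmem : ∀ z : ℝ × ℝ, (z.1, F z) ∈ band l' η₂ ↔ z ∈ band l η := fun z => by
    have h1 := (hmono z.1).lt_iff_lt (a := l) (b := z.2)
    have h2 := (hmono z.1).lt_iff_lt (a := z.2) (b := η z.1)
    simp only [hFbot, hFtop, Prod.mk.eta] at h1 h2
    exact and_congr h1 h2
  have hmemc : ∀ z : ℝ × ℝ, (z.1, F z) ∈ closedBand l' η₂ ↔ z ∈ closedBand l η := fun z => by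
    have h1 := (hmono z.1).le_iff_le (a := l) (b := z.2)
    have h2 := (hmono z.1).le_iff_le (a := z.2) (b := η z.1)
    simp only [hFbot, hFtop, Prod.mk.eta] at h1 h2
    exact and_congr h1 h2
  have hkmem : ∀ w : ℝ × ℝ, (w.1, k w) ∈ band l η ↔ w ∈ band l' η₂ := fun w => by
    rw [← hmem]; simp only [hkr, Prod.mk.eta]
  have hB₂ : IsBand L l' η₂ := by
    refine ⟨hB.period_pos, fun x => ?_, ?_, fun x => ?_⟩
    · rw [← hFtop, ← hFtop, hB.periodic x]; exact hFper (x, η x)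
    · obtain ⟨κ, hκ, hη⟩ := hB.lipschitz
      refine ⟨K * (1 + κ), by positivity, fun x y => ?_⟩
      rw [← hFtop, ← hFtop]
      refine (hlip _ _).trans ?_
      rw [mul_assoc]
      gcongr
      rw [Prod.dist_eq, Real.dist_eq, Real.dist_eq]
      exact max_le (by nlinarith [abs_nonneg (x - y)])
        ((hη x y).trans (by nlinarith [abs_nonneg (x - y)]))
    · rw [← hFbot x, ← hFtop]; exact hmono x (hB.lt x)
  have hFd : ∀ z ∈ band l η, HasFDerivAt F (linForm (f₁ z) (f₂ z)) z := fun z hz => by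
    refine (hf.hasFDerivAt z hz).congr_of_eventuallyEq ?_
    filter_upwards [hB.isOpen.mem_nhds hz] with w hw using hFe w (band_subset_closedBand hw)
  have hdata : C1Data α L l η F f₁ f₂ := ⟨hFc.continuousOn, fun z _ => hFper z, hf.holder₁,
    hf.holder₂, hf.periodic₁, hf.periodic₂, hFd⟩
  have hf₂ : ∀ z, 0 < f₂ z := fun z => hm.trans_le (hm₂ z)
  -- The inverse is periodic since `F` is periodic and the solution of `F (x, y) = p` for given `x`
  -- and `p` is unique.
  have hkper : ∀ w : ℝ × ℝ, k (w.1 + L, w.2) = k w := fun w => by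
    have h1 := hkl (w.1 + L, k w)
    have h2 := hFper (w.1, k w)
    simp only at h1 h2
    rwa [h2, hkr] at h1
  have hG : ∀ z w : ℝ × ℝ, dist (z.1, k z) (w.1, k w) ≤ (1 + K') * dist z w := fun z w => by
    rw [Prod.dist_eq (x := (z.1, k z))]
    have h1 : dist z.1 w.1 ≤ dist z w := le_max_left _ _
    refine max_le (h1.trans ?_) ?_
    · nlinarith [dist_nonneg (x := z) (y := w)]
    · rw [Real.dist_eq]
      exact (hklip z w).trans (by nlinarith [dist_nonneg (x := z) (y := w)])
  have hq₁ : BddHolder α fun z => -f₁ z / f₂ z :=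
    hf.holder₁.neg.div hf.holder₂ hm fun z => (hm₂ z).trans (le_abs_self _)
  have hq₂ : BddHolder α fun z => 1 / f₂ z :=
    (BddHolder.const 1).div hf.holder₂ hm fun z => (hm₂ z).trans (le_abs_self _)
  refine ⟨F, k, fun w => -f₁ (w.1, k w) / f₂ (w.1, k w), fun w => 1 / f₂ (w.1, k w), hFe, hB, hB₂,
    ⟨K, hK, hlip⟩, ⟨K', hK', hklip⟩, hkl, hkr, hmem, hmemc, hdata, ?_, hf₂, fun z => ?_, fun z => ?_⟩
  · refine ⟨hkc.continuousOn, fun z _ => hkper z, hq₁.comp_lipschitz hα.le hG,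
      hq₂.comp_lipschitz hα.le hG, fun z => ?_, fun z => ?_, fun w hw => ?_⟩
    · have h1 := hf.periodic₁ (z.1, k z)
      have h2 := hf.periodic₂ (z.1, k z)
      simp only at h1 h2
      simp only [hkper, h1, h2]
    · have h2 := hf.periodic₂ (z.1, k z)
      simp only at h2
      simp only [hkper, h2]
    · set p := (w.1, k w) with hp
      have hne := (hf₂ p).ne'
      -- The derivative of (x, y) ↦ (x, F(x, y)) is triangular and is inverted explicitly. As the
      -- inverse map is already known and continuous, its differentiability follows pointwise,
      -- without the inverse function theorem.
      let e : (ℝ × ℝ) ≃L[ℝ] (ℝ × ℝ) := ContinuousLinearEquiv.equivOfInverse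
        ((ContinuousLinearMap.fst ℝ ℝ ℝ).prod (linForm (f₁ p) (f₂ p)))
        ((ContinuousLinearMap.fst ℝ ℝ ℝ).prod (linForm (-f₁ p / f₂ p) (1 / f₂ p)))
        (fun v => by ext <;> simp; field_simp; ring) (fun v => by ext <;> simp; field_simp; ring)
      have h1 : HasFDerivAt (fun z : ℝ × ℝ => (z.1, F z)) (e : ℝ × ℝ →L[ℝ] ℝ × ℝ) p :=
        hasFDerivAt_fst.prodMk (hFd p ((hkmem w).2 hw))
      have h2 : HasFDerivAt (fun w : ℝ × ℝ => (w.1, k w)) (e.symm : ℝ × ℝ →L[ℝ] ℝ × ℝ) w :=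
        HasFDerivAt.of_local_left_inverse (by fun_prop) h1
          (.of_forall fun w => by simp only [hkr, Prod.mk.eta])
      have h3 : HasFDerivAt k _ w := h2.snd
      exact h3
  · simp only [hkl, Prod.mk.eta]
  · simp only [hkl, Prod.mk.eta]

/-! ### Stream function and height formulations -/

lemma C1HolderPerLine.deriv_periodic {α : ℝ≥0} {L : ℝ} {η : ℝ → ℝ} (hη : C1HolderPerLine α L η) :
    Function.Periodic (deriv η) L := fun x => by
  rw [← deriv_comp_add_const]
  congr 1
  ext y
  exact hη.periodic y

lemma C1HolderPerLine.isBand {α : ℝ≥0} (hα : 0 < α) {L : ℝ} (hL : 0 < L) {η : ℝ → ℝ}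
    (hη : C1HolderPerLine α L η) (hpos : ∀ x, 0 < η x) : IsBand L 0 η := by
  obtain ⟨C, hC⟩ := hη.holder
  have hc : Continuous (deriv η) := by
    rw [← continuousOn_univ]; exact hC.continuousOn hα
  obtain ⟨M, hM⟩ := (isCompact_Icc (a := (0 : ℝ)) (b := L)).exists_bound_of_continuousOn
    hc.continuousOn
  have hb : ∀ x, ‖deriv η x‖ ≤ max M 0 := fun x => by
    obtain ⟨y, hy, hxy⟩ := hη.deriv_periodic.exists_mem_Ico₀ hL x
    rw [hxy]
    exact (hM y ⟨hy.1, hy.2.le⟩).trans (le_max_left _ _)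
  refine ⟨hL, hη.periodic, ⟨max M 0, le_max_right _ _, fun x y => ?_⟩, hpos⟩
  exact convex_univ.norm_image_sub_le_of_norm_deriv_le (fun z _ => hη.differentiable z)
    (fun z _ => hb z) (mem_univ y) (mem_univ x)

lemma isBand_strip {L p₀ : ℝ} (hL : 0 < L) (hp₀ : p₀ < 0) : IsBand L p₀ (fun _ => 0) :=
  ⟨hL, fun _ => rfl, ⟨0, le_rfl, by simp⟩, fun _ => hp₀⟩

/-- A Hölder continuous function on a compact interval, extended by constants. -/
def clampFun (p₀ : ℝ) (Γ : ℝ → ℝ) (p : ℝ) : ℝ := Γ (max p₀ (min p 0))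

lemma clampFun_eq {p₀ p : ℝ} (Γ : ℝ → ℝ) (h : p ∈ Icc p₀ 0) : clampFun p₀ Γ p = Γ p := by
  rw [clampFun, min_eq_left h.2, max_eq_right h.1]

lemma bddHolder_clampFun {α : ℝ≥0} (hα : 0 < α) {p₀ : ℝ} (hp : p₀ ≤ 0) {Γ : ℝ → ℝ}
    (hΓ : HolderOn α Γ (Icc p₀ 0)) : BddHolder (α : ℝ) (clampFun p₀ Γ) := by
  obtain ⟨C, hC, h⟩ := hΓ.abs_sub_le
  obtain ⟨C', hC'⟩ := hΓ
  obtain ⟨M, hM⟩ := (isCompact_Icc (a := p₀) (b := 0)).exists_bound_of_continuousOn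
    (hC'.continuousOn hα)
  have hmem : ∀ p, max p₀ (min p 0) ∈ Icc p₀ 0 := fun p =>
    ⟨le_max_left _ _, max_le hp (min_le_right _ _)⟩
  have hM0 : 0 ≤ M := (norm_nonneg _).trans (hM 0 ⟨hp, le_rfl⟩)
  refine ⟨M + C, by positivity, fun p => ?_, fun p q => ?_⟩
  · exact (hM _ (hmem p)).trans (le_add_of_nonneg_right hC)
  · refine (h _ (hmem p) _ (hmem q)).trans ?_
    have hd : dist (max p₀ (min p 0)) (max p₀ (min q 0)) ≤ dist p q := by
      rw [Real.dist_eq, Real.dist_eq]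
      refine (abs_max_sub_max_le_max _ _ _ _).trans (max_le (by simp) ?_)
      exact (abs_min_sub_min_le_max _ _ _ _).trans (max_le le_rfl (by simp))
    gcongr
    exact le_add_of_nonneg_left hM0

lemma C1Data.exists_lipschitz_retract {α L l : ℝ} {η : ℝ → ℝ} {f f₁ f₂ : ℝ × ℝ → ℝ}
    (hB : IsBand L l η) (hf : C1Data α L l η f f₁ f₂) :
    ∃ K, 0 ≤ K ∧ ∀ z w, |f (retract l η z) - f (retract l η w)| ≤ K * dist z w := by
  obtain ⟨K, hK, h⟩ := hf.exists_lipschitz hB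
  obtain ⟨κ, hκ, hr⟩ := hB.exists_dist_retract_le
  refine ⟨K * κ, by positivity, fun z w => ?_⟩
  rw [mul_assoc]
  exact (h _ (hB.retract_mem z) _ (hB.retract_mem w)).trans (mul_le_mul_of_nonneg_left (hr z w) hK)

lemma C1Data.congr {α L l : ℝ} {η : ℝ → ℝ} {f g f₁ f₂ : ℝ × ℝ → ℝ}
    (hB : IsBand L l η) (hf : C1Data α L l η f f₁ f₂) (h : ∀ z ∈ closedBand l η, f z = g z) :
    C1Data α L l η g f₁ f₂ where
  continuousOn := hf.continuousOn.congr fun z hz => (h z hz).symm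
  periodic z hz := by rw [← h z hz, ← h _ (hB.shift_mem hz), hf.periodic z hz]
  holder₁ := hf.holder₁
  holder₂ := hf.holder₂
  periodic₁ := hf.periodic₁
  periodic₂ := hf.periodic₂
  hasFDerivAt z hz := by
    refine (hf.hasFDerivAt z hz).congr_of_eventuallyEq ?_
    filter_upwards [hB.isOpen.mem_nhds hz] with w hw using (h w (band_subset_closedBand hw)).symm

namespace BandPair

variable {α : ℝ≥0} {L p₀ : ℝ} {η : ℝ → ℝ} {F H f₁ f₂ h₁ h₂ : ℝ × ℝ → ℝ}

lemma mem_Icc (P : BandPair α L 0 p₀ η (fun _ => 0) F H f₁ f₂ h₁ h₂) {z : ℝ × ℝ}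
    (hz : z ∈ closedBand 0 η) : F z ∈ Icc p₀ 0 := (P.mem_closed_iff z).2 hz

/-- The function `Γ (-ψ)` is Hölder continuous. -/
lemma bddHolder_clampFun_comp (hα : 0 < α)
    (P : BandPair α L 0 p₀ η (fun _ => 0) F H f₁ f₂ h₁ h₂) {Γ : ℝ → ℝ}
    (hΓ : HolderOn α Γ (Icc p₀ 0)) :
    BddHolder (α : ℝ) fun z => clampFun p₀ Γ (F (retract 0 η z)) := by
  obtain ⟨K, -, hK⟩ := P.data.exists_lipschitz_retract P.isBand_dom
  exact (bddHolder_clampFun hα (P.isBand_cod.lt 0).le hΓ).comp_lipschitz α.2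
    (φ := fun z => F (retract 0 η z)) hK

/-- Dividing by the Jacobian turns the first component into f₁ = -h₁/h₂ and the second into ½(f₁² +
f₂²) - Γ = (1 + h₁²)/(2h₂²) - Γ. This is the negative of the height field, hence the change of sign
at the end. -/
lemma weakC1_stream_to_height (hα : 0 < α)
    (P : BandPair α L 0 p₀ η (fun _ => 0) F H f₁ f₂ h₁ h₂) {Γ : ℝ → ℝ}
    (h : WeakC1 (band 0 η) (fun z => f₁ z * f₂ z)
      (fun z => -(1 / 2) * (f₁ z ^ 2 - f₂ z ^ 2) - Γ (F z))) :
    WeakC1 (band p₀ fun _ => 0) (fun z => h₁ z / h₂ z)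
      (fun z => -((1 + h₁ z ^ 2) / (2 * h₂ z ^ 2)) + Γ z.2) := by
  have key : WeakC1 (band p₀ fun _ => 0) (fun z => -(h₁ z / h₂ z))
      (fun z => -(-((1 + h₁ z ^ 2) / (2 * h₂ z ^ 2)) + Γ z.2)) := by
    refine P.weakC1 (by exact_mod_cast hα) (fun z _ => ?_) (fun z _ => ?_) h
    · have := (P.pos z).ne'
      rw [P.inv₁, P.inv₂]
      field_simp
    · have := (P.pos z).ne'
      rw [P.inv₁, P.inv₂]
      field_simp
      ring
  simpa only [neg_neg] using key.neg

lemma weakC1_height_to_stream (hα : 0 < α)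
    (P : BandPair α L 0 p₀ η (fun _ => 0) F H f₁ f₂ h₁ h₂) {Γ : ℝ → ℝ}
    (h : WeakC1 (band p₀ fun _ => 0) (fun z => h₁ z / h₂ z)
      (fun z => -((1 + h₁ z ^ 2) / (2 * h₂ z ^ 2)) + Γ z.2)) :
    WeakC1 (band 0 η) (fun z => f₁ z * f₂ z)
      (fun z => -(1 / 2) * (f₁ z ^ 2 - f₂ z ^ 2) - Γ (F z)) := by
  have key : WeakC1 (band 0 η) (fun z => -(f₁ z * f₂ z))
      (fun z => -(-(1 / 2) * (f₁ z ^ 2 - f₂ z ^ 2) - Γ (F z))) := by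
    refine P.symm.weakC1 (by exact_mod_cast hα) (fun z _ => ?_) (fun z _ => ?_) h
    · have := (P.symm.pos z).ne'
      rw [P.symm.inv₁, P.symm.inv₂]
      field_simp
    · have := (P.symm.pos z).ne'
      simp only [P.symm.inv₁, P.symm.inv₂, P.right_inv]
      field_simp
      ring
  simpa only [neg_neg] using key.neg

/-- Since `Γ` is controlled only on `[p₀, 0]`, it is replaced by its clamped version. The field then
is Hölder continuous on the plane and can be mollified, and it is unchanged in the band. -/
lemma stream_weakC1 (hα : 0 < α)
    (P : BandPair α L 0 p₀ η (fun _ => 0) F H f₁ f₂ h₁ h₂) {Γ : ℝ → ℝ}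
    (hΓ : HolderOn α Γ (Icc p₀ 0))
    (h : WeakDivEq (band 0 η) (fun z => f₁ z * f₂ z)
      (fun z => -(1 / 2) * (f₁ z ^ 2 - f₂ z ^ 2) - Γ (F z)) fun _ => 0) :
    WeakC1 (band 0 η) (fun z => f₁ z * f₂ z)
      (fun z => -(1 / 2) * (f₁ z ^ 2 - f₂ z ^ 2) - Γ (F z)) := by
  have hD := P.isBand_dom.isOpen
  have e : ∀ z ∈ band 0 η, -(1 / 2) * (f₁ z ^ 2 - f₂ z ^ 2) - Γ (F z) =
      -(1 / 2) * (f₁ z ^ 2 - f₂ z ^ 2) - clampFun p₀ Γ (F (retract 0 η z)) := fun z hz => by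
    rw [retract_eq_self (band_subset_closedBand hz),
      clampFun_eq Γ (P.mem_Icc (band_subset_closedBand hz))]
  refine ((h.congr hD.measurableSet (fun _ _ => rfl) e).weakC1 (α := α) (by exact_mod_cast hα) hD
    (P.data.holder₁.mul P.data.holder₂) ?_).congr hD.measurableSet (fun _ _ => rfl)
      fun z hz => (e z hz).symm
  exact ((BddHolder.const _).mul (P.data.holder₁.sq.sub P.data.holder₂.sq)).sub
    (P.bddHolder_clampFun_comp hα hΓ)

lemma height_weakC1 (hα : 0 < α)
    (P : BandPair α L 0 p₀ η (fun _ => 0) F H f₁ f₂ h₁ h₂) {Γ : ℝ → ℝ}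
    (hΓ : HolderOn α Γ (Icc p₀ 0)) {m : ℝ} (hm : 0 < m) (hm₂ : ∀ z, m ≤ h₂ z)
    (h : WeakDivEq (band p₀ fun _ => 0) (fun z => h₁ z / h₂ z)
      (fun z => -((1 + h₁ z ^ 2) / (2 * h₂ z ^ 2)) + Γ z.2) fun _ => 0) :
    WeakC1 (band p₀ fun _ => 0) (fun z => h₁ z / h₂ z)
      (fun z => -((1 + h₁ z ^ 2) / (2 * h₂ z ^ 2)) + Γ z.2) := by
  have hD := P.isBand_cod.isOpen
  have e : ∀ z ∈ band p₀ (fun _ => 0), -((1 + h₁ z ^ 2) / (2 * h₂ z ^ 2)) + Γ z.2 =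
      -((1 + h₁ z ^ 2) / (2 * h₂ z ^ 2)) + clampFun p₀ Γ z.2 := fun z hz => by
    rw [clampFun_eq Γ (show z.2 ∈ Icc p₀ 0 from band_subset_closedBand hz)]
  refine ((h.congr hD.measurableSet (fun _ _ => rfl) e).weakC1 (α := α) (by exact_mod_cast hα) hD
    (P.data_inv.holder₁.div P.data_inv.holder₂ hm fun z => (hm₂ z).trans (le_abs_self _))
    ?_).congr hD.measurableSet (fun _ _ => rfl) fun z hz => (e z hz).symm
  have hsq : ∀ z, 2 * m ^ 2 ≤ |2 * h₂ z ^ 2| := fun z =>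
    le_trans (by gcongr; exact hm₂ z) (le_abs_self _)
  refine (((BddHolder.const 1).add P.data_inv.holder₁.sq).div
    ((BddHolder.const 2).mul P.data_inv.holder₂.sq) (by positivity) hsq).neg.add
    ((bddHolder_clampFun hα (P.isBand_cod.lt 0).le hΓ).comp_lipschitz α.2 (φ := Prod.snd) (K := 1)
      fun z w => ?_)
  rw [one_mul]
  exact le_max_right _ _

end BandPair

section Equivalence

variable {α : ℝ≥0} {L g p₀ Q : ℝ} {Γ η : ℝ → ℝ} {ψ h F H f₁ f₂ h₁ h₂ : ℝ × ℝ → ℝ}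

lemma BandPair.streamHeightCorr (P : BandPair α L 0 p₀ η (fun _ => 0) F H f₁ f₂ h₁ h₂)
    (hψ : ∀ z ∈ closedBand 0 η, F z = -ψ z)
    (hh : ∀ z ∈ closedBand p₀ (fun _ => 0), H z = h z) : StreamHeightCorr p₀ η ψ h := by
  have c1 : closure (fluidDomain η) = closedBand 0 η := P.isBand_dom.closure_band
  have c2 : closure (strip p₀) = closedBand p₀ (fun _ => 0) := P.isBand_cod.closure_band
  have m1 : ∀ z ∈ closedBand 0 η, (z.1, -ψ z) ∈ closedBand p₀ (fun _ => 0) := fun z hz => by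
    rw [← hψ z hz]; exact (P.mem_closed_iff z).2 hz
  have m2 : ∀ z ∈ closedBand p₀ (fun _ => 0), (z.1, h z) ∈ closedBand 0 η := fun z hz => by
    rw [← hh z hz]; exact (P.symm.mem_closed_iff z).2 hz
  refine ⟨by rwa [c1, c2], by rwa [c1, c2], ?_, ?_⟩
  · rw [c2]
    intro z hz
    rw [← hψ _ (m2 z hz), ← hh z hz, P.right_inv]
  · rw [c1]
    intro z hz
    rw [← hh _ (m1 z hz), ← hψ z hz, P.left_inv]

/-- The stream function equation and the height equation correspond to each other. -/
lemma BandPair.isStreamSolution_iff (hα : 0 < α)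
    (P : BandPair α L 0 p₀ η (fun _ => 0) F H f₁ f₂ h₁ h₂)
    (hψ : ∀ z ∈ closedBand 0 η, F z = -ψ z)
    (hh : ∀ z ∈ closedBand p₀ (fun _ => 0), H z = h z)
    (hbot : ∀ x, F (x, 0) = p₀) (htop : ∀ x, F (x, η x) = 0)
    (hη : C1HolderPerLine α L η) :
    IsStreamSolution α L g p₀ Q Γ η ψ ↔ IsHeightSolution α L g p₀ Q Γ h := by
  have dψ : C1Data α L 0 η ψ (fun z => -f₁ z) (fun z => -f₂ z) :=
    P.data.neg.congr P.isBand_dom fun z hz => by simp only [hψ z hz, neg_neg]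
  have dh : C1Data α L p₀ (fun _ => 0) h h₁ h₂ := P.data_inv.congr P.isBand_cod hh
  have c1 : closure (fluidDomain η) = closedBand 0 η := P.isBand_dom.closure_band
  have c2 : closure (strip p₀) = closedBand p₀ (fun _ => 0) := P.isBand_cod.closure_band
  have e1 : ∀ z ∈ closedBand 0 η, d₁ (fluidDomain η) ψ z = -f₁ z := fun z hz =>
    dψ.d₁_eq hα (c1.ge hz)
  have e2 : ∀ z ∈ closedBand 0 η, d₂ (fluidDomain η) ψ z = -f₂ z := fun z hz =>
    dψ.d₂_eq hα (c1.ge hz)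
  have e3 : ∀ z ∈ closedBand p₀ (fun _ => 0), d₁ (strip p₀) h z = h₁ z := fun z hz =>
    dh.d₁_eq hα (c2.ge hz)
  have e4 : ∀ z ∈ closedBand p₀ (fun _ => 0), d₂ (strip p₀) h z = h₂ z := fun z hz =>
    dh.d₂_eq hα (c2.ge hz)
  have hp₀ : p₀ < 0 := P.isBand_cod.lt 0
  have hηpos := P.isBand_dom.lt
  have t1 : ∀ x, (x, η x) ∈ closedBand 0 η := fun x => ⟨(hηpos x).le, le_rfl⟩
  have b1 : ∀ x, (x, (0 : ℝ)) ∈ closedBand 0 η := fun x => ⟨le_rfl, (hηpos x).le⟩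
  have t2 : ∀ x, (x, (0 : ℝ)) ∈ closedBand p₀ (fun _ => 0) := fun x => ⟨hp₀.le, le_rfl⟩
  have b2 : ∀ x, (x, p₀) ∈ closedBand p₀ (fun _ => 0) := fun x => ⟨le_rfl, hp₀.le⟩
  have hH0 : ∀ x, H (x, 0) = η x := fun x => by
    have := P.left_inv (x, η x)
    simpa only [htop] using this
  have hHb : ∀ x, H (x, p₀) = 0 := fun x => by
    have := P.left_inv (x, 0)
    simpa only [hbot] using this
  have hbern : ∀ x, (1 + h₁ (x, 0) ^ 2) / (2 * h₂ (x, 0) ^ 2) + g * H (x, 0) - Q / 2 =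
      1 / 2 * (f₁ (x, η x) ^ 2 + f₂ (x, η x) ^ 2 + 2 * g * η x - Q) := fun x => by
    have i1 := P.inv₁ (x, η x)
    have i2 := P.inv₂ (x, η x)
    simp only [htop] at i1 i2
    have := (P.pos (x, η x)).ne'
    rw [i1, i2, hH0]
    field_simp
    ring
  have w1 : (WeakDivEq (fluidDomain η)
      (fun z => d₁ (fluidDomain η) ψ z * d₂ (fluidDomain η) ψ z)
      (fun z => -(1 / 2) * (d₁ (fluidDomain η) ψ z ^ 2 - d₂ (fluidDomain η) ψ z ^ 2) - Γ (-ψ z))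
      fun _ => 0) ↔ WeakDivEq (band 0 η) (fun z => f₁ z * f₂ z)
      (fun z => -(1 / 2) * (f₁ z ^ 2 - f₂ z ^ 2) - Γ (F z)) fun _ => 0 := by
    have ha : ∀ z ∈ band 0 η, d₁ (fluidDomain η) ψ z * d₂ (fluidDomain η) ψ z = f₁ z * f₂ z :=
      fun z hz => by
        rw [e1 z (band_subset_closedBand hz), e2 z (band_subset_closedBand hz)]; ring
    have hb : ∀ z ∈ band 0 η, -(1 / 2) * (d₁ (fluidDomain η) ψ z ^ 2 -
        d₂ (fluidDomain η) ψ z ^ 2) - Γ (-ψ z) = -(1 / 2) * (f₁ z ^ 2 - f₂ z ^ 2) - Γ (F z) :=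
      fun z hz => by
        rw [e1 z (band_subset_closedBand hz), e2 z (band_subset_closedBand hz),
          hψ z (band_subset_closedBand hz)]; ring
    exact ⟨fun h => h.congr P.isBand_dom.isOpen.measurableSet ha hb,
      fun h => h.congr P.isBand_dom.isOpen.measurableSet (fun z hz => (ha z hz).symm)
        fun z hz => (hb z hz).symm⟩
  have w2 : (WeakDivEq (strip p₀) (fun z => d₁ (strip p₀) h z / d₂ (strip p₀) h z)
      (fun z => -((1 + d₁ (strip p₀) h z ^ 2) / (2 * d₂ (strip p₀) h z ^ 2)) + Γ z.2)
      fun _ => 0) ↔ WeakDivEq (band p₀ fun _ => 0) (fun z => h₁ z / h₂ z)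
      (fun z => -((1 + h₁ z ^ 2) / (2 * h₂ z ^ 2)) + Γ z.2) fun _ => 0 := by
    have ha : ∀ z ∈ band p₀ (fun _ => 0), d₁ (strip p₀) h z / d₂ (strip p₀) h z = h₁ z / h₂ z :=
      fun z hz => by
        rw [e3 z (band_subset_closedBand hz), e4 z (band_subset_closedBand hz)]
    have hb : ∀ z ∈ band p₀ (fun _ => 0), -((1 + d₁ (strip p₀) h z ^ 2) /
        (2 * d₂ (strip p₀) h z ^ 2)) + Γ z.2 = -((1 + h₁ z ^ 2) / (2 * h₂ z ^ 2)) + Γ z.2 :=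
      fun z hz => by
        rw [e3 z (band_subset_closedBand hz), e4 z (band_subset_closedBand hz)]
    exact ⟨fun h => h.congr P.isBand_cod.isOpen.measurableSet ha hb,
      fun h => h.congr P.isBand_cod.isOpen.measurableSet (fun z hz => (ha z hz).symm)
        fun z hz => (hb z hz).symm⟩
  obtain ⟨C, hC, hfC, -⟩ := P.data.holder₂
  -- An upper bound for `f₂` is a lower bound for `h₂ = 1 / f₂`.
  have hm₂ : ∀ z, (C + 1)⁻¹ ≤ h₂ z := fun z => by
    rw [(P.inv_eq z).2, one_div]
    exact inv_anti₀ (P.pos _) (by linarith [le_abs_self (f₂ (z.1, H z)), hfC (z.1, H z)])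
  constructor
  · intro S
    refine ⟨hp₀, S.Γ_reg, dh.c1HolderPer P.isBand_cod, w2.2 ?_, fun q => ?_, fun q => ?_, ?_⟩
    · exact (P.weakC1_stream_to_height hα
        (P.stream_weakC1 hα S.Γ_reg (w1.1 S.interior))).weakDivEq
    · rw [← hh _ (b2 q), hHb]
    · rw [e3 _ (t2 q), e4 _ (t2 q), ← hh _ (t2 q), hbern]
      have := S.bernoulli q
      rw [e1 _ (t1 q), e2 _ (t1 q)] at this
      rw [← this]; ring
    · rw [c2]
      intro z hz
      rw [e4 z hz]
      exact P.symm.pos z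
  · intro S
    refine ⟨hp₀, S.Γ_reg, hη, hηpos, dψ.c1HolderPer P.isBand_dom, w1.2 ?_, fun x => ?_, fun x => ?_,
      fun x => ?_, ?_⟩
    · exact (P.weakC1_height_to_stream hα
        (P.height_weakC1 hα S.Γ_reg (by positivity) hm₂ (w2.1 S.interior))).weakDivEq
    · rw [← hbot x, hψ _ (b1 x), neg_neg]
    · have := hψ _ (t1 x)
      rw [htop] at this
      linarith
    · have := S.bernoulli x
      rw [e3 _ (t2 x), e4 _ (t2 x), ← hh _ (t2 x), hbern] at this
      rw [e1 _ (t1 x), e2 _ (t1 x)]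
      linarith
    · rw [c1]
      intro z hz
      rw [e2 z hz]
      exact neg_lt_zero.2 (P.pos z)

lemma C1Data.exists_pos_le_retract {l : ℝ} (hα : 0 < α) {f : ℝ × ℝ → ℝ} (hB : IsBand L l η)
    (hf : C1Data α L l η f f₁ f₂) (hpos : ∀ z ∈ closedBand l η, 0 < f₂ z) :
    ∃ m, 0 < m ∧ ∀ z, m ≤ f₂ (retract l η z) := by
  obtain ⟨m, hm, h⟩ := hB.exists_pos_le (hf.holder₂.continuous (by exact_mod_cast hα)).continuousOn
    (fun z _ => hf.periodic₂ z) hpos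
  exact ⟨m, hm, fun z => h _ (hB.retract_mem z)⟩

lemma retract_retract {l : ℝ} (hB : IsBand L l η) (z : ℝ × ℝ) :
    retract l η (retract l η z) = retract l η z := retract_eq_self (hB.retract_mem z)

/-- The derivatives of a stream function, extended to the plane, and the associated change of
variables. -/
lemma IsStreamSolution.exists_bandPair (hα : 0 < α) (hL : 0 < L)
    (S : IsStreamSolution α L g p₀ Q Γ η ψ) :
    ∃ F H f₁ f₂ h₁ h₂ m, (∀ z ∈ closedBand 0 η, F z = -ψ z) ∧ 0 < m ∧ (∀ z, m ≤ f₂ z) ∧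
      BandPair α L 0 p₀ η (fun _ => 0) F H f₁ f₂ h₁ h₂ := by
  have hB := S.η_reg.isBand hα hL S.η_pos
  have hd := (C1HolderPer.c1Data hα hB S.ψ_reg).neg
  have c1 : closure (fluidDomain η) = closedBand 0 η := hB.closure_band
  obtain ⟨m, hm, hm₂⟩ := hd.exists_pos_le_retract hα hB fun z hz => by
    have := S.no_stagnation z (c1.ge hz)
    rw [retract_eq_self hz]
    exact neg_pos.2 this
  simp only [retract_retract hB] at hm₂
  obtain ⟨F, H, h₁, h₂, hF, P⟩ := WaterWaves.exists_bandPair (by exact_mod_cast hα) hB hd hm hm₂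
    (l' := p₀) (η₂ := fun _ => 0) (fun x => by rw [S.bottom, neg_neg])
    (fun x => by rw [S.top, neg_zero])
  exact ⟨F, H, _, _, h₁, h₂, m, hF, hm, hm₂, P⟩

theorem IsStreamSolution.exists_height (hα : 0 < α) (hL : 0 < L)
    (S : IsStreamSolution α L g p₀ Q Γ η ψ) :
    ∃ h : ℝ × ℝ → ℝ, IsHeightSolution α L g p₀ Q Γ h ∧ StreamHeightCorr p₀ η ψ h ∧
      ∀ q, h (q, 0) = η q := by
  obtain ⟨F, H, f₁, f₂, h₁, h₂, m, hF, -, -, P⟩ := S.exists_bandPair hα hL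
  have htop : ∀ x, F (x, η x) = 0 := fun x => by
    rw [hF _ ⟨(S.η_pos x).le, le_rfl⟩, S.top, neg_zero]
  have hbot : ∀ x, F (x, 0) = p₀ := fun x => by
    rw [hF _ ⟨le_rfl, (S.η_pos x).le⟩, S.bottom, neg_neg]
  refine ⟨H, (P.isStreamSolution_iff hα hF (fun _ _ => rfl) hbot htop S.η_reg).1 S,
    P.streamHeightCorr hF fun _ _ => rfl, fun q => ?_⟩
  have := P.left_inv (q, η q)
  simpa only [htop] using this

/-- The change of variables is now built from the strip, with `h` in the role of the increasing
function and `h (·, 0)` as upper boundary of the image, and is then read backwards. The regularity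
of the new free surface comes from differentiating `h` along the top of the strip. -/
theorem IsHeightSolution.exists_stream (hα : 0 < α) (hL : 0 < L)
    (S : IsHeightSolution α L g p₀ Q Γ h) :
    ∃ (η : ℝ → ℝ) (ψ : ℝ × ℝ → ℝ), IsStreamSolution α L g p₀ Q Γ η ψ ∧
      StreamHeightCorr p₀ η ψ h ∧ ∀ q, η q = h (q, 0) := by
  have hB := isBand_strip hL S.p₀_neg
  have hd := C1HolderPer.c1Data hα hB S.h_reg
  have c1 : closure (strip p₀) = closedBand p₀ (fun _ => 0) := hB.closure_band
  obtain ⟨m, hm, hm₂⟩ := hd.exists_pos_le_retract hα hB fun z hz => by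
    have := S.no_stagnation z (c1.ge hz)
    rwa [retract_eq_self hz]
  simp only [retract_retract hB] at hm₂
  obtain ⟨H, F, f₁, f₂, hH, P⟩ := exists_bandPair (by exact_mod_cast hα) hB hd hm hm₂
    (l' := 0) (η₂ := fun q => h (q, 0)) S.bottom (fun x => rfl)
  have hder : ∀ q, HasDerivAt (fun q => h (q, 0))
      (d₁ (band p₀ fun _ => 0) h (retract p₀ (fun _ => 0) (q, 0))) q := fun q => by
    have := hd.hasDerivAt_curve (by exact_mod_cast hα) hB (fun x => hasDerivAt_const x (0 : ℝ))
      (t := 1) ⟨zero_le_one, le_rfl⟩ q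
    simpa using this
  have hη : C1HolderPerLine α L fun q => h (q, 0) := by
    refine ⟨fun q => (hder q).differentiableAt, ?_, fun q => ?_⟩
    · have : BddHolder (α : ℝ) (deriv fun q => h (q, 0)) := by
        have e : (deriv fun q => h (q, 0)) =
            fun q => d₁ (band p₀ fun _ => 0) h (retract p₀ (fun _ => 0) (q, 0)) :=
          funext fun q => (hder q).deriv
        rw [e]
        refine hd.holder₁.comp_lipschitz α.2 (φ := fun q : ℝ => ((q, 0) : ℝ × ℝ)) (K := 1)
          fun q q' => ?_
        simp [Prod.dist_eq]
      exact this.holderOn univ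
    · exact hd.periodic (q, 0) ⟨S.p₀_neg.le, le_rfl⟩
  have hbot : ∀ x, F (x, 0) = p₀ := fun x => by
    have := P.left_inv (x, p₀)
    rwa [hH _ ⟨le_rfl, S.p₀_neg.le⟩, S.bottom] at this
  have htop : ∀ x, F (x, h (x, 0)) = 0 := fun x => by
    have := P.left_inv (x, 0)
    rwa [hH _ ⟨S.p₀_neg.le, le_rfl⟩] at this
  refine ⟨fun q => h (q, 0), fun z => -F z,
    (P.symm.isStreamSolution_iff hα (fun _ _ => (neg_neg _).symm) hH hbot htop hη).2 S,
    P.symm.streamHeightCorr (fun _ _ => (neg_neg _).symm) hH, fun _ => rfl⟩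

end Equivalence

/-! ### Linear operations on distributional equations -/

lemma WeakDivEq.const_mul {D : Set (ℝ × ℝ)} {a b : ℝ × ℝ → ℝ} {s : ℝ}
    (h : WeakDivEq D a b fun _ => s) (k : ℝ) :
    WeakDivEq D (fun z => k * a z) (fun z => k * b z) (fun _ => k * s) := fun φ hφ => by
  have := congrArg (k * ·) (h φ hφ)
  simp only [mul_neg, ← integral_const_mul] at this
  simpa only [mul_add, mul_assoc] using this

lemma IsTestFunction.integrable_mul {D : Set (ℝ × ℝ)} {φ : ℝ × ℝ → ℝ} (hφ : IsTestFunction D φ)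
    {a b : ℝ × ℝ → ℝ} (ha : Continuous a) (hb : Continuous b) :
    Integrable (fun z => a z * partial₁ φ z + b z * partial₂ φ z) := by
  have h1 : ContDiff ℝ 1 φ := hφ.smooth.of_le (by exact_mod_cast le_top)
  have s1 : HasCompactSupport (partial₁ φ) := hφ.hasCompactSupport.fderiv_apply ℝ _
  have s2 : HasCompactSupport (partial₂ φ) := hφ.hasCompactSupport.fderiv_apply ℝ _
  exact ((ha.mul (partial₁_continuous h1)).integrable_of_hasCompactSupport s1.mul_left).add
    ((hb.mul (partial₂_continuous h1)).integrable_of_hasCompactSupport s2.mul_left)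

lemma WeakDivEq.add {D : Set (ℝ × ℝ)} {a b a' b' : ℝ × ℝ → ℝ} {s s' : ℝ}
    (h : WeakDivEq D a b fun _ => s) (h' : WeakDivEq D a' b' fun _ => s')
    (ha : Continuous a) (hb : Continuous b) (ha' : Continuous a') (hb' : Continuous b') :
    WeakDivEq D (fun z => a z + a' z) (fun z => b z + b' z) (fun _ => s + s') := fun φ hφ => by
  have hi : Integrable φ :=
    hφ.smooth.continuous.integrable_of_hasCompactSupport hφ.hasCompactSupport
  have e := integral_add (hφ.integrable_mul ha hb).integrableOn
    (hφ.integrable_mul ha' hb').integrableOn (μ := volume.restrict D)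
  rw [h φ hφ, h' φ hφ, ← neg_add, ← integral_add (hi.const_mul s).integrableOn
    (hi.const_mul s').integrableOn] at e
  simp only [add_mul] at e ⊢
  rw [← e]
  exact integral_congr_ae (.of_forall fun z => by simp only; ring)

/-- This moves gravity and additive constants between the pressure and the right-hand side: a term
in `y` is invisible in the first component and contributes its slope in the second. -/
lemma weakDivEq_affine (D : Set (ℝ × ℝ)) (κ₀ κ l₀ l : ℝ) :
    WeakDivEq D (fun z => κ₀ + κ * z.2) (fun z => l₀ + l * z.2) (fun _ => l) := fun φ hφ => by
  have h1 : ContDiff ℝ 1 φ := hφ.smooth.of_le (by exact_mod_cast le_top)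
  have s1 : HasCompactSupport (partial₁ φ) := hφ.hasCompactSupport.fderiv_apply ℝ _
  have s2 : HasCompactSupport (partial₂ φ) := hφ.hasCompactSupport.fderiv_apply ℝ _
  have hc : ∀ k₀ k : ℝ, ContDiff ℝ 1 fun z : ℝ × ℝ => k₀ + k * z.2 := fun k₀ k => by fun_prop
  have hd : ∀ k₀ k : ℝ, ∀ z, fderiv ℝ (fun z : ℝ × ℝ => k₀ + k * z.2) z =
      k • ContinuousLinearMap.snd ℝ ℝ ℝ := fun k₀ k z =>
    (((hasFDerivAt_snd (𝕜 := ℝ) (p := z)).const_mul k).const_add k₀).fderiv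
  have key := integral_div_mul_test (hc κ₀ κ) (hc l₀ l) h1 hφ.hasCompactSupport
  have p1 : ∀ z, partial₁ (fun z : ℝ × ℝ => κ₀ + κ * z.2) z = 0 := fun z => by
    simp [partial₁, hd]
  have p2 : ∀ z, partial₂ (fun z : ℝ × ℝ => l₀ + l * z.2) z = l := fun z => by
    simp [partial₂, hd]
  simp only [p1, p2, zero_add] at key
  rw [setIntegral_test _ _ hφ.tsupport_subset, setIntegral_eq_integral_of_forall_compl_eq_zero
    (fun z hz => by
      rw [image_eq_zero_of_notMem_tsupport fun h => hz (hφ.tsupport_subset h), mul_zero]), key,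
    neg_neg]
  exact integral_add (((hc κ₀ κ).continuous.mul
      (partial₁_continuous h1)).integrable_of_hasCompactSupport s1.mul_left)
    (((hc l₀ l).continuous.mul
      (partial₂_continuous h1)).integrable_of_hasCompactSupport s2.mul_left)

/-- Mollification preserves independence of the horizontal variable, so the mollified field is
exactly divergence free although `γ` need not be differentiable. -/
lemma weakC1_of_vertical {α : ℝ} (hα : 0 < α) (D : Set (ℝ × ℝ)) {γ : ℝ → ℝ}
    (hγ : BddHolder α γ) : WeakC1 D (fun z => γ z.2) (fun _ => 0) := by
  have hγ' : BddHolder α fun z : ℝ × ℝ => γ z.2 :=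
    hγ.comp_lipschitz hα.le (φ := Prod.snd) (K := 1) fun z w => by
      rw [one_mul]; exact le_max_right _ _
  refine weakC1_of_tendsto hα hγ' (BddHolder.const 0) fun φ _ _ _ => ?_
  refine tendsto_const_nhds.congr' ?_
  filter_upwards [self_mem_nhdsWithin] with ε hε
  have e1 : ∀ z, partial₁ (moll ε fun z : ℝ × ℝ => γ z.2) z = 0 := fun z => by
    have hd : DifferentiableAt ℝ (moll ε fun z : ℝ × ℝ => γ z.2) z :=
      (moll_contDiff hε (hγ'.continuous hα) (n := 1)).differentiable (by norm_num) z
    rw [partial₁, ← hd.lineDeriv_eq_fderiv, lineDeriv]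
    simp [moll]
  have e2 : ∀ z, partial₂ (moll ε fun _ : ℝ × ℝ => (0 : ℝ)) z = 0 := fun z => by
    have : moll ε (fun _ : ℝ × ℝ => (0 : ℝ)) = fun _ => 0 := by ext; simp [moll]
    rw [partial₂, this]
    simp
  simp [e1, e2]

/-! ### Fluxes through rectangles -/

lemma tendsto_intervalIntegral_moll {α : ℝ} (hα : 0 < α) {a : ℝ × ℝ → ℝ} (ha : BddHolder α a)
    {γ : ℝ → ℝ × ℝ} (hγ : Continuous γ) (s t : ℝ) :
    Filter.Tendsto (fun ε => ∫ τ in s..t, moll ε a (γ τ)) (𝓝[>] 0) (𝓝 (∫ τ in s..t, a (γ τ))) := by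
  have hc := ha.continuous hα
  obtain ⟨C, hC, -, hC₂⟩ := ha
  rw [tendsto_iff_dist_tendsto_zero]
  have hlim : Filter.Tendsto (fun ε : ℝ => C * ε ^ α * |t - s|) (𝓝[>] 0) (𝓝 0) := by
    have : Filter.Tendsto (fun ε : ℝ => C * ε ^ α * |t - s|) (𝓝 0) (𝓝 (C * 0 ^ α * |t - s|)) :=
      (((Real.continuous_rpow_const hα.le).tendsto 0).const_mul C).mul_const _
    rw [Real.zero_rpow hα.ne', mul_zero, zero_mul] at this
    exact this.mono_left nhdsWithin_le_nhds
  refine squeeze_zero' (.of_forall fun _ => dist_nonneg) ?_ hlim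
  filter_upwards [self_mem_nhdsWithin] with ε hε
  have i1 : Continuous fun τ => moll ε a (γ τ) :=
    (moll_contDiff hε hc (n := 0)).continuous.comp hγ
  have i2 : Continuous fun τ => a (γ τ) := hc.comp hγ
  rw [dist_eq_norm, ← intervalIntegral.integral_sub (i1.intervalIntegrable _ _)
    (i2.intervalIntegrable _ _)]
  exact intervalIntegral.norm_integral_le_of_norm_le_const fun τ _ =>
    abs_moll_sub_le hα hc hC hC₂ hε (γ τ)

/-- A weakly divergence free field has no flux out of a rectangle. -/
lemma WeakDivEq.flux_eq_zero {α : ℝ} (hα : 0 < α) {D : Set (ℝ × ℝ)} (hD : IsOpen D)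
    {a b : ℝ × ℝ → ℝ} (ha : BddHolder α a) (hb : BddHolder α b)
    (h : WeakDivEq D a b fun _ => 0) {x₁ x₂ y₁ y₂ : ℝ}
    (hsub : uIcc x₁ x₂ ×ˢ uIcc y₁ y₂ ⊆ D) :
    (((∫ x in x₁..x₂, b (x, y₂)) - ∫ x in x₁..x₂, b (x, y₁)) + ∫ y in y₁..y₂, a (x₂, y)) -
      ∫ y in y₁..y₂, a (x₁, y) = 0 := by
  have ca := ha.continuous hα
  have cb := hb.continuous hα
  have hlim := (((tendsto_intervalIntegral_moll hα hb (γ := fun x => (x, y₂)) (by fun_prop)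
    x₁ x₂).sub (tendsto_intervalIntegral_moll hα hb (γ := fun x => (x, y₁)) (by fun_prop)
    x₁ x₂)).add (tendsto_intervalIntegral_moll hα ha (γ := fun y => (x₂, y)) (by fun_prop)
    y₁ y₂)).sub (tendsto_intervalIntegral_moll hα ha (γ := fun y => (x₁, y)) (by fun_prop) y₁ y₂)
  refine tendsto_nhds_unique hlim (tendsto_const_nhds.congr' ?_)
  have hK : IsCompact (uIcc x₁ x₂ ×ˢ uIcc y₁ y₂) := isCompact_uIcc.prod isCompact_uIcc
  -- For small ε the mollified field is smooth and divergence free on the rectangle, so the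
  -- classical divergence theorem applies.
  filter_upwards [h.eventually_div_moll hD ca cb hK hsub, self_mem_nhdsWithin] with ε hε hε₀
  have da := moll_contDiff hε₀ ca (n := 1)
  have db := moll_contDiff hε₀ cb (n := 1)
  rw [← integral2_divergence_prod_of_hasFDerivAt (moll ε a) (moll ε b) (fderiv ℝ (moll ε a))
    (fderiv ℝ (moll ε b)) x₁ y₁ x₂ y₂ da.continuous.continuousOn db.continuous.continuousOn
    (fun z _ => (da.differentiable (by norm_num) z).hasFDerivAt)
    (fun z _ => (db.differentiable (by norm_num) z).hasFDerivAt)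
    (((partial₁_continuous da).add (partial₂_continuous db)).continuousOn.integrableOn_compact hK)]
  symm
  refine intervalIntegral.integral_zero_ae (.of_forall fun x hx => ?_)
  refine intervalIntegral.integral_zero_ae (.of_forall fun y hy => ?_)
  exact hε (x, y) ⟨uIoc_subset_uIcc hx, uIoc_subset_uIcc hy⟩

lemma eq_zero_of_intervalIntegral_eq_zero {f : ℝ → ℝ} (hf : Continuous f) {s t : ℝ}
    (h : ∀ y ∈ Ioo s t, ∀ y' ∈ Ioo s t, ∫ τ in y..y', f τ = 0) {y : ℝ} (hy : y ∈ Ioo s t) :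
    f y = 0 := by
  have h1 : HasDerivAt (fun y' => ∫ τ in y..y', f τ) (f y) y :=
    intervalIntegral.integral_hasDerivAt_right (hf.intervalIntegrable _ _)
      hf.stronglyMeasurable.stronglyMeasurableAtFilter hf.continuousAt
  refine h1.unique ((hasDerivAt_const y (0 : ℝ)).congr_of_eventuallyEq ?_)
  filter_upwards [Ioo_mem_nhds hy.1 hy.2] with y' hy' using h y hy y' hy'

/-- A function whose horizontal derivative vanishes weakly in a strip depends on the vertical
variable only. -/
lemma WeakDivEq.eq_of_horizontal {α : ℝ} (hα : 0 < α) {p₀ : ℝ} (hp₀ : p₀ < 0) {a : ℝ × ℝ → ℝ}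
    (ha : BddHolder α a) (h : WeakDivEq (band p₀ fun _ => 0) a (fun _ => 0) fun _ => 0) (q q' : ℝ)
    {p : ℝ} (hp : p ∈ Icc p₀ 0) : a (q, p) = a (q', p) := by
  have ca := ha.continuous hα
  have c : ∀ q, Continuous fun p => a (q, p) := fun q => by fun_prop
  have hD : IsOpen (band p₀ fun _ => 0) :=
    (isOpen_lt continuous_const continuous_snd).inter (isOpen_lt continuous_snd continuous_const)
  have key : ∀ p ∈ Ioo p₀ 0, a (q', p) - a (q, p) = 0 := fun p hp => by
    refine eq_zero_of_intervalIntegral_eq_zero (f := fun p => a (q', p) - a (q, p))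
      ((c q').sub (c q)) (fun y hy y' hy' => ?_) hp
    have hs : uIcc y y' ⊆ Ioo p₀ 0 := ordConnected_Ioo.uIcc_subset hy hy'
    have := h.flux_eq_zero hα hD ha (BddHolder.const 0) (x₁ := q) (x₂ := q') (y₁ := y) (y₂ := y')
      fun z hz => hs hz.2
    rw [intervalIntegral.integral_sub ((c q').intervalIntegrable _ _)
      ((c q).intervalIntegrable _ _)]
    simpa using this
  have hcl : IsClosed {p | a (q, p) = a (q', p)} := isClosed_eq (c q) (c q')
  have := closure_minimal (s := Ioo p₀ 0) (fun p hp => (sub_eq_zero.1 (key p hp)).symm) hcl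
  rw [closure_Ioo hp₀.ne] at this
  exact this hp

/-! ### Potentials -/

lemma IsBand.bddHolder_retract_snd {α L : ℝ} (hα₀ : 0 ≤ α) (hα₁ : α ≤ 1) {η : ℝ → ℝ}
    (hB : IsBand L 0 η) : BddHolder α fun z => (retract 0 η z).2 := by
  obtain ⟨M, -, hM⟩ := hB.exists_height
  obtain ⟨K, -, hK⟩ := hB.exists_dist_retract_le
  refine BddHolder.of_lipschitz hα₀ hα₁ (C := M) (K := K) (fun z => ?_)
    fun z w => (le_max_right _ _).trans (hK z w)
  obtain ⟨h1, h2⟩ := hB.retract_mem z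
  rw [abs_of_nonneg h1]
  refine h2.trans ((le_abs_self _).trans ?_)
  simpa using hM (retract 0 η z).1

lemma continuous_vertical_integral {a : ℝ × ℝ → ℝ} (ha : Continuous a) (l : ℝ) :
    Continuous fun z : ℝ × ℝ => ∫ s in l..z.2, a (z.1, s) :=
  intervalIntegral.continuous_parametric_intervalIntegral_of_continuous
    (f := fun (z : ℝ × ℝ) s => a (z.1, s)) (by fun_prop) continuous_snd

/-- The bottom is not contained in the open band, so the flux balance is used on rectangles with
lower edge at height t > l. In the limit t → l the flux through the lower edge vanishes by the
bottom condition. -/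
lemma WeakDivEq.vertical_integral_sub {α : ℝ} (hα : 0 < α) {l : ℝ} {η : ℝ → ℝ}
    (hD : IsOpen (band l η)) {a b : ℝ × ℝ → ℝ} (ha : BddHolder α a) (hb : BddHolder α b)
    (hbot : ∀ x, b (x, l) = 0) (h : WeakDivEq (band l η) a b fun _ => 0) {x x' y : ℝ} (hy : l < y)
    (hx : ∀ ξ ∈ uIcc x x', y < η ξ) :
    (∫ s in l..y, a (x', s)) - ∫ s in l..y, a (x, s) = -∫ ξ in x..x', b (ξ, y) := by
  have ca := ha.continuous hα
  have cb := hb.continuous hα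
  set Φ : ℝ → ℝ := fun t => (((∫ ξ in x..x', b (ξ, y)) - ∫ ξ in x..x', b (ξ, t)) +
    ∫ s in t..y, a (x', s)) - ∫ s in t..y, a (x, s) with hΦ
  have hc : Continuous Φ := by
    have c1 : Continuous fun t => ∫ ξ in x..x', b (ξ, t) :=
      intervalIntegral.continuous_parametric_intervalIntegral_of_continuous'
        (f := fun (t : ℝ) ξ => b (ξ, t)) (by fun_prop) x x'
    have c2 : ∀ x, Continuous fun t => ∫ s in t..y, a (x, s) := fun x => by
      simp only [fun t => intervalIntegral.integral_symm (μ := volume) (f := fun s => a (x, s)) y t]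
      exact (intervalIntegral.continuous_parametric_intervalIntegral_of_continuous
        (f := fun (_ : ℝ) s => a (x, s)) (by fun_prop) continuous_id).neg
    exact ((continuous_const.sub c1).add (c2 x')).sub (c2 x)
  have hz : Ioc l y ⊆ {t | Φ t = 0} := fun t ht => by
    refine h.flux_eq_zero hα hD ha hb fun z hz => ?_
    have := hz.2
    rw [uIcc_of_le ht.2] at this
    exact ⟨ht.1.trans_le this.1, this.2.trans_lt (hx _ hz.1)⟩
  have h0 := closure_minimal hz (isClosed_eq hc continuous_const)
  rw [closure_Ioc hy.ne] at h0
  have h1 : Φ l = 0 := h0 ⟨le_rfl, hy.le⟩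
  simp only [hΦ, hbot, intervalIntegral.integral_zero, sub_zero] at h1
  linarith

/-- A weakly divergence free field which is tangential to the bottom has a stream function. -/
lemma WeakDivEq.c1Data_vertical_integral {α L l : ℝ} (hα : 0 < α) {η : ℝ → ℝ} (hB : IsBand L l η)
    {a b : ℝ × ℝ → ℝ} (ha : BddHolder α a) (hb : BddHolder α b)
    (hpa : ∀ z, a (z.1 + L, z.2) = a z) (hpb : ∀ z, b (z.1 + L, z.2) = b z)
    (hbot : ∀ x, b (x, l) = 0) (h : WeakDivEq (band l η) a b fun _ => 0) (k : ℝ) :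
    C1Data α L l η (fun z => k + ∫ s in l..z.2, a (z.1, s)) (fun z => -b z) a where
  continuousOn :=
    (continuous_const.add (continuous_vertical_integral (ha.continuous hα) l)).continuousOn
  periodic z _ := by
    have : ∀ s, a (z.1 + L, s) = a (z.1, s) := fun s => hpa (z.1, s)
    simp only [this]
  holder₁ := hb.neg
  holder₂ := ha
  periodic₁ z := by rw [hpb]
  periodic₂ := hpa
  hasFDerivAt z hz := by
    have ca := ha.continuous hα
    have cb := hb.continuous hα
    have d2 : ∀ w : ℝ × ℝ, HasDerivAt (fun y => k + ∫ s in l..y, a (w.1, s)) (a w) w.2 :=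
      fun w => by
        have c : Continuous fun s => a (w.1, s) := by fun_prop
        exact (intervalIntegral.integral_hasDerivAt_right (c.intervalIntegrable _ _)
          c.stronglyMeasurable.stronglyMeasurableAtFilter c.continuousAt).const_add k
    have d1 : ∀ w ∈ band l η, HasDerivAt (fun x => k + ∫ s in l..w.2, a (x, s)) (-b w) w.1 :=
      fun w hw => by
        have c : Continuous fun ξ => b (ξ, w.2) := by fun_prop
        have hd := ((intervalIntegral.integral_hasDerivAt_right (a := w.1) (b := w.1)
          (c.intervalIntegrable _ _) c.stronglyMeasurable.stronglyMeasurableAtFilter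
          c.continuousAt).neg.const_add (∫ s in l..w.2, a (w.1, s))).const_add k
        refine hd.congr_of_eventuallyEq ?_
        -- The flux balance requires the horizontal segment from `w` to stay below the graph, which
        -- holds for nearby endpoints.
        have ho : {ξ | w.2 < η ξ} ∈ 𝓝 w.1 :=
          (isOpen_lt continuous_const hB.continuous).mem_nhds hw.2
        obtain ⟨s, t, hst, hsub⟩ := mem_nhds_iff_exists_Ioo_subset.1 ho
        filter_upwards [Ioo_mem_nhds hst.1 hst.2] with x hx
        have := h.vertical_integral_sub hα hB.isOpen ha hb hbot (x := w.1) (x' := x) hw.1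
          fun ξ hξ => hsub (ordConnected_Ioo.uIcc_subset hst hx hξ)
        simp only [Pi.neg_apply]
        linarith
    -- Both partial derivatives exist near `z` and are continuous, which gives the total derivative.
    have key := hasStrictFDerivAt_uncurry_coprod (𝕜 := ℝ) (u := z)
      (f := fun x y => k + ∫ s in l..y, a (x, s))
      (f₁ := fun x y => ContinuousLinearMap.toSpanSingleton ℝ (-b (x, y)))
      (f₂ := fun x y => ContinuousLinearMap.toSpanSingleton ℝ (a (x, y)))
      (by filter_upwards [hB.isOpen.mem_nhds hz] with w hw using (d1 w hw).hasFDerivAt)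
      (.of_forall fun w => (d2 w).hasFDerivAt)
      (by
        refine Continuous.continuousAt (f := fun w : ℝ × ℝ =>
          ContinuousLinearMap.toSpanSingleton ℝ (-b w)) ?_
        exact (ContinuousLinearMap.toSpanSingletonCLE (𝕜 := ℝ) (E := ℝ)).continuous.comp cb.neg)
      (by
        refine Continuous.continuousAt (f := fun w : ℝ × ℝ =>
          ContinuousLinearMap.toSpanSingleton ℝ (a w)) ?_
        exact (ContinuousLinearMap.toSpanSingletonCLE (𝕜 := ℝ) (E := ℝ)).continuous.comp ca)
    refine key.hasFDerivAt.congr_fderiv ?_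
    ext <;> simp [Function.HasUncurry.uncurry]

lemma C1Data.eq_zero_of_bottom {α L l : ℝ} (hα : 0 < α) {η η' : ℝ → ℝ} {f f₁ f₂ : ℝ × ℝ → ℝ}
    (hB : IsBand L l η) (hf : C1Data α L l η f f₁ f₂) (hη : ∀ x, HasDerivAt η (η' x) x) {k : ℝ}
    (h : ∀ x, f (x, l) = k) (x : ℝ) : f₁ (x, l) = 0 := by
  have := hf.hasDerivAt_curve hα hB hη (t := 0) ⟨le_rfl, zero_le_one⟩ x
  simp only [zero_mul, add_zero, h, mul_zero] at this
  exact this.unique (hasDerivAt_const x k)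

lemma C1Data.hasDerivAt_top {α L l : ℝ} (hα : 0 < α) {η η' : ℝ → ℝ} {f f₁ f₂ : ℝ × ℝ → ℝ}
    (hB : IsBand L l η) (hf : C1Data α L l η f f₁ f₂) (hη : ∀ x, HasDerivAt η (η' x) x) (x : ℝ) :
    HasDerivAt (fun x => f (x, η x)) (f₁ (x, η x) + f₂ (x, η x) * η' x) x := by
  have := hf.hasDerivAt_curve hα hB hη (t := 1) ⟨zero_le_one, le_rfl⟩ x
  simpa only [one_mul, add_sub_cancel] using this

/-! ### Velocity and stream function formulations -/

section Equivalence

variable {α : ℝ≥0} {L c g Patm p₀ Q : ℝ} {Γ η : ℝ → ℝ} {u v P ψ F H f₁ f₂ h₁ h₂ : ℝ × ℝ → ℝ}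

/-- Functions of the stream function are transported by the flow. -/
lemma BandPair.weakC1_comp {α : ℝ} (hα : 0 < α)
    (B : BandPair α L 0 p₀ η (fun _ => 0) F H f₁ f₂ h₁ h₂) {γ : ℝ → ℝ} (hγ : BddHolder α γ) :
    WeakC1 (band 0 η) (fun z => f₂ z * γ (F z)) (fun z => -(f₁ z * γ (F z))) := by
  refine B.symm.weakC1 hα (fun z _ => ?_) (fun z _ => ?_) (weakC1_of_vertical hα _ hγ)
  · have := (B.symm.pos z).ne'
    simp only [B.symm.inv₂, B.right_inv]
    field_simp
  · have := (B.symm.pos z).ne'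
    simp only [B.symm.inv₁, B.right_inv]
    field_simp
    ring

/-- With `P` defined by Bernoulli's law the stream function equation is the second momentum
equation. Mass conservation and the transport of Γ(-ψ) hold because functions of ψ are constant
along streamlines. The first momentum equation is the only one that needs the commutator argument.
-/
theorem IsStreamSolution.exists_velocity (hα : 1 / 3 < α) (hα₁ : α ≤ 1) (hL : 0 < L)
    (c Patm : ℝ) (S : IsStreamSolution α L g p₀ Q Γ η ψ) :
    ∃ u v P : ℝ × ℝ → ℝ, IsVelocitySolution α L c g Patm η u v P ∧
      VelocityStreamCorr c g Γ η u v P ψ := by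
  have hα₀ : 0 < α := (by positivity : (0 : ℝ≥0) < 1 / 3).trans hα
  have hαr : (0 : ℝ) < α := by exact_mod_cast hα₀
  have hα3 : (1 / 3 : ℝ) < α := by exact_mod_cast hα
  have hαr₁ : (α : ℝ) ≤ 1 := by exact_mod_cast hα₁
  obtain ⟨F, H, f₁, f₂, h₁, h₂, m, hF, hm, hm₂, B⟩ := S.exists_bandPair hα₀ hL
  have hB := B.isBand_dom
  have hD := hB.isOpen
  have c1 : closure (fluidDomain η) = closedBand 0 η := hB.closure_band
  have dψ : C1Data α L 0 η ψ (fun z => -f₁ z) (fun z => -f₂ z) :=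
    B.data.neg.congr hB fun z hz => by simp only [hF z hz, neg_neg]
  have e1 : ∀ z ∈ closedBand 0 η, d₁ (fluidDomain η) ψ z = -f₁ z := fun z hz =>
    dψ.d₁_eq hα₀ (c1.ge hz)
  have e2 : ∀ z ∈ closedBand 0 η, d₂ (fluidDomain η) ψ z = -f₂ z := fun z hz =>
    dψ.d₂_eq hα₀ (c1.ge hz)
  have mt : ∀ x, (x, η x) ∈ closedBand 0 η := fun x => ⟨(S.η_pos x).le, le_rfl⟩
  have mb : ∀ x, (x, (0 : ℝ)) ∈ closedBand 0 η := fun x => ⟨le_rfl, (S.η_pos x).le⟩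
  have hηd : ∀ x, HasDerivAt η (deriv η x) x := fun x => (S.η_reg.differentiable x).hasDerivAt
  have htop : ∀ x, F (x, η x) = 0 := fun x => by rw [hF _ (mt x), S.top, neg_zero]
  have hbot : ∀ x, F (x, 0) = p₀ := fun x => by rw [hF _ (mb x), S.bottom, neg_neg]
  set E : ℝ × ℝ → ℝ := fun z => clampFun p₀ Γ (F (retract 0 η z)) with hEdef
  have hE : BddHolder (α : ℝ) E := B.bddHolder_clampFun_comp hα₀ S.Γ_reg
  have hEF : ∀ z ∈ closedBand 0 η, E z = Γ (F z) := fun z hz => by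
    simp only [hEdef]
    rw [retract_eq_self hz, clampFun_eq Γ (B.mem_Icc hz)]
  have H₁ := B.data.holder₁
  have H₂ := B.data.holder₂
  have k₁ := H₁.continuous hαr
  have k₂ := H₂.continuous hαr
  have kE := hE.continuous hαr
  have hA : WeakDivEq (band 0 η) (fun z => -f₁ z * -f₂ z)
      (fun z => (-1 / 2) * (-f₁ z * -f₁ z) + (1 / 2) * (-f₂ z * -f₂ z) + (-1) * E z)
      fun _ => 0 := by
    refine WeakDivEq.congr hD.measurableSet S.interior (fun z hz => ?_) fun z hz => ?_
    · rw [e1 z (band_subset_closedBand hz), e2 z (band_subset_closedBand hz)]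
    · rw [e1 z (band_subset_closedBand hz), e2 z (band_subset_closedBand hz),
        hEF z (band_subset_closedBand hz), hF z (band_subset_closedBand hz)]
      ring
  have mass : WeakDivEq (band 0 η) (fun z => -f₂ z) (fun z => - -f₁ z) fun _ => 0 := by
    have := (B.weakC1_comp hαr (BddHolder.const 1)).neg
    simpa only [mul_one] using this.weakDivEq
  have hT : WeakDivEq (band 0 η) (fun z => -f₂ z * E z) (fun z => -(-f₁ z * E z)) fun _ => 0 := by
    refine (B.weakC1_comp hαr (bddHolder_clampFun hα₀ S.p₀_neg.le
      S.Γ_reg)).neg.weakDivEq.congr hD.measurableSet (fun z hz => ?_) fun z hz => ?_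
    · rw [hEF z (band_subset_closedBand hz), clampFun_eq Γ (B.mem_Icc (band_subset_closedBand hz))]
      ring
    · rw [hEF z (band_subset_closedBand hz), clampFun_eq Γ (B.mem_Icc (band_subset_closedBand hz))]
      ring
  have hM := (weakC1_momentum hα3 hαr₁ hD H₁.neg H₂.neg hE hm
    (fun z => neg_le_neg (hm₂ z)) mass hA hT).weakDivEq
  -- On the surface ½|∇ψ|² + gη = Q/2 and Γ(-ψ) = Γ(0), so this constant is forced by P = `Patm`.
  set K : ℝ := Patm + Q / 2 - Γ 0 with hK
  refine ⟨fun z => c - f₂ z, f₁, fun z => -(1 / 2) * (f₁ z ^ 2 + f₂ z ^ 2) -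
    g * (retract 0 η z).2 + E z + K, ⟨S.η_reg, S.η_pos, ⟨?_, ?_⟩, ⟨?_, ?_⟩, ⟨?_, ?_⟩, ?_, ?_, ?_,
      ?_, ?_, ?_, ?_⟩, ⟨?_, ?_, K, ?_⟩⟩
  · exact ((BddHolder.const c).sub H₂).holderOn _
  · intro z _
    simp only [B.data.periodic₂]
  · exact H₁.holderOn _
  · exact fun z _ => B.data.periodic₁ z
  · exact ((((BddHolder.const _).mul (H₁.sq.add H₂.sq)).sub ((BddHolder.const g).mul
      (hB.bddHolder_retract_snd hαr.le hαr₁))).add hE |>.add (BddHolder.const K)).holderOn _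
  · intro z _
    simp only [B.data.periodic₁, B.data.periodic₂, hEdef, hB.retract_add]
    rw [B.data.periodic _ (hB.retract_mem z)]
  · refine mass.congr hD.measurableSet (fun z _ => ?_) fun z _ => ?_ <;> simp
  -- Since (u - c)² + P = ½(f₂² - f₁²) + E + K - gy, the field differs from the negative of `hM`
  -- only by an affine field without divergence. The second momentum equation is treated alike, with
  -- -gy in the second component producing the source -g.
  · have h0 := (hM.const_mul (-1)).add (weakDivEq_affine (band 0 η) K (-g) 0 0) (by fun_prop)
      (by fun_prop) (by fun_prop) (by fun_prop)
    rw [show (-1 : ℝ) * 0 + 0 = 0 by ring] at h0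
    refine h0.congr hD.measurableSet (fun z hz => ?_) fun z hz => ?_
    · rw [retract_eq_self (band_subset_closedBand hz)]
      ring
    · ring
  · have h0 := (hA.const_mul (-1)).add (weakDivEq_affine (band 0 η) 0 0 K (-g)) (by fun_prop)
      (by fun_prop) (by fun_prop) (by fun_prop)
    rw [show (-1 : ℝ) * 0 + -g = -g by ring] at h0
    refine h0.congr hD.measurableSet (fun z hz => ?_) fun z hz => ?_
    · ring
    · rw [retract_eq_self (band_subset_closedBand hz)]
      ring
  · exact B.data.eq_zero_of_bottom hαr hB hηd hbot
  · intro x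
    have := B.data.hasDerivAt_top hαr hB hηd x
    simp only [htop] at this
    have := this.unique (hasDerivAt_const x 0)
    linarith
  · intro x
    have hb := S.bernoulli x
    rw [e1 _ (mt x), e2 _ (mt x)] at hb
    simp only [retract_eq_self (mt x), hEF _ (mt x), htop, hK]
    linarith
  · intro z _
    linarith [B.pos z]
  · intro z hz
    rw [e2 z (c1.le hz)]
    ring
  · exact fun z hz => e1 z (c1.le hz)
  · intro z hz
    have hz := c1.le hz
    rw [e1 z hz, e2 z hz, retract_eq_self hz, hEF z hz, hF z hz]
    ring

/-- The momentum equations, written in terms of the total head `E`, force `E` to be transported. In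
the variables (q, p) its horizontal derivative then vanishes, so `E` is a function of p = -ψ, and
this function is Γ. -/
theorem IsVelocitySolution.exists_stream (hα : 1 / 3 < α) (hα₁ : α ≤ 1) (hL : 0 < L)
    (S : IsVelocitySolution α L c g Patm η u v P) :
    ∃ (p₀ Q : ℝ) (Γ : ℝ → ℝ) (ψ : ℝ × ℝ → ℝ), IsStreamSolution α L g p₀ Q Γ η ψ ∧
      VelocityStreamCorr c g Γ η u v P ψ := by
  have hα₀ : 0 < α := (by positivity : (0 : ℝ≥0) < 1 / 3).trans hα
  have hαr : (0 : ℝ) < α := by exact_mod_cast hα₀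
  have hα3 : (1 / 3 : ℝ) < α := by exact_mod_cast hα
  have hαr₁ : (α : ℝ) ≤ 1 := by exact_mod_cast hα₁
  have hB := S.η_reg.isBand hα₀ hL S.η_pos
  have hD := hB.isOpen
  have c1 : closure (fluidDomain η) = closedBand 0 η := hB.closure_band
  have mt : ∀ x, (x, η x) ∈ closedBand 0 η := fun x => ⟨(S.η_pos x).le, le_rfl⟩
  have mb : ∀ x, (x, (0 : ℝ)) ∈ closedBand 0 η := fun x => ⟨le_rfl, (S.η_pos x).le⟩
  have hηd : ∀ x, HasDerivAt η (deriv η x) x := fun x => (S.η_reg.differentiable x).hasDerivAt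
  set a : ℝ × ℝ → ℝ := fun z => u (retract 0 η z) - c with ha
  set b : ℝ × ℝ → ℝ := fun z => v (retract 0 η z) with hb
  set p : ℝ × ℝ → ℝ := fun z => P (retract 0 η z) with hp
  have Ha : BddHolder (α : ℝ) a := (C0HolderPer.bddHolder hα₀ hB S.u_reg).sub (BddHolder.const c)
  have Hb : BddHolder (α : ℝ) b := C0HolderPer.bddHolder hα₀ hB S.v_reg
  have Hp : BddHolder (α : ℝ) p := C0HolderPer.bddHolder hα₀ hB S.P_reg
  have ka := Ha.continuous hαr
  have kb := Hb.continuous hαr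
  have kp := Hp.continuous hαr
  have ea : ∀ z ∈ closedBand 0 η, a z = u z - c := fun z hz => by
    simp only [ha]; rw [retract_eq_self hz]
  have eb : ∀ z ∈ closedBand 0 η, b z = v z := fun z hz => by
    simp only [hb]; rw [retract_eq_self hz]
  have ep : ∀ z ∈ closedBand 0 η, p z = P z := fun z hz => by
    simp only [hp]; rw [retract_eq_self hz]
  have pa : ∀ z, a (z.1 + L, z.2) = a z := fun z => by
    simp only [ha, hB.retract_add]
    rw [S.u_reg.periodic _ (c1.ge (hB.retract_mem z))]
  have pb : ∀ z, b (z.1 + L, z.2) = b z := fun z => by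
    simp only [hb, hB.retract_add]
    exact S.v_reg.periodic _ (c1.ge (hB.retract_mem z))
  obtain ⟨m, hm, hma⟩ : ∃ m, 0 < m ∧ ∀ z, m ≤ -a z := by
    obtain ⟨m, hm, h⟩ := hB.exists_pos_le (f := fun z => -a z) ka.neg.continuousOn
      (fun z _ => by simp only [pa]) fun z hz => by
        rw [ea z hz]
        linarith [S.no_stagnation z (c1.ge hz)]
    refine ⟨m, hm, fun z => ?_⟩
    have := h _ (hB.retract_mem z)
    simp only [ha, retract_retract hB] at this ⊢
    exact this
  have mass : WeakDivEq (band 0 η) a b fun _ => 0 :=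
    WeakDivEq.congr hD.measurableSet S.mass (fun z hz => (ea z (band_subset_closedBand hz)).symm)
      fun z hz => (eb z (band_subset_closedBand hz)).symm
  have mom₁ : WeakDivEq (band 0 η) (fun z => a z ^ 2 + p z) (fun z => a z * b z) fun _ => 0 := by
    refine WeakDivEq.congr hD.measurableSet S.momentum₁ (fun z hz => ?_) fun z hz => ?_
    · rw [ea z (band_subset_closedBand hz), ep z (band_subset_closedBand hz)]
    · rw [ea z (band_subset_closedBand hz), eb z (band_subset_closedBand hz)]
  have mom₂ : WeakDivEq (band 0 η) (fun z => a z * b z) (fun z => b z ^ 2 + p z)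
      fun _ => -g := by
    refine WeakDivEq.congr hD.measurableSet S.momentum₂ (fun z hz => ?_) fun z hz => ?_
    · rw [ea z (band_subset_closedBand hz), eb z (band_subset_closedBand hz)]
    · rw [eb z (band_subset_closedBand hz), ep z (band_subset_closedBand hz)]
  have b0 : ∀ x, b (x, 0) = 0 := fun x => by rw [eb _ (mb x), S.bottom]
  -- This relative mass flux through the section x = 0 normalises ψ to vanish at the surface point
  -- above the origin; the kinematic condition extends this to the whole surface.
  set p₀ : ℝ := ∫ s in (0 : ℝ)..η 0, a (0, s) with hp₀
  have hp₀neg : p₀ < 0 := by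
    have cs : Continuous fun s => -a (0, s) := by fun_prop
    have := intervalIntegral.intervalIntegral_pos_of_pos_on (cs.intervalIntegrable 0 (η 0))
      (fun s _ => hm.trans_le (hma (0, s))) (S.η_pos 0)
    rw [intervalIntegral.integral_neg] at this
    linarith
  set ψ : ℝ × ℝ → ℝ := fun z => -p₀ + ∫ s in (0 : ℝ)..z.2, a (z.1, s) with hψ
  have dψ : C1Data α L 0 η ψ (fun z => -b z) a :=
    mass.c1Data_vertical_integral hαr hB Ha Hb pa pb b0 (-p₀)
  have ψbot : ∀ x, ψ (x, 0) = -p₀ := fun x => by simp [hψ]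
  have ψtop : ∀ x, ψ (x, η x) = 0 := fun x => by
    have hd : ∀ x, HasDerivAt (fun x => ψ (x, η x)) 0 x := fun x => by
      have := dψ.hasDerivAt_top hαr hB hηd x
      rwa [eb _ (mt x), ea _ (mt x), S.kinematic, neg_add_cancel] at this
    have := is_const_of_deriv_eq_zero (fun x => (hd x).differentiableAt) (fun x => (hd x).deriv) x 0
    rw [this]
    simp [hψ, hp₀]
  have e1 : ∀ z ∈ closedBand 0 η, d₁ (fluidDomain η) ψ z = -b z := fun z hz =>
    dψ.d₁_eq hα₀ (c1.ge hz)
  have e2 : ∀ z ∈ closedBand 0 η, d₂ (fluidDomain η) ψ z = a z := fun z hz =>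
    dψ.d₂_eq hα₀ (c1.ge hz)
  obtain ⟨F, H, k₁, k₂, hF, B⟩ := WaterWaves.exists_bandPair hαr hB dψ.neg hm hma
    (l' := p₀) (η₂ := fun _ => 0) (fun x => by rw [ψbot, neg_neg]) fun x => by rw [ψtop, neg_zero]
  set E : ℝ × ℝ → ℝ := fun z => p z + 1 / 2 * (a z ^ 2 + b z ^ 2) + g * (retract 0 η z).2 with hEd
  have hE : BddHolder (α : ℝ) E := (Hp.add ((BddHolder.const _).mul (Ha.sq.add Hb.sq))).add
    ((BddHolder.const g).mul (hB.bddHolder_retract_snd hαr.le hαr₁))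
  have hA : WeakDivEq (band 0 η) (fun z => -b z * a z)
      (fun z => (-1 / 2) * (-b z * -b z) + (1 / 2) * (a z * a z) + (-1) * E z) fun _ => 0 := by
    have h0 := (mom₂.const_mul (-1)).add (weakDivEq_affine (band 0 η) 0 0 0 (-g)) (by fun_prop)
      (by fun_prop) (by fun_prop) (by fun_prop)
    rw [show (-1 : ℝ) * -g + -g = 0 by ring] at h0
    refine h0.congr hD.measurableSet (fun z _ => by ring) fun z hz => ?_
    simp only [hEd]
    rw [retract_eq_self (band_subset_closedBand hz)]
    ring
  have hM : WeakDivEq (band 0 η)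
      (fun z => (1 / 2) * (-b z * -b z) + (-1 / 2) * (a z * a z) + (-1) * E z)
      (fun z => -b z * a z) fun _ => 0 := by
    have h0 := (mom₁.const_mul (-1)).add (weakDivEq_affine (band 0 η) 0 (-g) 0 0) (by fun_prop)
      (by fun_prop) (by fun_prop) (by fun_prop)
    rw [show (-1 : ℝ) * 0 + 0 = 0 by ring] at h0
    refine h0.congr hD.measurableSet (fun z hz => ?_) fun z _ => by ring
    simp only [hEd]
    rw [retract_eq_self (band_subset_closedBand hz)]
    ring
  have hT := weakC1_transport hα3 hαr₁ hD Hb.neg Ha hE (by simpa only [neg_neg] using mass) hA hM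
  -- The transported field is tangent to the level lines of ψ, so its Piola transform has only a
  -- horizontal component, namely -E.
  have hT' : WeakC1 (band p₀ fun _ => 0) (fun w => -E (w.1, H w)) fun _ => 0 := by
    refine B.weakC1 hαr (fun z _ => ?_) (fun z _ => ?_) hT
    · simp only [B.left_inv]
      ring
    · ring
  obtain ⟨κ, -, hκ⟩ := B.lipschitz_inv
  have hEH : BddHolder (α : ℝ) fun w : ℝ × ℝ => E (w.1, H w) :=
    hE.comp_lipschitz hαr.le (φ := fun w : ℝ × ℝ => (w.1, H w)) (K := max 1 κ) fun w w' => by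
      refine max_le ?_ ((hκ w w').trans ?_)
      · refine le_trans (le_max_left _ _ : _ ≤ dist w w') ?_
        exact le_mul_of_one_le_left (dist_nonneg (x := w) (y := w')) (le_max_left _ _)
      · gcongr
        exact le_max_right _ _
  -- Any vertical section of the strip would serve; q = 0 is chosen.
  set Γ : ℝ → ℝ := fun p => E (0, H (0, p)) with hΓ
  have hΓreg : BddHolder (α : ℝ) Γ :=
    hEH.comp_lipschitz hαr.le (φ := fun p : ℝ => ((0, p) : ℝ × ℝ)) (K := 1) fun p p' => by
      simp [Prod.dist_eq]
  have hEΓ : ∀ z ∈ closedBand 0 η, E z = Γ (F z) := fun z hz => by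
    have := hT'.weakDivEq.eq_of_horizontal hαr hp₀neg hEH.neg z.1 0 (B.mem_Icc hz)
    simp only [B.left_inv, neg_inj] at this
    exact this
  -- On the surface E = Γ(0) and P = `Patm`, hence |∇ψ|² + 2gη = 2(Γ(0) - `Patm`). The constant in
  -- Bernoulli's law is zero because Γ was defined from `E` itself.
  refine ⟨p₀, 2 * (Γ 0 - Patm), Γ, ψ, ⟨hp₀neg, hΓreg.holderOn _, S.η_reg, S.η_pos,
    dψ.c1HolderPer hB, ?_, ψbot, ψtop, fun x => ?_, fun z hz => ?_⟩, ⟨fun z hz => ?_, fun z hz => ?_,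
      0, fun z hz => ?_⟩⟩
  · refine WeakDivEq.congr hD.measurableSet hA (fun z hz => ?_) fun z hz => ?_
    · rw [e1 z (band_subset_closedBand hz), e2 z (band_subset_closedBand hz)]
    · rw [e1 z (band_subset_closedBand hz), e2 z (band_subset_closedBand hz),
        hEΓ z (band_subset_closedBand hz), hF z (band_subset_closedBand hz)]
      ring
  · have := hEΓ _ (mt x)
    rw [hF _ (mt x), ψtop, neg_zero] at this
    rw [e1 _ (mt x), e2 _ (mt x), ← this]
    simp only [hEd]
    rw [ep _ (mt x), S.dynamic, retract_eq_self (mt x)]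
    ring
  · rw [e2 z (c1.le hz)]
    linarith [hma z]
  · rw [e2 z (c1.le hz), ea z (c1.le hz)]
  · rw [e1 z (c1.le hz), eb z (c1.le hz)]
  · have hz := c1.le hz
    have := hEΓ z hz
    rw [hF z hz] at this
    rw [e1 z hz, e2 z hz, ← this]
    simp only [hEd]
    rw [ep z hz, retract_eq_self hz]
    ring

end Equivalence

end

end WaterWaves

/-! ### Equivalence of the three formulations -/

theorem theorem1 (α : ℝ≥0) (hα₀ : 0 < α) (hα₁ : α ≤ 1) (L : ℝ) (hL : 0 < L) (c g Patm : ℝ) :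
    -- stream function and height formulations, for every exponent in (0, 1]
    ((∀ (p₀ Q : ℝ) (Γ η : ℝ → ℝ) (ψ : ℝ × ℝ → ℝ), IsStreamSolution α L g p₀ Q Γ η ψ →
        ∃ h : ℝ × ℝ → ℝ, IsHeightSolution α L g p₀ Q Γ h ∧ StreamHeightCorr p₀ η ψ h ∧
          ∀ q, h (q, 0) = η q) ∧
      (∀ (p₀ Q : ℝ) (Γ : ℝ → ℝ) (h : ℝ × ℝ → ℝ), IsHeightSolution α L g p₀ Q Γ h →
        ∃ (η : ℝ → ℝ) (ψ : ℝ × ℝ → ℝ), IsStreamSolution α L g p₀ Q Γ η ψ ∧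
          StreamHeightCorr p₀ η ψ h ∧ ∀ q, η q = h (q, 0))) ∧
    -- velocity and stream function formulations (hence all three), for exponents in (1/3, 1]
    (1 / 3 < α →
      (∀ (η : ℝ → ℝ) (u v P : ℝ × ℝ → ℝ), IsVelocitySolution α L c g Patm η u v P →
        ∃ (p₀ Q : ℝ) (Γ : ℝ → ℝ) (ψ : ℝ × ℝ → ℝ), IsStreamSolution α L g p₀ Q Γ η ψ ∧
          VelocityStreamCorr c g Γ η u v P ψ) ∧
      (∀ (p₀ Q : ℝ) (Γ η : ℝ → ℝ) (ψ : ℝ × ℝ → ℝ), IsStreamSolution α L g p₀ Q Γ η ψ →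
        ∃ u v P : ℝ × ℝ → ℝ, IsVelocitySolution α L c g Patm η u v P ∧
          VelocityStreamCorr c g Γ η u v P ψ) ∧
      (∀ η : ℝ → ℝ, List.TFAE [
        ∃ u v P : ℝ × ℝ → ℝ, IsVelocitySolution α L c g Patm η u v P,
        ∃ (p₀ Q : ℝ) (Γ : ℝ → ℝ) (ψ : ℝ × ℝ → ℝ), IsStreamSolution α L g p₀ Q Γ η ψ,
        ∃ (p₀ Q : ℝ) (Γ : ℝ → ℝ) (h : ℝ × ℝ → ℝ), IsHeightSolution α L g p₀ Q Γ h ∧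
          ∀ q, h (q, 0) = η q])) := by
  refine ⟨⟨fun p₀ Q Γ η ψ S => S.exists_height hα₀ hL, fun p₀ Q Γ h S => S.exists_stream hα₀ hL⟩,
    fun hα => ⟨fun η u v P S => S.exists_stream hα hα₁ hL,
      fun p₀ Q Γ η ψ S => S.exists_velocity hα hα₁ hL c Patm, fun η => ?_⟩⟩
  tfae_have 1 → 2 := by
    rintro ⟨u, v, P, S⟩
    obtain ⟨p₀, Q, Γ, ψ, S', -⟩ := S.exists_stream hα hα₁ hL
    exact ⟨p₀, Q, Γ, ψ, S'⟩
  tfae_have 2 → 1 := by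
    rintro ⟨p₀, Q, Γ, ψ, S⟩
    obtain ⟨u, v, P, S', -⟩ := S.exists_velocity hα hα₁ hL c Patm
    exact ⟨u, v, P, S'⟩
  tfae_have 2 → 3 := by
    rintro ⟨p₀, Q, Γ, ψ, S⟩
    obtain ⟨h, S', -, hη⟩ := S.exists_height hα₀ hL
    exact ⟨p₀, Q, Γ, h, S', hη⟩
  tfae_have 3 → 2 := by
    rintro ⟨p₀, Q, Γ, h, S, hη⟩
    obtain ⟨η', ψ, S', -, hη'⟩ := S.exists_stream hα₀ hL
    obtain rfl : η' = η := funext fun q => (hη' q).trans (hη q)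
    exact ⟨p₀, Q, Γ, ψ, S'⟩
  tfae_finish
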